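/- Consider elections with voters $1,\dots,n$ over a set $C$ of $m\ge 3$ candidates under 2-approval: each voter submits a linear order over $C$, each candidate gets one point from every voter who ranks her in the top two positions, and the winner is the candidate with the highest score, ties being broken by a fixed linear order $>$ on $C$. Let $\mathcal R(W)$ be the winner at a profile $W$, let $V=(v_1,\dots,v_n)$ be the profile of sincere preferences, and write $c\succ_i d$ if $v_i$ ranks $c$ above $d$. A vote $v_i'$ is a manipulative vote of voter $i$ if $\mathcal R(V_{-i},v_i')\succ_i\mathcal R(V)$, and $N$ is the set of voters who have a manipulative vote. A vote $v_i'$ is a level-1 strategy of $i$ if $\mathcal R(V_{-i},v_i')$ is the candidate that $i$ likes best among all candidates of the form $\mathcal R(V_{-i},v)$. For $\ell$-element sets $X=\{x_1,\dots,x_\ell\}\subseteq\mathrm{top}_2(v_i)$ and $Y=\{y_1,\dots,y_\ell\}\subseteq C\setminus\mathrm{top}_2(v_i)$, let $v_i[X;Y]$ be the vote obtained from $v_i$ by swapping $x_j$ with $y_j$ for all $j$. A manipulative vote $v_i[X;Y]$ is a minimal manipulation of $i$ if for every other manipulative vote $v_i'$ of $i$ there is a vote $v_i[X';Y']$ with $|X'|\ge|X|$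 that is equivalent to $v_i'$, that is, replacing one of these two votes by the other in any $n$-voter profile never changes the winner. A GS-game $(V,\mathcal R,(A_i)_{i\in N})$ has the player set $N\cup\{1\}$; the strategy set $A_i$ of a player $i\in N\setminus\{1\}$ consists of $v_i$ and a (possibly empty) set of level-1 strategies of $i$, player 1 may submit any linear order over $C$, and all voters who are not players vote truthfully. A strategy $u$ of player 1 weakly dominates a strategy $v$ of player 1 if, for every choice of strategies of the other players, the winner when player 1 submits $u$ is equal to, or preferred by player 1 (according to $v_1$) to, the winner when he submits $v$, and for at least one such choice it is strictly preferred. Theorem. There is a polynomial-time algorithm that, given $V$, the tie-breaking order $>$, a GS-game $(V,\mathcal R,(A_i)_{i\in N})$ under 2-approval (with the sets $A_i$, $i\in N\setminus\{1\}$, listed explicitly) in which, for each $i\in N\setminus\{1\}$, the set $A_i$ consists of the truthful vote $v_i$ and a subset of the minimal manipulations of $i$, and two strategies $v_1',v_1''$ of player 1, decides whether $v_1'$ weakly dominates $v_1''$. -/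

import Mathlib

/-! ### Computation model: while-programs over integer variables and arrays, with a step count -/

namespace RAM

/-- Arithmetic expressions over natural-number variables `x₀, x₁, …` and one-dimensional arrays
`a₀, a₁, …`. The only operations are addition and truncated subtraction (no multiplication), so
that an execution of `t` steps handles numbers of at most `O(t + input size)` bits, and the number
of steps is polynomially related to the running time of a Turing machine. -/
inductive Expr : Type where
  /-- a constant -/
  | num (c : ℕ)
  /-- the value of the variable `x` -/
  | var (x : ℕ)
  /-- the cell of the array `a` whose index is the value of `e` -/
  | get (a : ℕ) (e : Expr)
  /-- addition -/
  | add (e₁ e₂ : Expr)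
  /-- truncated subtraction -/
  | sub (e₁ e₂ : Expr)

/-- Memory contents. A program mentions only finitely many variables and arrays. -/
structure State where
  /-- values of the variables -/
  vars : ℕ → ℕ
  /-- contents of the arrays: `arrs a j` is cell `j` of array `a` -/
  arrs : ℕ → ℕ → ℕ

/-- The value of an expression. -/
def Expr.eval (s : State) : Expr → ℕ
  | .num c => c
  | .var x => s.vars x
  | .get a e => s.arrs a (e.eval s)
  | .add e₁ e₂ => e₁.eval s + e₂.eval s
  | .sub e₁ e₂ => e₁.eval s - e₂.eval s

/-- The number of steps needed to evaluate an expression: one for every symbol in it. -/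
def Expr.cost : Expr → ℕ
  | .num _ => 1
  | .var _ => 1
  | .get _ e => e.cost + 1
  | .add e₁ e₂ => e₁.cost + e₂.cost + 1
  | .sub e₁ e₂ => e₁.cost + e₂.cost + 1

/-- Programs. A test `e` succeeds if its value is not zero. -/
inductive Prog : Type where
  /-- do nothing -/
  | skip
  /-- `x := e` -/
  | assign (x : ℕ) (e : Expr)
  /-- `a[e₁] := e₂` -/
  | put (a : ℕ) (e₁ e₂ : Expr)
  /-- sequential composition -/
  | seq (P Q : Prog)
  /-- `if e ≠ 0 then P else Q` -/
  | ite (e : Expr) (P Q : Prog)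
  /-- `while e ≠ 0 do P` -/
  | loop (e : Expr) (P : Prog)

/-- `Run P s s' t`: started in the memory `s`, the program `P` halts in the memory `s'` after
exactly `t` steps. -/
inductive Run : Prog → State → State → ℕ → Prop where
  | skip (s : State) : Run .skip s s 1
  | assign (x : ℕ) (e : Expr) (s : State) :
      Run (.assign x e) s ⟨Function.update s.vars x (e.eval s), s.arrs⟩ (e.cost + 1)
  | put (a : ℕ) (e₁ e₂ : Expr) (s : State) :
      Run (.put a e₁ e₂) s
        ⟨s.vars, Function.update s.arrs a (Function.update (s.arrs a) (e₁.eval s) (e₂.eval s))⟩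
        (e₁.cost + e₂.cost + 1)
  | seq {P Q : Prog} {s₁ s₂ s₃ : State} {t₁ t₂ : ℕ} :
      Run P s₁ s₂ t₁ → Run Q s₂ s₃ t₂ → Run (.seq P Q) s₁ s₃ (t₁ + t₂)
  | iteTrue {e : Expr} {P Q : Prog} {s s' : State} {t : ℕ} :
      e.eval s ≠ 0 → Run P s s' t → Run (.ite e P Q) s s' (e.cost + 1 + t)
  | iteFalse {e : Expr} {P Q : Prog} {s s' : State} {t : ℕ} :
      e.eval s = 0 → Run Q s s' t → Run (.ite e P Q) s s' (e.cost + 1 + t)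
  | loopDone {e : Expr} {P : Prog} {s : State} :
      e.eval s = 0 → Run (.loop e P) s s (e.cost + 1)
  | loopStep {e : Expr} {P : Prog} {s₁ s₂ s₃ : State} {t₁ t₂ : ℕ} :
      e.eval s₁ ≠ 0 → Run P s₁ s₂ t₁ → Run (.loop e P) s₂ s₃ t₂ →
      Run (.loop e P) s₁ s₃ (e.cost + 1 + t₁ + t₂)

/-- The initial memory on an input word: array `0` holds the word, variable `0` its length, and
everything else is `0`. -/
def initial (input : List ℕ) : State where
  vars := fun x => if x = 0 then input.length else 0
  arrs := fun a j => if a = 0 then input.getD j 0 else 0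

/-- The size of an input word: the total number of binary digits of its entries, plus one
separator for each entry. -/
def inputSize (input : List ℕ) : ℕ :=
  (input.map fun x => Nat.size x + 1).sum

/-- On the given input, `P` halts after at most `T` steps, and its answer, which it leaves in
variable `0`, is `1` if `Q` holds and `0` if `Q` does not hold. -/
def Prog.DecidesWithin (P : Prog) (input : List ℕ) (Q : Prop) (T : ℕ) : Prop :=
  ∃ (s : State) (t : ℕ), Run P (initial input) s t ∧ t ≤ T ∧
    ((Q ∧ s.vars 0 = 1) ∨ (¬ Q ∧ s.vars 0 = 0))

end RAM

/-! ### Votes, profiles and `k`-approval -/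

namespace Voting

/-- A linear order on the candidates `Fin m`, as a ranking: `v r` is the candidate in position `r`
(position `0` is the top), and `v.symm c` is the position of the candidate `c`. -/
abbrev Vote (m : ℕ) : Type := Equiv.Perm (Fin m)

/-- A preference profile of the voters `Fin n`. -/
abbrev Profile (n m : ℕ) : Type := Fin n → Vote m

/-- `c` is ranked strictly above `d` in `v`. -/
def Vote.Prefers {m : ℕ} (v : Vote m) (c d : Fin m) : Prop := v.symm c < v.symm d

instance {m : ℕ} (v : Vote m) (c d : Fin m) : Decidable (Vote.Prefers v c d) :=
  inferInstanceAs (Decidable (v.symm c < v.symm d))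

/-- The set of the top `k` candidates of `v`. -/
def Vote.top {m : ℕ} (k : ℕ) (v : Vote m) : Finset (Fin m) :=
  Finset.univ.filter fun c => (v.symm c : ℕ) < k

/-- The `k`-approval score of `c`: the number of voters who rank `c` among their top `k`. -/
def score {n m : ℕ} (k : ℕ) (V : Profile n m) (c : Fin m) : ℕ :=
  (Finset.univ.filter fun i => c ∈ Vote.top k (V i)).card

theorem exists_max_score {n m : ℕ} [NeZero m] (k : ℕ) (tie : Vote m) (V : Profile n m) :
    (Finset.univ.filter fun r => ∀ d, score k V d ≤ score k V (tie r)).Nonempty := by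
  obtain ⟨c, -, hc⟩ := Finset.exists_max_image Finset.univ (score k V) Finset.univ_nonempty
  exact ⟨tie.symm c, by simpa using hc⟩

/-- The `k`-approval winner: among the candidates with the highest score, the one that the
tie-breaking order `tie` ranks highest. -/
def winner {n m : ℕ} [NeZero m] (k : ℕ) (tie : Vote m) (V : Profile n m) : Fin m :=
  tie ((Finset.univ.filter fun r => ∀ d, score k V d ≤ score k V (tie r)).min'
    (exists_max_score k tie V))

/-- `v'` is a manipulative vote of voter `i` at `V`. -/
def IsManipulative {n m : ℕ} [NeZero m] (k : ℕ) (tie : Vote m) (V : Profile n m) (i : Fin n)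
    (v' : Vote m) : Prop :=
  Vote.Prefers (V i) (winner k tie (Function.update V i v')) (winner k tie V)

/-- Voter `i` is a Gibbard–Satterthwaite manipulator at `V`. -/
def IsGSManipulator {n m : ℕ} [NeZero m] (k : ℕ) (tie : Vote m) (V : Profile n m)
    (i : Fin n) : Prop :=
  ∃ v' : Vote m, IsManipulative k tie V i v'

/-- The candidates that are feasible for voter `i` at `V`. -/
def feasible {n m : ℕ} [NeZero m] (k : ℕ) (tie : Vote m) (V : Profile n m) (i : Fin n) :
    Set (Fin m) :=
  {c | ∃ v' : Vote m, winner k tie (Function.update V i v') = c}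

/-- `v'` is a level-1 strategy of voter `i` at `V`. -/
def IsLevelOne {n m : ℕ} [NeZero m] (k : ℕ) (tie : Vote m) (V : Profile n m) (i : Fin n)
    (v' : Vote m) : Prop :=
  ∀ c ∈ feasible k tie V i, c ≠ winner k tie (Function.update V i v') →
    Vote.Prefers (V i) (winner k tie (Function.update V i v')) c

/-- `u` and `v` are equivalent with respect to `k`-approval for `n` voters: replacing one by the
other as the vote of any voter never changes the winner. -/
def Equivalent {m : ℕ} [NeZero m] (n k : ℕ) (tie : Vote m) (u v : Vote m) : Prop :=
  ∀ (i : Fin n) (W : Profile n m),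
    winner k tie (Function.update W i u) = winner k tie (Function.update W i v)

/-- `v' = v[X; Y]` for some `X = {x₁, …, x_ℓ}` contained in the top `k` of `v` and some
`Y = {y₁, …, y_ℓ}` disjoint from it: `v'` is obtained from `v` by swapping `x_j` with `y_j` for
every `j`. -/
def IsSwap {m : ℕ} (k : ℕ) (v : Vote m) (ℓ : ℕ) (v' : Vote m) : Prop :=
  ∃ x y : Fin ℓ ↪ Fin m,
    (∀ j, x j ∈ Vote.top k v) ∧ (∀ j, y j ∉ Vote.top k v) ∧
    (∀ j, v'.symm (x j) = v.symm (y j) ∧ v'.symm (y j) = v.symm (x j)) ∧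
    (∀ c, c ∉ Set.range x → c ∉ Set.range y → v'.symm c = v.symm c)

/-- `v'` is a minimal manipulation of voter `i` at `V`: it is a manipulative vote of the form
`v_i[X; Y]`, and every other manipulative vote of `i` is equivalent to some `v_i[X'; Y']` with
`|X'| ≥ |X|`. -/
def IsMinimalManipulation {n m : ℕ} [NeZero m] (k : ℕ) (tie : Vote m) (V : Profile n m)
    (i : Fin n) (v' : Vote m) : Prop :=
  IsManipulative k tie V i v' ∧
  ∃ ℓ : ℕ, IsSwap k (V i) ℓ v' ∧
    ∀ v'' : Vote m, v'' ≠ v' → IsManipulative k tie V i v'' →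
      ∃ (ℓ' : ℕ) (u : Vote m), IsSwap k (V i) ℓ' u ∧ Equivalent n k tie u v'' ∧ ℓ ≤ ℓ'

/-! ### GS-games -/

/-- A GS-game for `k`-approval with `n` voters and `m` candidates. The distinguished voter
("player 1") is `0 : Fin n`; the players are voter `0` and all GS-manipulators. Voter `0` may submit
any vote. For every other player `i`, `A i` lists the strategy set of `i`, which consists of the
truthful vote and some level-1 strategies of `i`; for all other `i` nothing is listed. -/
structure GSGame (k n m : ℕ) [NeZero n] [NeZero m] where
  /-- `k` is at least one -/
  one_le_k : 1 ≤ k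
  /-- `k` is at most `m - 1` -/
  k_lt_m : k < m
  /-- the tie-breaking order -/
  tie : Vote m
  /-- the profile of sincere preferences -/
  V : Profile n m
  /-- the strategy sets of the players other than `0` -/
  A : Fin n → List (Vote m)
  /-- voter `0` and the voters who are not players have no list -/
  A_eq_nil : ∀ i, (i = 0 ∨ ¬ IsGSManipulator k tie V i) → A i = []
  /-- the truthful vote is a strategy -/
  truthful_mem : ∀ i, i ≠ 0 → IsGSManipulator k tie V i → V i ∈ A i
  /-- every other strategy is a level-1 strategy -/
  levelOne : ∀ i, i ≠ 0 → IsGSManipulator k tie V i →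
    ∀ v ∈ A i, v = V i ∨ IsLevelOne k tie V i v

namespace GSGame

variable {k n m : ℕ} [NeZero n] [NeZero m]

/-- `W` is the preference profile that results from a strategy profile of the game: players other
than `0` use one of their strategies, voter `0` votes arbitrarily, and all remaining voters vote
truthfully. -/
def IsGSProfile (G : GSGame k n m) (W : Profile n m) : Prop :=
  ∀ i, i ≠ 0 →
    (IsGSManipulator k G.tie G.V i → W i ∈ G.A i) ∧
    (¬ IsGSManipulator k G.tie G.V i → W i = G.V i)

/-- Voter `0` strictly prefers the outcome at `W` to the outcome at `W'`. -/
def StrictlyBetter (G : GSGame k n m) (W W' : Profile n m) : Prop :=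
  Vote.Prefers (G.V 0) (winner k G.tie W) (winner k G.tie W')

/-- Voter `0` finds the outcome at `W` at least as good as the outcome at `W'`. -/
def AtLeastAsGood (G : GSGame k n m) (W W' : Profile n m) : Prop :=
  G.StrictlyBetter W W' ∨ winner k G.tie W = winner k G.tie W'

/-- The strategy `u` of voter `0` weakly dominates the strategy `v` of voter `0`. -/
def WeaklyDominates (G : GSGame k n m) (u v : Vote m) : Prop :=
  (∀ W, G.IsGSProfile W →
    G.AtLeastAsGood (Function.update W 0 u) (Function.update W 0 v)) ∧
  ∃ W, G.IsGSProfile W ∧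
    G.StrictlyBetter (Function.update W 0 u) (Function.update W 0 v)

/-- The strategy set of every player other than `0` consists of the truthful vote and some of the
minimal manipulations of that player. -/
def OthersMinimal (G : GSGame k n m) : Prop :=
  ∀ i, i ≠ 0 → IsGSManipulator k G.tie G.V i →
    ∀ v ∈ G.A i, v = G.V i ∨ IsMinimalManipulation k G.tie G.V i v

end GSGame

/-- A vote is written as the list of the candidates from top to bottom. -/
def encodeVote {m : ℕ} (v : Vote m) : List ℕ := List.ofFn fun r => (v r : ℕ)

/-- The input word for a game and two strategies `u`, `v` of voter `0`: the numbers `n` and `m`,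
the tie-breaking order, `u`, `v`, the sincere votes of all voters, and for every voter the number
of strategies listed for that voter followed by these strategies. -/
def GSGame.encode {k n m : ℕ} [NeZero n] [NeZero m] (G : GSGame k n m) (u v : Vote m) : List ℕ :=
  [n, m] ++ encodeVote G.tie ++ encodeVote u ++ encodeVote v ++
    (List.finRange n).flatMap (fun i => encodeVote (G.V i)) ++
    (List.finRange n).flatMap (fun i => (G.A i).length :: (G.A i).flatMap encodeVote)

end Voting

/-! Why it is true. Fix a winner c when voter `0` votes `u`, a different winner d when he votes `v`,
and the points τ, τ' that the other voters give to c and d. There are polynomially many such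
quadruples, and weak dominance only asks which of them occur in the game (`weaklyDominates_iff`).
For a fixed quadruple the two winning conditions say that c and d get exactly τ and τ' from the
others and that every other candidate stays within an explicit capacity; tie-breaking costs at most
one point (`othersWinner_iff`).

So each voter i ≠ 0 places two tokens according to one of his options, and the question is whether
the capacities can be met. The crucial fact is that any two options of one voter share an approved
candidate (`OthersMinimal.inter_nonempty`). A minimal manipulation keeps a sincerely approved
candidate: if a manipulation drops both, some manipulation keeps the favourite, against minimality.
Two level-1 manipulations elect the same candidate, and if they are minimal both approve of this
candidate. Hence a change of option moves exactly one token, and the problem behaves like a flow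
problem. Filler tokens on candidates other than c and d bring the number of tokens up to the total
capacity, so that upper bounds alone force the exact scores of c and d (`Owners.outcome_iff`).

A push-relabel algorithm solves the distribution problem. Its invariant survives pushes because the
options of an agent pairwise intersect (`Inv.step`), a potential bounds the number of steps
(`Step.potential_lt`), and an overloaded candidate of full height yields a set of candidates that is
overloaded in every allocation (`Inv.not_feasible`). These facts give `Runs.feasible_iff`.

The algorithm is written in a small language in which every loop runs B times, where B is the length
of the input word. Its running time is then polynomial by its syntax alone
(`Cmd.exists_decidesWithin`), and only the meaning of the program remains to be checked
(`mainCmd_correct`). -/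

/-! ### Structured programs whose loops all run `B` times -/

namespace RAM

/-- Assign `v` to the variable `x`. -/
def State.set (s : State) (x v : ℕ) : State := ⟨Function.update s.vars x v, s.arrs⟩

/-- Store `v` in cell `j` of the array `a`. -/
def State.put (s : State) (a j v : ℕ) : State :=
  ⟨s.vars, Function.update s.arrs a (Function.update (s.arrs a) j v)⟩

@[simp] theorem State.set_vars (s : State) (x v : ℕ) :
    (s.set x v).vars = Function.update s.vars x v := rfl

@[simp] theorem State.set_arrs (s : State) (x v : ℕ) : (s.set x v).arrs = s.arrs := rfl

@[simp] theorem State.put_vars (s : State) (a j v : ℕ) : (s.put a j v).vars = s.vars := rfl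

@[simp] theorem State.put_arrs (s : State) (a j v : ℕ) :
    (s.put a j v).arrs = Function.update s.arrs a (Function.update (s.arrs a) j v) := rfl

/-- The last index below `i` at which `f` does not vanish, or `B` if there is none. -/
def lastIndex (f : ℕ → ℕ) (B : ℕ) : ℕ → ℕ
  | 0 => B
  | i + 1 => if f i ≠ 0 then i else lastIndex f B i

theorem lastIndex_spec (f : ℕ → ℕ) (B i : ℕ) :
    (lastIndex f B i < i ∧ f (lastIndex f B i) ≠ 0) ∨
      (lastIndex f B i = B ∧ ∀ j < i, f j = 0) := by
  induction i with
  | zero => right; simp [lastIndex]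
  | succ i ih =>
    by_cases h : f i = 0
    · simp only [lastIndex, h, ne_eq, not_true_eq_false, if_false]
      rcases ih with ⟨h1, h2⟩ | ⟨h1, h2⟩
      · exact .inl ⟨by omega, h2⟩
      · refine .inr ⟨h1, fun j hj => ?_⟩
        rcases Nat.lt_succ_iff_lt_or_eq.1 hj with hj | rfl
        · exact h2 j hj
        · exact h
    · left; simp [lastIndex, h]

theorem lastIndex_lt {f : ℕ → ℕ} {B : ℕ} (h : lastIndex f B B < B) :
    f (lastIndex f B B) ≠ 0 := by
  rcases lastIndex_spec f B B with h' | h'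
  · exact h'.2
  · omega

theorem lastIndex_not_lt {f : ℕ → ℕ} {B : ℕ} (h : ¬ lastIndex f B B < B) :
    ∀ j < B, f j = 0 := by
  rcases lastIndex_spec f B B with h' | h'
  · omega
  · exact h'.2

theorem lastIndex_of_exists {f : ℕ → ℕ} {B j : ℕ} (hj : j < B) (h : f j ≠ 0) :
    lastIndex f B B < B ∧ f (lastIndex f B B) ≠ 0 := by
  by_cases hl : lastIndex f B B < B
  · exact ⟨hl, lastIndex_lt hl⟩
  · exact absurd (lastIndex_not_lt hl j hj) h

/-- Terms: arithmetic expressions with sums and searches over all indices below a bound `B`. -/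
inductive Tm : Type where
  | num (c : ℕ)
  | var (x : ℕ)
  | bound
  | get (a : ℕ) (t : Tm)
  | add (t₁ t₂ : Tm)
  | sub (t₁ t₂ : Tm)
  | ite (t t₁ t₂ : Tm)
  | sum (x : ℕ) (t : Tm)
  | find (x : ℕ) (t : Tm)

/-- The value of a term. -/
def Tm.eval (B : ℕ) : Tm → State → ℕ
  | .num c, _ => c
  | .var x, s => s.vars x
  | .bound, _ => B
  | .get a t, s => s.arrs a (t.eval B s)
  | .add t₁ t₂, s => t₁.eval B s + t₂.eval B s
  | .sub t₁ t₂, s => t₁.eval B s - t₂.eval B s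
  | .ite t t₁ t₂, s => if t.eval B s ≠ 0 then t₁.eval B s else t₂.eval B s
  | .sum x t, s => ∑ j ∈ Finset.range B, t.eval B (s.set x j)
  | .find x t, s => lastIndex (fun j => t.eval B (s.set x j)) B B

/-- Structured programs. -/
inductive Cmd : Type where
  | set (x : ℕ) (t : Tm)
  | put (a : ℕ) (t₁ t₂ : Tm)
  | seq (C D : Cmd)
  | ite (t : Tm) (C D : Cmd)
  | skip
  | loop (x : ℕ) (C : Cmd)

/-- Run `f 0`, …, `f (i - 1)` one after the other. -/
def iterate (f : ℕ → State → State) : ℕ → State → State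
  | 0, s => s
  | i + 1, s => f i (iterate f i s)

theorem iterate_induction {f : ℕ → State → State} {s : State} {B : ℕ} (I : ℕ → State → Prop)
    (h0 : I 0 s) (hs : ∀ i < B, ∀ s, I i s → I (i + 1) (f i s)) : I B (iterate f B s) := by
  induction B with
  | zero => exact h0
  | succ B ih => exact hs B (by omega) _ (ih fun i hi => hs i (by omega))

/-- The effect of a structured program. -/
def Cmd.sem (B : ℕ) : Cmd → State → State
  | .set x t, s => s.set x (t.eval B s)
  | .put a t₁ t₂, s => s.put a (t₁.eval B s) (t₂.eval B s)
  | .seq C D, s => D.sem B (C.sem B s)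
  | .ite t C D, s => if t.eval B s ≠ 0 then C.sem B s else D.sem B s
  | .skip, s => s
  | .loop x C, s => iterate (fun j s => C.sem B (s.set x j)) B s

/-! ### Compilation -/

/-- Run `P` for `j = 0, …, B - 1`, where the bound `B` is kept in variable `1`. -/
def countLoop (j : ℕ) (P : Prog) : Prog :=
  .seq (.assign j (.num 0))
    (.loop (.sub (.var 1) (.var j)) (.seq P (.assign j (.add (.var j) (.num 1)))))

/-- Besides the body, a round costs 4 steps for the test and 4 for the increment; the final test and
the initialisation account for the remaining 6. -/
theorem run_countLoop {j : ℕ} {P : Prog} {B T : ℕ} (I : ℕ → State → Prop) {σ : State}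
    (h0 : I 0 (σ.set j 0)) (hI : ∀ i σ, I i σ → σ.vars j = i ∧ σ.vars 1 = B)
    (step : ∀ i < B, ∀ σ, I i σ → ∃ σ' t, Run P σ σ' t ∧ t ≤ T ∧ σ'.vars j = i ∧
      I (i + 1) (σ'.set j (i + 1))) :
    ∃ σ' t, Run (countLoop j P) σ σ' t ∧ t ≤ B * (T + 8) + 6 ∧ I B σ' := by
  -- Induction on the number r of rounds that remain, because `Run.loopStep` splits off the first
  -- round.
  have key : ∀ r i, i + r = B → ∀ σ, I i σ → ∃ σ' t,
      Run (.loop (.sub (.var 1) (.var j)) (.seq P (.assign j (.add (.var j) (.num 1))))) σ σ' t ∧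
        t ≤ r * (T + 8) + 4 ∧ I B σ' := by
    intro r
    induction r with
    | zero =>
      intro i hi σ h
      obtain rfl : i = B := by omega
      refine ⟨σ, _, Run.loopDone ?_, ?_, h⟩
      · simp [Expr.eval, (hI _ _ h).1, (hI _ _ h).2]
      · simp [Expr.cost]
    | succ r ih =>
      intro i hi σ h
      obtain ⟨σ₁, t₁, hr₁, ht₁, hj, h₁⟩ := step i (by omega) σ h
      obtain ⟨σ₂, t₂, hr₂, ht₂, h₂⟩ := ih (i + 1) (by omega) _ h₁
      have ha := Run.assign j (.add (.var j) (.num 1)) σ₁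
      simp only [Expr.eval, hj] at ha
      refine ⟨σ₂, _, Run.loopStep ?_ (Run.seq hr₁ ha) hr₂, ?_, h₂⟩
      · simp only [Expr.eval, (hI _ _ h).1, (hI _ _ h).2]; omega
      · simp only [Expr.cost]
        rw [Nat.succ_mul]; omega
  obtain ⟨σ', t, hr, ht, h⟩ := key B 0 (by omega) _ h0
  exact ⟨σ', _, Run.seq (Run.assign j (.num 0) σ) hr, by simp only [Expr.cost]; omega, h⟩

/-- A loop over the values of the named variable `x`; the named variable `x` is represented by
variable `2 * x`, and the auxiliary variable `k` by variable `2 * k + 1`. -/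
def foldProg (x k : ℕ) (init : Expr) (P upd : Prog) : Prog :=
  .seq (.assign (2 * k + 1) init) (.seq (.assign (2 * (k + 2) + 1) (.var (2 * x)))
    (.seq (countLoop (2 * (k + 1) + 1)
      (.seq (.assign (2 * x) (.var (2 * (k + 1) + 1))) (.seq P upd)))
      (.assign (2 * x) (.var (2 * (k + 2) + 1)))))

/-- Compute the value of a term in the auxiliary variable `k`. -/
def Tm.compile : Tm → ℕ → Prog
  | .num c, k => .assign (2 * k + 1) (.num c)
  | .var x, k => .assign (2 * k + 1) (.var (2 * x))
  | .bound, k => .assign (2 * k + 1) (.var 1)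
  | .get a t, k => .seq (t.compile k) (.assign (2 * k + 1) (.get a (.var (2 * k + 1))))
  | .add t₁ t₂, k => .seq (t₁.compile k) (.seq (t₂.compile (k + 1))
      (.assign (2 * k + 1) (.add (.var (2 * k + 1)) (.var (2 * (k + 1) + 1)))))
  | .sub t₁ t₂, k => .seq (t₁.compile k) (.seq (t₂.compile (k + 1))
      (.assign (2 * k + 1) (.sub (.var (2 * k + 1)) (.var (2 * (k + 1) + 1)))))
  | .ite t t₁ t₂, k => .seq (t.compile k)
      (.ite (.var (2 * k + 1)) (t₁.compile k) (t₂.compile k))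
  | .sum x t, k => foldProg x k (.num 0) (t.compile (k + 3))
      (.assign (2 * k + 1) (.add (.var (2 * k + 1)) (.var (2 * (k + 3) + 1))))
  | .find x t, k => foldProg x k (.var 1) (t.compile (k + 3))
      (.ite (.var (2 * (k + 3) + 1)) (.assign (2 * k + 1) (.var (2 * (k + 1) + 1))) .skip)

open Polynomial in
/-- A bound on the running time of a compiled term, as a polynomial in the bound `B`. -/
noncomputable def Tm.cost : Tm → Polynomial ℕ
  | .num _ => 2
  | .var _ => 2
  | .bound => 2
  | .get _ t => t.cost + 3
  | .add t₁ t₂ => t₁.cost + t₂.cost + 4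
  | .sub t₁ t₂ => t₁.cost + t₂.cost + 4
  | .ite t t₁ t₂ => t.cost + t₁.cost + t₂.cost + 2
  | .sum _ t => X * (t.cost + 14) + 12
  | .find _ t => X * (t.cost + 14) + 12

/-- Compile a structured program that may use the auxiliary variables from `k` on. -/
def Cmd.compile : Cmd → ℕ → Prog
  | .set x t, k => .seq (t.compile k) (.assign (2 * x) (.var (2 * k + 1)))
  | .put a t₁ t₂, k => .seq (t₁.compile k) (.seq (t₂.compile (k + 1))
      (.put a (.var (2 * k + 1)) (.var (2 * (k + 1) + 1))))
  | .seq C D, k => .seq (C.compile k) (D.compile k)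
  | .ite t C D, k => .seq (t.compile k) (.ite (.var (2 * k + 1)) (C.compile k) (D.compile k))
  | .skip, _ => .skip
  | .loop x C, k => countLoop (2 * k + 1)
      (.seq (.assign (2 * x) (.var (2 * k + 1))) (C.compile (k + 1)))

open Polynomial in
/-- A bound on the running time of a compiled structured program. -/
noncomputable def Cmd.cost : Cmd → Polynomial ℕ
  | .set _ t => t.cost + 2
  | .put _ t₁ t₂ => t₁.cost + t₂.cost + 3
  | .seq C D => C.cost + D.cost
  | .ite t C D => t.cost + C.cost + D.cost + 2
  | .skip => 1
  | .loop _ C => X * (C.cost + 10) + 6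

/-- The memory `σ` of a compiled program represents the memory `s` of a structured program. -/
structure Rep (B : ℕ) (s σ : State) : Prop where
  vars : ∀ x, σ.vars (2 * x) = s.vars x
  arrs : σ.arrs = s.arrs
  bound : σ.vars 1 = B

/-- The auxiliary variables below `k` are unchanged. -/
def Keeps (k : ℕ) (σ σ' : State) : Prop := ∀ j < k, σ'.vars (2 * j + 1) = σ.vars (2 * j + 1)

theorem Keeps.trans {k : ℕ} {σ₁ σ₂ σ₃ : State} (h : Keeps k σ₁ σ₂) (h' : Keeps k σ₂ σ₃) :
    Keeps k σ₁ σ₃ := fun j hj => (h' j hj).trans (h j hj)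

theorem Keeps.mono {k l : ℕ} {σ σ' : State} (h : Keeps k σ σ') (hl : l ≤ k) : Keeps l σ σ' :=
  fun j hj => h j (hj.trans_le hl)

theorem keeps_set {k l v : ℕ} {σ : State} (h : k ≤ l) : Keeps k σ (σ.set (2 * l + 1) v) :=
  fun j hj => by simp [Function.update_of_ne (show 2 * j + 1 ≠ 2 * l + 1 by omega)]

theorem keeps_set_even {k x v : ℕ} {σ : State} : Keeps k σ (σ.set (2 * x) v) :=
  fun j _ => by simp [Function.update_of_ne (show 2 * j + 1 ≠ 2 * x by omega)]

theorem Rep.set_aux {B k v : ℕ} {s σ : State} (h : Rep B s σ) (hk : 1 ≤ k) :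
    Rep B s (σ.set (2 * k + 1) v) where
  vars x := by
    simp [Function.update_of_ne (show 2 * x ≠ 2 * k + 1 by omega), h.vars]
  arrs := h.arrs
  bound := by simp [Function.update_of_ne (show 1 ≠ 2 * k + 1 by omega), h.bound]

theorem Rep.set_var {B x v : ℕ} {s σ : State} (h : Rep B s σ) :
    Rep B (s.set x v) (σ.set (2 * x) v) where
  vars y := by
    by_cases hy : y = x
    · subst hy; simp
    · simp [Function.update_of_ne (show 2 * y ≠ 2 * x by omega), Function.update_of_ne hy, h.vars]
  arrs := h.arrs
  bound := by simp [Function.update_of_ne (show 1 ≠ 2 * x by omega), h.bound]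

theorem Rep.put {B a j v : ℕ} {s σ : State} (h : Rep B s σ) :
    Rep B (s.put a j v) (σ.put a j v) where
  vars := h.vars
  arrs := by simp [h.arrs]
  bound := h.bound

theorem State.set_set (s : State) (x v w : ℕ) : (s.set x v).set x w = s.set x w := by
  simp [State.set]

theorem State.set_eq_self {s : State} {x v : ℕ} (h : s.vars x = v) : s.set x v = s := by
  subst h; simp [State.set]

/-- Slots k, k + 1 and k + 2 hold the accumulated value, the counter and the old value of `x`, so
the body may use the slots from k + 3 on. Restoring `x` at the end is what makes the evaluation of a
term free of side effects on `s`. The value `acc i` is the one accumulated before round i. -/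
theorem run_foldProg {B x k T : ℕ} (hk : 1 ≤ k) {init : Expr} {P upd : Prog} {s σ : State}
    (val acc : ℕ → ℕ) (hi : init.cost = 1) (h0 : init.eval σ = acc 0) (hrep : Rep B s σ)
    (hP : ∀ j σ, Rep B (s.set x j) σ → ∃ σ' t, Run P σ σ' t ∧ t ≤ T ∧ Rep B (s.set x j) σ' ∧
      Keeps (k + 3) σ σ' ∧ σ'.vars (2 * (k + 3) + 1) = val j)
    (hupd : ∀ i σ, σ.vars (2 * k + 1) = acc i → σ.vars (2 * (k + 3) + 1) = val i →
      σ.vars (2 * (k + 1) + 1) = i →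
      ∃ t, Run upd σ (σ.set (2 * k + 1) (acc (i + 1))) t ∧ t ≤ 4) :
    ∃ σ' t, Run (foldProg x k init P upd) σ σ' t ∧ t ≤ B * (T + 14) + 12 ∧ Rep B s σ' ∧
      Keeps k σ σ' ∧ σ'.vars (2 * k + 1) = acc B := by
  set σ₁ := σ.set (2 * k + 1) (acc 0) with hσ₁
  set σ₂ := σ₁.set (2 * (k + 2) + 1) (s.vars x) with hσ₂
  have r₁ : Run (.assign (2 * k + 1) init) σ σ₁ 2 := by
    have := Run.assign (2 * k + 1) init σ
    rwa [h0, hi] at this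
  have hrep₁ : Rep B s σ₁ := hrep.set_aux hk
  have r₂ : Run (.assign (2 * (k + 2) + 1) (.var (2 * x))) σ₁ σ₂ 2 := by
    have := Run.assign (2 * (k + 2) + 1) (.var (2 * x)) σ₁
    simp only [Expr.eval, Expr.cost, hrep₁.vars] at this
    exact this
  have hrep₂ : Rep B s σ₂ := hrep₁.set_aux (by omega)
  have hk₂ : Keeps k σ σ₂ := (keeps_set le_rfl).trans (keeps_set (by omega))
  have hacc₂ : σ₂.vars (2 * k + 1) = acc 0 := by
    simp [hσ₂, hσ₁]
  -- The value of `x` is left open here: at the test it is still the one from the previous round, or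
  -- the original one.
  let I : ℕ → State → Prop := fun i τ =>
    Rep B (s.set x (τ.vars (2 * x))) τ ∧ Keeps k σ τ ∧ τ.vars (2 * (k + 2) + 1) = s.vars x ∧
      τ.vars (2 * k + 1) = acc i ∧ τ.vars (2 * (k + 1) + 1) = i
  obtain ⟨σ₃, t₃, r₃, ht₃, hI₃, hK₃, hx₃, ha₃, -⟩ := run_countLoop (j := 2 * (k + 1) + 1)
    (P := .seq (.assign (2 * x) (.var (2 * (k + 1) + 1))) (.seq P upd)) (B := B) (T := T + 6)
    (σ := σ₂) I
    (by
      refine ⟨?_, hk₂.trans (keeps_set (by omega)), ?_, ?_, by simp⟩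
      · have hx : (σ₂.set (2 * (k + 1) + 1) 0).vars (2 * x) = s.vars x := by
          simp only [State.set_vars]
          rw [Function.update_of_ne (by omega), hrep₂.vars]
        rw [hx, State.set_eq_self rfl]
        exact hrep₂.set_aux (by omega)
      · simp only [State.set_vars]
        rw [Function.update_of_ne (by omega)]; simp [hσ₂]
      · simp only [State.set_vars]
        rw [Function.update_of_ne (by omega), hacc₂])
    (fun i τ h => ⟨h.2.2.2.2, h.1.bound⟩)
    (by
      rintro i - τ ⟨hR, hK, hx, ha, hi'⟩
      have ra : Run (.assign (2 * x) (.var (2 * (k + 1) + 1))) τ (τ.set (2 * x) i) 2 := by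
        have := Run.assign (2 * x) (.var (2 * (k + 1) + 1)) τ
        simp only [Expr.eval, Expr.cost, hi'] at this
        exact this
      have hR' : Rep B (s.set x i) (τ.set (2 * x) i) := by
        have := hR.set_var (x := x) (v := i)
        rwa [State.set_set] at this
      obtain ⟨τ₁, t₁, q₁, ht₁, hR₁, hK₁, hv₁⟩ := hP i _ hR'
      have hacc₁ : τ₁.vars (2 * k + 1) = acc i := by
        rw [hK₁ k (by omega), keeps_set_even (k := k + 1) k (by omega), ha]
      have hcnt₁ : τ₁.vars (2 * (k + 1) + 1) = i := by
        rw [hK₁ (k + 1) (by omega), keeps_set_even (k := k + 2) (k + 1) (by omega), hi']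
      have hsav₁ : τ₁.vars (2 * (k + 2) + 1) = s.vars x := by
        rw [hK₁ (k + 2) (by omega), keeps_set_even (k := k + 3) (k + 2) (by omega), hx]
      obtain ⟨t₂, q₂, ht₂⟩ := hupd i τ₁ hacc₁ hv₁ hcnt₁
      refine ⟨_, _, Run.seq ra (Run.seq q₁ q₂), by omega, ?_, ?_, ?_, ?_, ?_, by simp⟩
      · simp only [State.set_vars]
        rw [Function.update_of_ne (by omega), hcnt₁]
      · have hx' : ((τ₁.set (2 * k + 1) (acc (i + 1))).set (2 * (k + 1) + 1) (i + 1)).vars (2 * x)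
            = i := by
          simp only [State.set_vars]
          rw [Function.update_of_ne (by omega), Function.update_of_ne (by omega), hR₁.vars]
          simp
        rw [hx']
        exact (hR₁.set_aux hk).set_aux (by omega)
      · exact (((hK.trans keeps_set_even).trans (hK₁.mono (by omega))).trans
          (keeps_set le_rfl)).trans (keeps_set (by omega))
      · simp only [State.set_vars]
        rw [Function.update_of_ne (by omega), Function.update_of_ne (by omega), hsav₁]
      · simp only [State.set_vars]
        rw [Function.update_of_ne (by omega)]; simp)
  have r₄ : Run (.assign (2 * x) (.var (2 * (k + 2) + 1))) σ₃ (σ₃.set (2 * x) (s.vars x)) 2 := by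
    have := Run.assign (2 * x) (.var (2 * (k + 2) + 1)) σ₃
    simp only [Expr.eval, Expr.cost, hx₃] at this
    exact this
  refine ⟨_, _, Run.seq r₁ (Run.seq r₂ (Run.seq r₃ r₄)), ?_, ?_, hK₃.trans keeps_set_even, ?_⟩
  · have : B * (T + 6 + 8) = B * (T + 14) := by ring
    omega
  · have := hI₃.set_var (x := x) (v := s.vars x)
    rwa [State.set_set, State.set_eq_self rfl] at this
  · simp only [State.set_vars]
    rw [Function.update_of_ne (by omega), ha₃]

/-- `Keeps k` makes the induction work: the first operand waits in slot k while the second is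
computed from slot k + 1 on. Slot 0 is variable `1`, which holds the bound, whence `1 ≤ k`. -/
theorem Tm.run_compile (B : ℕ) (t : Tm) : ∀ (k : ℕ) (s σ : State), 1 ≤ k → Rep B s σ →
    ∃ σ' T, Run (t.compile k) σ σ' T ∧ T ≤ t.cost.eval B ∧ Rep B s σ' ∧ Keeps k σ σ' ∧
      σ'.vars (2 * k + 1) = t.eval B s := by
  induction t with
  | num c =>
    intro k s σ hk h
    exact ⟨_, _, Run.assign _ _ _, by simp [Expr.cost, Tm.cost], h.set_aux hk, keeps_set le_rfl,
      by simp [Expr.eval, Tm.eval]⟩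
  | var x =>
    intro k s σ hk h
    exact ⟨_, _, Run.assign _ _ _, by simp [Expr.cost, Tm.cost], h.set_aux hk, keeps_set le_rfl,
      by simp [Expr.eval, Tm.eval, h.vars]⟩
  | bound =>
    intro k s σ hk h
    exact ⟨_, _, Run.assign _ _ _, by simp [Expr.cost, Tm.cost], h.set_aux hk, keeps_set le_rfl,
      by simp [Expr.eval, Tm.eval, h.bound]⟩
  | get a t ih =>
    intro k s σ hk h
    obtain ⟨σ₁, T₁, r₁, hT₁, h₁, hK₁, hv₁⟩ := ih k s σ hk h
    refine ⟨_, _, Run.seq r₁ (Run.assign _ _ _), ?_, h₁.set_aux hk,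
      hK₁.trans (keeps_set le_rfl), ?_⟩
    · simp only [Expr.cost, Tm.cost, Polynomial.eval_add, Polynomial.eval_ofNat]; omega
    · simp [Expr.eval, Tm.eval, hv₁, h₁.arrs]
  | add t₁ t₂ ih₁ ih₂ =>
    intro k s σ hk h
    obtain ⟨σ₁, T₁, r₁, hT₁, h₁, hK₁, hv₁⟩ := ih₁ k s σ hk h
    obtain ⟨σ₂, T₂, r₂, hT₂, h₂, hK₂, hv₂⟩ := ih₂ (k + 1) s σ₁ (by omega) h₁
    refine ⟨_, _, Run.seq r₁ (Run.seq r₂ (Run.assign _ _ _)), ?_, h₂.set_aux hk,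
      (hK₁.trans (hK₂.mono (by omega))).trans (keeps_set le_rfl), ?_⟩
    · simp only [Expr.cost, Tm.cost, Polynomial.eval_add, Polynomial.eval_ofNat]; omega
    · simp only [Expr.eval, Tm.eval, Function.update_self]
      rw [hK₂ k (by omega), hv₁, hv₂]
  | sub t₁ t₂ ih₁ ih₂ =>
    intro k s σ hk h
    obtain ⟨σ₁, T₁, r₁, hT₁, h₁, hK₁, hv₁⟩ := ih₁ k s σ hk h
    obtain ⟨σ₂, T₂, r₂, hT₂, h₂, hK₂, hv₂⟩ := ih₂ (k + 1) s σ₁ (by omega) h₁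
    refine ⟨_, _, Run.seq r₁ (Run.seq r₂ (Run.assign _ _ _)), ?_, h₂.set_aux hk,
      (hK₁.trans (hK₂.mono (by omega))).trans (keeps_set le_rfl), ?_⟩
    · simp only [Expr.cost, Tm.cost, Polynomial.eval_add, Polynomial.eval_ofNat]; omega
    · simp only [Expr.eval, Tm.eval, Function.update_self]
      rw [hK₂ k (by omega), hv₁, hv₂]
  | ite t t₁ t₂ ih ih₁ ih₂ =>
    intro k s σ hk h
    obtain ⟨σ₀, T₀, r₀, hT₀, h₀, hK₀, hv₀⟩ := ih k s σ hk h
    by_cases hc : t.eval B s = 0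
    · obtain ⟨σ₁, T₁, r₁, hT₁, h₁, hK₁, hv₁⟩ := ih₂ k s σ₀ hk h₀
      refine ⟨_, _, Run.seq r₀ (Run.iteFalse (by simp [Expr.eval, hv₀, hc]) r₁), ?_, h₁,
        hK₀.trans hK₁, by simp [Tm.eval, hc, hv₁]⟩
      simp only [Expr.cost, Tm.cost, Polynomial.eval_add, Polynomial.eval_ofNat]; omega
    · obtain ⟨σ₁, T₁, r₁, hT₁, h₁, hK₁, hv₁⟩ := ih₁ k s σ₀ hk h₀
      refine ⟨_, _, Run.seq r₀ (Run.iteTrue (by simp [Expr.eval, hv₀, hc]) r₁), ?_, h₁,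
        hK₀.trans hK₁, by simp [Tm.eval, hc, hv₁]⟩
      simp only [Expr.cost, Tm.cost, Polynomial.eval_add, Polynomial.eval_ofNat]; omega
  | sum x t ih =>
    intro k s σ hk h
    obtain ⟨σ', T, r, hT, hR, hK, hv⟩ := run_foldProg (T := t.cost.eval B) (x := x) hk
      (init := .num 0) (P := t.compile (k + 3))
      (upd := .assign (2 * k + 1) (.add (.var (2 * k + 1)) (.var (2 * (k + 3) + 1))))
      (fun j => t.eval B (s.set x j)) (fun i => ∑ j ∈ Finset.range i, t.eval B (s.set x j))
      rfl (by simp [Expr.eval]) h (fun j σ hσ => ih (k + 3) _ σ (by omega) hσ)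
      (by
        intro i σ h1 h2 h3
        have := Run.assign (2 * k + 1) (.add (.var (2 * k + 1)) (.var (2 * (k + 3) + 1))) σ
        simp only [Expr.eval, h1, h2] at this
        exact ⟨_, by rw [Finset.sum_range_succ]; exact this, by simp [Expr.cost]⟩)
    exact ⟨σ', T, r, by simpa [Tm.cost] using hT, hR, hK, hv⟩
  | find x t ih =>
    intro k s σ hk h
    obtain ⟨σ', T, r, hT, hR, hK, hv⟩ := run_foldProg (T := t.cost.eval B) (x := x) hk
      (init := .var 1) (P := t.compile (k + 3))
      (upd := .ite (.var (2 * (k + 3) + 1)) (.assign (2 * k + 1) (.var (2 * (k + 1) + 1))) .skip)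
      (fun j => t.eval B (s.set x j)) (lastIndex (fun j => t.eval B (s.set x j)) B)
      rfl (by simp [Expr.eval, lastIndex, h.bound]) h (fun j σ hσ => ih (k + 3) _ σ (by omega) hσ)
      (by
        intro i σ h1 h2 h3
        by_cases hc : t.eval B (s.set x i) = 0
        · have e : lastIndex (fun j => t.eval B (s.set x j)) B (i + 1) =
              lastIndex (fun j => t.eval B (s.set x j)) B i := by simp [lastIndex, hc]
          rw [e, State.set_eq_self h1]
          exact ⟨_, Run.iteFalse (by simpa [Expr.eval, h2] using hc) (Run.skip _),
            by simp [Expr.cost]⟩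
        · have e : lastIndex (fun j => t.eval B (s.set x j)) B (i + 1) = i := by
            simp [lastIndex, hc]
          rw [e]
          have := Run.assign (2 * k + 1) (.var (2 * (k + 1) + 1)) σ
          simp only [Expr.eval, h3] at this
          exact ⟨_, Run.iteTrue (by simpa [Expr.eval, h2] using hc) this, by simp [Expr.cost]⟩)
    exact ⟨σ', T, r, by simpa [Tm.cost] using hT, hR, hK, hv⟩

theorem Cmd.run_compile (B : ℕ) (C : Cmd) : ∀ (k : ℕ) (s σ : State), 1 ≤ k → Rep B s σ →
    ∃ σ' T, Run (C.compile k) σ σ' T ∧ T ≤ C.cost.eval B ∧ Rep B (C.sem B s) σ' ∧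
      Keeps k σ σ' := by
  induction C with
  | set x t =>
    intro k s σ hk h
    obtain ⟨σ₁, T₁, r₁, hT₁, h₁, hK₁, hv₁⟩ := t.run_compile B k s σ hk h
    have := Run.assign (2 * x) (.var (2 * k + 1)) σ₁
    simp only [Expr.eval, hv₁] at this
    refine ⟨_, _, Run.seq r₁ this, ?_, h₁.set_var, hK₁.trans keeps_set_even⟩
    simp only [Expr.cost, Cmd.cost, Polynomial.eval_add, Polynomial.eval_ofNat]; omega
  | put a t₁ t₂ =>
    intro k s σ hk h
    obtain ⟨σ₁, T₁, r₁, hT₁, h₁, hK₁, hv₁⟩ := t₁.run_compile B k s σ hk h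
    obtain ⟨σ₂, T₂, r₂, hT₂, h₂, hK₂, hv₂⟩ := t₂.run_compile B (k + 1) s σ₁ (by omega) h₁
    have := Run.put a (.var (2 * k + 1)) (.var (2 * (k + 1) + 1)) σ₂
    simp only [Expr.eval, hv₂] at this
    rw [hK₂ k (by omega), hv₁] at this
    refine ⟨_, _, Run.seq r₁ (Run.seq r₂ this), ?_, h₂.put, ?_⟩
    · simp only [Expr.cost, Cmd.cost, Polynomial.eval_add, Polynomial.eval_ofNat]; omega
    · exact hK₁.trans (hK₂.mono (by omega))
  | seq C D ihC ihD =>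
    intro k s σ hk h
    obtain ⟨σ₁, T₁, r₁, hT₁, h₁, hK₁⟩ := ihC k s σ hk h
    obtain ⟨σ₂, T₂, r₂, hT₂, h₂, hK₂⟩ := ihD k _ σ₁ hk h₁
    refine ⟨_, _, Run.seq r₁ r₂, ?_, h₂, hK₁.trans hK₂⟩
    simp only [Cmd.cost, Polynomial.eval_add]; omega
  | ite t C D ihC ihD =>
    intro k s σ hk h
    obtain ⟨σ₀, T₀, r₀, hT₀, h₀, hK₀, hv₀⟩ := t.run_compile B k s σ hk h
    by_cases hc : t.eval B s = 0
    · obtain ⟨σ₁, T₁, r₁, hT₁, h₁, hK₁⟩ := ihD k s σ₀ hk h₀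
      refine ⟨_, _, Run.seq r₀ (Run.iteFalse (by simp [Expr.eval, hv₀, hc]) r₁), ?_,
        by simpa [Cmd.sem, hc] using h₁, hK₀.trans hK₁⟩
      simp only [Expr.cost, Cmd.cost, Polynomial.eval_add, Polynomial.eval_ofNat]; omega
    · obtain ⟨σ₁, T₁, r₁, hT₁, h₁, hK₁⟩ := ihC k s σ₀ hk h₀
      refine ⟨_, _, Run.seq r₀ (Run.iteTrue (by simp [Expr.eval, hv₀, hc]) r₁), ?_,
        by simpa [Cmd.sem, hc] using h₁, hK₀.trans hK₁⟩
      simp only [Expr.cost, Cmd.cost, Polynomial.eval_add, Polynomial.eval_ofNat]; omega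
  | skip =>
    intro k s σ hk h
    exact ⟨σ, _, Run.skip σ, by simp [Cmd.cost], h, fun _ _ => rfl⟩
  | loop x C ih =>
    intro k s σ hk h
    let f : ℕ → State → State := fun j s => C.sem B (s.set x j)
    obtain ⟨σ', T, r, hT, hR, hK, -⟩ := run_countLoop (j := 2 * k + 1)
      (P := .seq (.assign (2 * x) (.var (2 * k + 1))) (C.compile (k + 1))) (B := B)
      (T := C.cost.eval B + 2) (σ := σ)
      (fun i τ => Rep B (iterate f i s) τ ∧ Keeps k σ τ ∧ τ.vars (2 * k + 1) = i)
      ⟨h.set_aux hk, keeps_set le_rfl, by simp⟩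
      (fun i τ hτ => ⟨hτ.2.2, hτ.1.bound⟩)
      (by
        rintro i - τ ⟨hR, hK, hi⟩
        have ra := Run.assign (2 * x) (.var (2 * k + 1)) τ
        simp only [Expr.eval, hi] at ra
        obtain ⟨τ₁, t₁, r₁, ht₁, hR₁, hK₁⟩ := ih (k + 1) _ _ (by omega)
          (hR.set_var (x := x) (v := i))
        refine ⟨_, _, Run.seq ra r₁, by simp only [Expr.cost]; omega, ?_, hR₁.set_aux hk, ?_,
          by simp⟩
        · rw [hK₁ k (by omega), keeps_set_even (k := k + 1) k (by omega), hi]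
        · exact ((hK.trans keeps_set_even).trans (hK₁.mono (by omega))).trans (keeps_set le_rfl))
    refine ⟨σ', T, r, ?_, hR, hK⟩
    simp only [Cmd.cost, Polynomial.eval_add, Polynomial.eval_mul, Polynomial.eval_X,
      Polynomial.eval_ofNat]
    have : B * (C.cost.eval B + 2 + 8) = B * (C.cost.eval B + 10) := by ring
    omega

theorem polynomial_eval_mono (p : Polynomial ℕ) {a b : ℕ} (h : a ≤ b) : p.eval a ≤ p.eval b := by
  rw [Polynomial.eval_eq_sum, Polynomial.eval_eq_sum]
  exact Finset.sum_le_sum fun i _ => Nat.mul_le_mul_left _ (Nat.pow_le_pow_left h i)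

theorem length_le_inputSize (w : List ℕ) : w.length ≤ inputSize w := by
  unfold inputSize
  induction w with
  | nil => simp
  | cons a w ih => simp only [List.map_cons, List.sum_cons, List.length_cons]; omega

/-- A structured program that decides a predicate decides it in polynomial time. -/
theorem Cmd.exists_decidesWithin (C : Cmd) :
    ∃ (P : Prog) (p : Polynomial ℕ), ∀ (w : List ℕ) (Q : Prop),
      ((Q ∧ (C.sem w.length (initial w)).vars 0 = 1) ∨
        (¬ Q ∧ (C.sem w.length (initial w)).vars 0 = 0)) →
      P.DecidesWithin w Q (p.eval (inputSize w)) := by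
  refine ⟨.seq (.assign 1 (.var 0)) (C.compile 1), C.cost + 2, fun w Q hQ => ?_⟩
  -- The named variable 0 is variable 2 * 0, so the length of the word already is in the right
  -- place; all other even variables start at 0.
  have h₀ : Rep w.length (initial w) ((initial w).set 1 w.length) := by
    refine ⟨fun x => ?_, rfl, by simp⟩
    simp only [State.set_vars]
    rw [Function.update_of_ne (by omega)]
    simp [initial]
  have r₀ := Run.assign 1 (.var 0) (initial w)
  have e : (Expr.var 0).eval (initial w) = w.length := by simp [Expr.eval, initial]
  rw [e] at r₀
  obtain ⟨σ, T, r, hT, hR, -⟩ := C.run_compile w.length 1 _ _ le_rfl h₀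
  refine ⟨σ, _, Run.seq r₀ r, ?_, ?_⟩
  · have := polynomial_eval_mono C.cost (length_le_inputSize w)
    simp only [Expr.cost, Polynomial.eval_add, Polynomial.eval_ofNat]; omega
  · have := hR.vars 0
    simp only [mul_zero] at this
    rwa [this]

end RAM

/-! ### A push-relabel algorithm for distributing approvals under capacities -/

/-- Every agent in `agents` holds one of its options; `own p` is the agent to which the option `p`
belongs, and the option `p` places one token on each candidate in `T p`. In addition, filler tokens
lie on the candidates in `Z`. At most `cap x` tokens may lie on the candidate `x < m`. -/
structure Network where
  m : ℕ
  agents : Finset ℕ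
  own : ℕ → ℕ
  T : ℕ → Finset ℕ
  Z : Finset ℕ
  cap : ℕ → ℕ

namespace Network

/-- Every option has two candidates, and any two options of an agent have a common candidate. -/
structure Proper (N : Network) : Prop where
  card : ∀ p, N.own p ∈ N.agents → (N.T p).card = 2
  sub : ∀ p, N.own p ∈ N.agents → N.T p ⊆ Finset.range N.m
  inter : ∀ p q, N.own p ∈ N.agents → N.own p = N.own q → (N.T p ∩ N.T q).Nonempty
  filler : N.Z ⊆ Finset.range N.m

/-- The number of tokens on `x`. -/
def load (N : Network) (cur f : ℕ → ℕ) (x : ℕ) : ℕ :=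
  f x + ∑ i ∈ N.agents, if x ∈ N.T (cur i) then 1 else 0

/-- Every agent holds one of its options and there are `D` filler tokens, all of them in `Z`. -/
structure Alloc (N : Network) (D : ℕ) (cur f : ℕ → ℕ) : Prop where
  own_cur : ∀ i ∈ N.agents, N.own (cur i) = i
  f_eq_zero : ∀ x, x ∉ N.Z → f x = 0
  sum_f : ∑ x ∈ N.Z, f x = D

/-- An allocation together with heights. -/
structure Cfg where
  cur : ℕ → ℕ
  f : ℕ → ℕ
  h : ℕ → ℕ

/-- `x` is overloaded and its height is less than `m`. -/
def Active (N : Network) (s : Cfg) (x : ℕ) : Prop :=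
  x < N.m ∧ N.cap x < N.load s.cur s.f x ∧ s.h x < N.m

/-- One token can move from `x` to `y` if the owner of the option `p` switches to `p`. -/
def Arc (N : Network) (s : Cfg) (p x y : ℕ) : Prop :=
  N.own p ∈ N.agents ∧ x ∈ N.T (s.cur (N.own p)) ∧ x ∉ N.T p ∧ y ∈ N.T p ∧
    y ∉ N.T (s.cur (N.own p))

/-- Move a token from `x` to `y`. -/
def move (f : ℕ → ℕ) (x y : ℕ) : ℕ → ℕ :=
  Function.update (Function.update f x (f x - 1)) y (Function.update f x (f x - 1) y + 1)

/-- One step of the algorithm. -/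
inductive Step (N : Network) (s : Cfg) : Cfg → Prop where
  | pushAgent (p x y : ℕ) : N.Active s x → N.Arc s p x y → s.h x = s.h y + 1 →
      Step N s ⟨Function.update s.cur (N.own p) p, s.f, s.h⟩
  | pushFiller (x y : ℕ) : N.Active s x → 0 < s.f x → y ∈ N.Z → s.h x = s.h y + 1 →
      Step N s ⟨s.cur, move s.f x y, s.h⟩
  | relabel (x : ℕ) : N.Active s x → (∀ p y, N.Arc s p x y → s.h x ≠ s.h y + 1) →
      (0 < s.f x → ∀ y ∈ N.Z, s.h x ≠ s.h y + 1) →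
      Step N s ⟨s.cur, s.f, Function.update s.h x (s.h x + 1)⟩

/-- The invariant of the algorithm. -/
structure Inv (N : Network) (D : ℕ) (s : Cfg) : Prop where
  alloc : N.Alloc D s.cur s.f
  agent : ∀ p x y, N.Arc s p x y → s.h x ≤ s.h y + 1
  filler : ∀ x, 0 < s.f x → ∀ y ∈ N.Z, s.h x ≤ s.h y + 1
  full : ∀ x < N.m, 0 < s.h x → N.cap x ≤ N.load s.cur s.f x
  height : ∀ x < N.m, s.h x ≤ N.m

/-! ### Pushes, relabels and the invariant -/

variable {N : Network}

/-- Two different 2-sets that meet differ in one element each. This is why a switch between options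
of one agent moves a single token. -/
theorem exists_common {S T : Finset ℕ} (hS : S.card = 2) (hT : T.card = 2)
    (h : (S ∩ T).Nonempty) {x y : ℕ} (hx : x ∈ S) (hx' : x ∉ T) (hy : y ∈ T) (hy' : y ∉ S) :
    ∃ q, q ≠ x ∧ q ≠ y ∧ x ≠ y ∧ S = {q, x} ∧ T = {q, y} := by
  obtain ⟨q, hq⟩ := h
  rw [Finset.mem_inter] at hq
  have h1 : q ≠ x := fun e => hx' (e ▸ hq.2)
  have h2 : q ≠ y := fun e => hy' (e ▸ hq.1)
  refine ⟨q, h1, h2, fun e => hx' (e ▸ hy), ?_, ?_⟩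
  · refine (Finset.eq_of_subset_of_card_le ?_ ?_).symm
    · intro z hz; simp only [Finset.mem_insert, Finset.mem_singleton] at hz
      rcases hz with rfl | rfl
      exacts [hq.1, hx]
    · rw [hS, Finset.card_pair h1]
  · refine (Finset.eq_of_subset_of_card_le ?_ ?_).symm
    · intro z hz; simp only [Finset.mem_insert, Finset.mem_singleton] at hz
      rcases hz with rfl | rfl
      exacts [hq.2, hy]
    · rw [hT, Finset.card_pair h2]

theorem Arc.exists_common (hN : N.Proper) {D : ℕ} {s : Cfg} (hs : N.Alloc D s.cur s.f)
    {p x y : ℕ} (h : N.Arc s p x y) :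
    ∃ q, q ≠ x ∧ q ≠ y ∧ x ≠ y ∧ N.T (s.cur (N.own p)) = {q, x} ∧ N.T p = {q, y} := by
  obtain ⟨hp, hx, hx', hy, hy'⟩ := h
  have ho := hs.own_cur _ hp
  exact Network.exists_common (hN.card _ (by rwa [ho])) (hN.card _ hp)
    (hN.inter _ _ (by rwa [ho]) ho) hx hx' hy hy'

/-- Only the summand of the owner of `p` changes, from the indicator of {q, x} to that of {q, y}.
The lost token is added on the left because subtraction on the right would be truncated. -/
theorem load_pushAgent (hN : N.Proper) {D : ℕ} {s : Cfg} (hs : N.Alloc D s.cur s.f)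
    {p x y : ℕ} (h : N.Arc s p x y) (z : ℕ) :
    N.load (Function.update s.cur (N.own p) p) s.f z + (if z = x then 1 else 0) =
      N.load s.cur s.f z + (if z = y then 1 else 0) := by
  obtain ⟨q, h1, h2, h3, hT, hT'⟩ := h.exists_common hN hs
  unfold load
  rw [← Finset.add_sum_erase _ _ h.1, ← Finset.add_sum_erase N.agents _ h.1]
  have e : ∑ i ∈ N.agents.erase (N.own p),
      (if z ∈ N.T (Function.update s.cur (N.own p) p i) then 1 else 0) =
      ∑ i ∈ N.agents.erase (N.own p), (if z ∈ N.T (s.cur i) then 1 else 0) :=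
    Finset.sum_congr rfl fun i hi => by rw [Function.update_of_ne (Finset.ne_of_mem_erase hi)]
  rw [e, Function.update_self, hT, hT']
  simp only [Finset.mem_insert, Finset.mem_singleton]
  split_ifs <;> omega

theorem load_move {cur f : ℕ → ℕ} {x y : ℕ} (hx : 0 < f x) (hxy : x ≠ y) (z : ℕ) :
    N.load cur (move f x y) z + (if z = x then 1 else 0) =
      N.load cur f z + (if z = y then 1 else 0) := by
  unfold load move
  by_cases h1 : z = y
  · subst h1
    simp [hxy.symm]; omega
  · by_cases h2 : z = x
    · subst h2
      simp [h1]; omega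
    · simp [h1, h2]

theorem sum_move {f : ℕ → ℕ} {x y : ℕ} (hx : 0 < f x) (hxy : x ≠ y) {S : Finset ℕ} (hxS : x ∈ S)
    (hyS : y ∈ S) : ∑ z ∈ S, move f x y z = ∑ z ∈ S, f z := by
  have key : ∀ z, move f x y z + (if z = x then 1 else 0) = f z + (if z = y then 1 else 0) := by
    intro z
    -- In a network without agents the load is the filler itself.
    have := load_move (N := ⟨0, ∅, id, fun _ => ∅, ∅, id⟩) (cur := id) hx hxy z
    simpa [load] using this
  have := Finset.sum_congr (rfl : S = S) fun z _ => key z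
  rw [Finset.sum_add_distrib, Finset.sum_add_distrib] at this
  simpa [hxS, hyS] using this

theorem Alloc.pushAgent {D : ℕ} {s : Cfg} (hs : N.Alloc D s.cur s.f) (p : ℕ) :
    N.Alloc D (Function.update s.cur (N.own p) p) s.f where
  own_cur i hi := by
    by_cases h : i = N.own p
    · subst h; simp
    · rw [Function.update_of_ne h, hs.own_cur i hi]
  f_eq_zero := hs.f_eq_zero
  sum_f := hs.sum_f

theorem Alloc.pushFiller {D : ℕ} {s : Cfg} (hs : N.Alloc D s.cur s.f) {x y : ℕ} (hx : 0 < s.f x)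
    (hy : y ∈ N.Z) (hxy : x ≠ y) : N.Alloc D s.cur (move s.f x y) := by
  have hxZ : x ∈ N.Z := by
    by_contra h
    exact absurd (hs.f_eq_zero x h) (by omega)
  refine ⟨hs.own_cur, fun z hz => ?_, (sum_move hx hxy hxZ hy).trans hs.sum_f⟩
  have h1 : z ≠ y := fun e => hz (e ▸ hy)
  have h2 : z ≠ x := fun e => hz (e ▸ hxZ)
  simp [move, h1, h2, hs.f_eq_zero z hz]

/-- The effect of a push on the number of tokens. -/
def Moves (g g' : ℕ → ℕ) (x y : ℕ) : Prop :=
  ∀ z, g' z + (if z = x then 1 else 0) = g z + (if z = y then 1 else 0)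

/-- A token leaves x only while x is strictly over its capacity, so x remains full; all other loads
can only grow. -/
theorem Moves.full {g g' cap h : ℕ → ℕ} {m x y : ℕ} (hm : Moves g g' x y)
    (hx : cap x < g x) (hf : ∀ z < m, 0 < h z → cap z ≤ g z) :
    ∀ z < m, 0 < h z → cap z ≤ g' z := by
  intro z hz hz'
  have h1 := hm z
  have h2 := hf z hz hz'
  by_cases e : z = x
  · subst e; simp only [if_true] at h1; split_ifs at h1 <;> omega
  · simp only [e, if_false] at h1; split_ifs at h1 <;> omega

/-- The delicate point is that a switch to `p` changes all arcs of the owner of `p` at once, and not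
only the arc that was used. Pairwise intersection of the options controls the new arcs. A relabel of
x is harmless because it happens only if no arc and no filler move descends from x by exactly one.
-/
theorem Inv.step (hN : N.Proper) {D : ℕ} {s s' : Cfg} (hs : N.Inv D s) (h : N.Step s s') :
    N.Inv D s' := by
  cases h with
  | pushAgent p x y hact harc hh =>
    obtain ⟨q, h1, h2, h3, hT, hT'⟩ := harc.exists_common hN hs.alloc
    refine ⟨hs.alloc.pushAgent p, ?_, hs.filler, ?_, hs.height⟩
    · intro p' a b hab
      by_cases ho : N.own p' = N.own p
      · have hall := hs.alloc.pushAgent p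
        obtain ⟨q', g1, g2, g3, hS, hS'⟩ :=
          hab.exists_common (s := ⟨Function.update s.cur (N.own p) p, s.f, s.h⟩) hN hall
        simp only [ho, Function.update_self] at hS
        have hold : ∀ a' b', a' ∈ N.T (s.cur (N.own p)) → a' ∉ N.T p' → b' ∈ N.T p' →
            b' ∉ N.T (s.cur (N.own p)) → s.h a' ≤ s.h b' + 1 := fun a' b' c1 c2 c3 c4 =>
          hs.agent p' a' b' ⟨hab.1, by rwa [ho], c2, c3, by rwa [ho]⟩
        have hcap : (N.T p' ∩ N.T (s.cur (N.own p))).Nonempty := by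
          have hc := hs.alloc.own_cur _ harc.1
          exact hN.inter _ _ hab.1 (by rw [hc, ho])
        show s.h a ≤ s.h b + 1
        rw [hT] at hold hcap
        rw [hS'] at hold hcap
        have e : ({q', a} : Finset ℕ) = {q, y} := by rw [← hS, hT']
        have hq' : q' = q ∨ q' = y := by
          have : q' ∈ ({q, y} : Finset ℕ) := e ▸ Finset.mem_insert_self _ _
          simpa using this
        have ha : a = q ∨ a = y := by
          have : a ∈ ({q, y} : Finset ℕ) := by rw [← e]; simp
          simpa using this
        simp only [Finset.mem_insert, Finset.mem_singleton, not_or] at hold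
        rcases hq' with rfl | rfl
        -- The new arc leaves y for b, and q stays. Either b = x, which lies above y, or x → b was
        -- an arc before the push and x lies one above y.
        · have ha : a = y := by
            rcases ha with rfl | rfl
            · exact absurd rfl g1
            · rfl
          subst ha
          by_cases hbx : b = x
          · subst hbx; omega
          · have := hold x b (.inr rfl) ⟨h1.symm, fun e => hbx e.symm⟩ (.inr rfl)
              ⟨g2.symm, hbx⟩
            omega
        -- The new arc leaves q, and y stays. The option {y, b} must meet the former option {q, x},
        -- so b = x; and then q → y was an arc before the push.
        · have ha : a = q := by
            rcases ha with rfl | rfl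
            · rfl
            · exact absurd rfl g1
          subst ha
          by_cases hbx : b = x
          · subst hbx
            have := hold a q' (.inl rfl) ⟨h2, g3⟩ (.inl rfl) ⟨h2.symm, h3.symm⟩
            omega
          · obtain ⟨z, hz⟩ := hcap
            simp only [Finset.mem_inter, Finset.mem_insert, Finset.mem_singleton] at hz
            omega
      · have := hs.agent p' a b ⟨hab.1, ?_, hab.2.2.1, hab.2.2.2.1, ?_⟩
        · exact this
        · have := hab.2.1
          simpa only [Function.update_of_ne ho] using this
        · have := hab.2.2.2.2
          simpa only [Function.update_of_ne ho] using this
    · exact Moves.full (load_pushAgent hN hs.alloc harc) hact.2.1 hs.full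
  | pushFiller x y hact hx hy hh =>
    have hxy : x ≠ y := fun e => by subst e; omega
    refine ⟨hs.alloc.pushFiller hx hy hxy, hs.agent, ?_, ?_, hs.height⟩
    · intro a ha b hb
      show s.h a ≤ s.h b + 1
      by_cases e : a = y
      · subst e
        have := hs.filler x hx b hb
        omega
      · refine hs.filler a ?_ b hb
        by_cases e' : a = x
        · subst e'; exact hx
        · simpa [move, e, e'] using ha
    · exact Moves.full (load_move hx hxy) hact.2.1 hs.full
  | relabel x hact hno hno' =>
    have up : ∀ y, s.h y ≤ Function.update s.h x (s.h x + 1) y := by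
      intro y
      by_cases e : y = x
      · subst e; simp
      · simp [e]
    refine ⟨hs.alloc, ?_, ?_, ?_, ?_⟩
    · intro p a b hab
      have hab' : N.Arc s p a b := hab
      have h1 := hs.agent p a b hab'
      have h2 := up b
      show Function.update s.h x (s.h x + 1) a ≤ Function.update s.h x (s.h x + 1) b + 1
      by_cases e : a = x
      · subst e
        have h3 := hno p b hab'
        rw [Function.update_self]
        omega
      · rw [Function.update_of_ne e]; omega
    · intro a ha b hb
      have h1 := hs.filler a ha b hb
      have h2 := up b
      show Function.update s.h x (s.h x + 1) a ≤ Function.update s.h x (s.h x + 1) b + 1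
      by_cases e : a = x
      · subst e
        have h3 := hno' ha b hb
        rw [Function.update_self]
        omega
      · rw [Function.update_of_ne e]; omega
    · intro z hz hz'
      by_cases e : z = x
      · subst e; exact hact.2.1.le
      · exact hs.full z hz (by simpa [e] using hz')
    · intro z hz
      by_cases e : z = x
      · subst e; simpa using hact.2.2
      · simpa [e] using hs.height z hz

/-- The total number of tokens. -/
theorem sum_load (hN : N.Proper) {D : ℕ} {cur f : ℕ → ℕ} (hs : N.Alloc D cur f) :
    ∑ x ∈ Finset.range N.m, N.load cur f x = D + 2 * N.agents.card := by
  unfold load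
  rw [Finset.sum_add_distrib, Finset.sum_comm]
  congr 1
  · rw [← hs.sum_f]
    exact (Finset.sum_subset hN.filler fun x _ hx => hs.f_eq_zero x hx).symm
  · rw [Finset.sum_congr rfl (g := fun _ => 2), Finset.sum_const, smul_eq_mul, mul_comm]
    intro i hi
    have ho := hs.own_cur i hi
    rw [← hN.card (cur i) (by rwa [ho]), Finset.sum_ite_mem,
      Finset.inter_eq_right.2 (hN.sub (cur i) (by rwa [ho]))]
    simp

/-! ### Termination, and why a stuck run proves infeasibility -/

/-- The potential that every step decreases. -/
def potential (N : Network) (L : ℕ) (s : Cfg) : ℕ :=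
  (L + 1) * ∑ x ∈ Finset.range N.m, (N.m - s.h x) +
    ∑ x ∈ Finset.range N.m, N.load s.cur s.f x * s.h x

theorem Moves.sum_mul {g g' : ℕ → ℕ} {x y m : ℕ} (hm : Moves g g' x y) (hx : x < m) (hy : y < m)
    (h : ℕ → ℕ) : ∑ z ∈ Finset.range m, g' z * h z + h x =
      ∑ z ∈ Finset.range m, g z * h z + h y := by
  have := Finset.sum_congr (rfl : Finset.range m = _) fun z _ => congrArg (· * h z) (hm z)
  simp only [add_mul, Finset.sum_add_distrib, ite_mul, one_mul, zero_mul] at this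
  simpa [hx, hy] using this

/-- A push lowers one token by one unit of height. A relabel lowers the first summand by L + 1 and
raises the second by the load of x, which is at most the total number L of tokens. -/
theorem Step.potential_lt (hN : N.Proper) {D : ℕ} {s s' : Cfg} (hs : N.Inv D s)
    (h : N.Step s s') :
    N.potential (D + 2 * N.agents.card) s' < N.potential (D + 2 * N.agents.card) s := by
  cases h with
  | pushAgent p x y hact harc hh =>
    have hy : y < N.m := Finset.mem_range.1 (hN.sub p harc.1 harc.2.2.2.1)
    have := Moves.sum_mul (load_pushAgent hN hs.alloc harc) hact.1 hy s.h
    simp only [potential]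
    omega
  | pushFiller x y hact hx hy hh =>
    have hxy : x ≠ y := fun e => by subst e; omega
    have hy : y < N.m := Finset.mem_range.1 (hN.filler hy)
    have := Moves.sum_mul (load_move (N := N) (cur := s.cur) hx hxy) hact.1 hy s.h
    simp only [potential]
    omega
  | relabel x hact hno hno' =>
    have hx : x ∈ Finset.range N.m := Finset.mem_range.2 hact.1
    have hle : N.load s.cur s.f x ≤ D + 2 * N.agents.card := by
      rw [← sum_load hN hs.alloc]
      exact Finset.single_le_sum (fun _ _ => Nat.zero_le _) hx
    simp only [potential]
    rw [← Finset.add_sum_erase _ _ hx, ← Finset.add_sum_erase _ (fun x => _ * _) hx,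
      ← Finset.add_sum_erase _ (fun x => N.m - s.h x) hx,
      ← Finset.add_sum_erase _ (fun x => N.load s.cur s.f x * s.h x) hx]
    have e1 : ∑ z ∈ (Finset.range N.m).erase x,
        (N.m - Function.update s.h x (s.h x + 1) z) =
        ∑ z ∈ (Finset.range N.m).erase x, (N.m - s.h z) :=
      Finset.sum_congr rfl fun i hi => by rw [Function.update_of_ne (Finset.ne_of_mem_erase hi)]
    have e2 : ∑ z ∈ (Finset.range N.m).erase x,
        N.load s.cur s.f z * Function.update s.h x (s.h x + 1) z =
        ∑ z ∈ (Finset.range N.m).erase x, N.load s.cur s.f z * s.h z :=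
      Finset.sum_congr rfl fun i hi => by rw [Function.update_of_ne (Finset.ne_of_mem_erase hi)]
    rw [e1, e2, Function.update_self]
    have h3 := hact.2.2
    obtain ⟨r, hr⟩ : ∃ r, N.m - s.h x = r + 1 := ⟨N.m - s.h x - 1, by omega⟩
    have hr' : N.m - (s.h x + 1) = r := by omega
    rw [hr, hr']
    nlinarith

/-- A set of candidates from which no token can leave cannot be relieved. -/
theorem sum_load_le_of_closed (hN : N.Proper) {D : ℕ} {s : Cfg} (hs : N.Alloc D s.cur s.f)
    {R : Finset ℕ} (hR : ∀ p x y, N.Arc s p x y → x ∈ R → y ∈ R)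
    (hR' : ∀ x ∈ R, 0 < s.f x → N.Z ⊆ R) {cur f : ℕ → ℕ} (h : N.Alloc D cur f) :
    ∑ x ∈ R, N.load s.cur s.f x ≤ ∑ x ∈ R, N.load cur f x := by
  unfold load
  rw [Finset.sum_add_distrib, Finset.sum_add_distrib]
  refine Nat.add_le_add ?_ ?_
  -- If filler lies in R, then R contains all of Z and hence all D filler tokens of any allocation.
  · by_cases hx : ∃ x ∈ R, 0 < s.f x
    · obtain ⟨x, hx, hx'⟩ := hx
      have hZ := hR' x hx hx'
      calc ∑ x ∈ R, s.f x = ∑ x ∈ N.Z, s.f x :=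
            (Finset.sum_subset hZ fun z _ hz => hs.f_eq_zero z hz).symm
        _ = ∑ x ∈ N.Z, f x := by rw [hs.sum_f, h.sum_f]
        _ ≤ ∑ x ∈ R, f x := Finset.sum_le_sum_of_subset hZ
    · push Not at hx
      rw [Finset.sum_eq_zero fun x hxR => Nat.le_zero.1 (hx x hxR)]
      exact Nat.zero_le _
  · rw [Finset.sum_comm, Finset.sum_comm (s := R)]
    refine Finset.sum_le_sum fun i hi => ?_
    rw [Finset.sum_ite_mem, Finset.sum_ite_mem]
    have ho := hs.own_cur i hi
    have ho' := h.own_cur i hi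
    simp only [Finset.sum_const, smul_eq_mul, mul_one]
    have c1 := hN.card (s.cur i) (by rwa [ho])
    have c2 := hN.card (cur i) (by rwa [ho'])
    -- For each agent separately: its present option is {q, x}, the other one is {q, y}, and x ∈ R
    -- implies y ∈ R because the switch is an arc.
    by_cases hsub : N.T (s.cur i) ⊆ N.T (cur i)
    · rw [Finset.eq_of_subset_of_card_le hsub (by rw [c1, c2])]
    · obtain ⟨x, hx, hx'⟩ := Finset.not_subset.1 hsub
      have hsub' : ¬ N.T (cur i) ⊆ N.T (s.cur i) := fun hc =>
        hsub (Finset.eq_of_subset_of_card_le hc (by rw [c1, c2])).symm.subset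
      obtain ⟨y, hy, hy'⟩ := Finset.not_subset.1 hsub'
      obtain ⟨q, h1, h2, h3, hT, hT'⟩ := exists_common c1 c2
        (hN.inter _ _ (by rwa [ho]) (by rw [ho, ho'])) hx hx' hy hy'
      have hxy : x ∈ R → y ∈ R :=
        hR (cur i) x y ⟨by rwa [ho'], by rwa [ho'], hx', hy, by rwa [ho']⟩
      have cnt : ∀ z, q ≠ z → (R ∩ {q, z} : Finset ℕ).card =
          (if q ∈ R then 1 else 0) + (if z ∈ R then 1 else 0) := by
        intro z hqz
        rw [Finset.inter_comm, ← Finset.filter_mem_eq_inter, Finset.card_filter,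
          Finset.sum_pair hqz]
      rw [hT, hT', cnt x h1, cnt y h2]
      split_ifs <;> simp_all

/-- The m candidates cannot take all m + 1 heights 0, …, m, and height m is taken. -/
theorem exists_gap {m x : ℕ} {h : ℕ → ℕ} (hx : x < m) (hh : h x = m) :
    ∃ k < m, ∀ z < m, h z ≠ k := by
  by_contra hc
  push Not at hc
  have hsub : Finset.range (m + 1) ⊆ (Finset.range m).image h := by
    intro k hk
    rw [Finset.mem_image]
    rcases Nat.lt_succ_iff_lt_or_eq.1 (Finset.mem_range.1 hk) with hk | rfl
    · obtain ⟨z, hz, e⟩ := hc k hk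
      exact ⟨z, Finset.mem_range.2 hz, e⟩
    · exact ⟨x, Finset.mem_range.2 hx, hh⟩
  have := (Finset.card_le_card hsub).trans Finset.card_image_le
  simp at this

/-- An overloaded candidate of full height shows that the capacities cannot be met. -/
theorem Inv.not_feasible (hN : N.Proper) {D : ℕ} {s : Cfg} (hs : N.Inv D s)
    (hact : ∀ x, ¬ N.Active s x) {x : ℕ} (hx : x < N.m) (hx' : N.cap x < N.load s.cur s.f x)
    {cur f : ℕ → ℕ} (h : N.Alloc D cur f) : ∃ z < N.m, N.cap z < N.load cur f z := by
  have hhx : s.h x = N.m := by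
    have h1 := hs.height x hx
    have h2 : ¬ s.h x < N.m := fun h2 => hact x ⟨hx, hx', h2⟩
    omega
  obtain ⟨k, hk, hgap⟩ := exists_gap hx hhx
  by_contra! hc
  -- Arcs descend by at most one, so none can cross the unoccupied height k: the set R above it is
  -- closed. All its members are full and x is overloaded, so every allocation puts more tokens on R
  -- than its capacity.
  set R := (Finset.range N.m).filter fun z => k < s.h z with hR
  have hmem : ∀ z, z ∈ R ↔ z < N.m ∧ k < s.h z := by simp [hR]
  have hle := sum_load_le_of_closed hN hs.alloc (R := R)
    (fun p a b hab ha => by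
      have hb : b < N.m := Finset.mem_range.1 (hN.sub p hab.1 hab.2.2.2.1)
      have h1 := hs.agent p a b hab
      have h2 := ((hmem a).1 ha).2
      have h3 := hgap b hb
      exact (hmem b).2 ⟨hb, by omega⟩)
    (fun a ha ha' b hb => by
      have hbm : b < N.m := Finset.mem_range.1 (hN.filler hb)
      have h1 := hs.filler a ha' b hb
      have h2 := ((hmem a).1 ha).2
      have h3 := hgap b hbm
      exact (hmem b).2 ⟨hbm, by omega⟩) h
  have hlt : ∑ z ∈ R, N.cap z < ∑ z ∈ R, N.load s.cur s.f z := by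
    refine Finset.sum_lt_sum (fun z hz => ?_) ⟨x, (hmem x).2 ⟨hx, by omega⟩, hx'⟩
    have := (hmem z).1 hz
    exact hs.full z this.1 (by omega)
  have hle' : ∑ z ∈ R, N.load cur f z ≤ ∑ z ∈ R, N.cap z :=
    Finset.sum_le_sum fun z hz => hc z ((hmem z).1 hz).1
  omega

/-- `Runs D k s s'`: the algorithm goes from `s` to `s'` in `k` steps. It does nothing once no
candidate is active. -/
inductive Runs (N : Network) (D : ℕ) : ℕ → Cfg → Cfg → Prop where
  | zero (s : Cfg) : Runs N D 0 s s
  | succ {k : ℕ} {s s' s'' : Cfg} : Runs N D k s s' →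
      (N.Inv D s' → (∃ x, N.Active s' x) → N.Step s' s'') →
      (N.Inv D s' → (¬ ∃ x, N.Active s' x) → s'' = s') → Runs N D (k + 1) s s''

theorem Runs.trans {D k l : ℕ} {s s' s'' : Cfg} (h : N.Runs D k s s') (h' : N.Runs D l s' s'') :
    N.Runs D (k + l) s s'' := by
  induction h' with
  | zero => exact h
  | succ _ h1 h2 ih => exact .succ (ih h) h1 h2

/-- A run of the algorithm that starts with all heights equal to zero and that is long enough
decides whether the capacities can be met. -/
theorem Runs.feasible_iff (hN : N.Proper) {D t : ℕ} {s s' : Cfg} (hrun : N.Runs D t s s')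
    (h0 : N.Alloc D s.cur s.f) (hh : s.h = fun _ => 0)
    (ht : (D + 2 * N.agents.card + 1) * (N.m * N.m) < t) :
    (∃ cur f, N.Alloc D cur f ∧ ∀ x < N.m, N.load cur f x ≤ N.cap x) ↔
      ∀ x < N.m, N.load s'.cur s'.f x ≤ N.cap x := by
  have hinv0 : N.Inv D s := ⟨h0, by simp [hh], by simp [hh], by simp [hh], by simp [hh]⟩
  -- Either the run has become idle, or each of its t steps has decreased the potential; the second
  -- is impossible since t exceeds the initial potential.
  have key : N.Inv D s' ∧ ((¬ ∃ x, N.Active s' x) ∨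
      N.potential (D + 2 * N.agents.card) s' + t ≤ N.potential (D + 2 * N.agents.card) s) := by
    clear ht h0 hh
    induction hrun with
    | zero => exact ⟨hinv0, .inr le_rfl⟩
    | @succ k s s' s'' hrun hstep hidle ih =>
      have ih := ih hinv0
      by_cases hact : ∃ x, N.Active s' x
      · have hs := hstep ih.1 hact
        refine ⟨ih.1.step hN hs, .inr ?_⟩
        have h1 := hs.potential_lt hN ih.1
        rcases ih.2 with h2 | h2
        · exact absurd hact h2
        · omega
      · rw [hidle ih.1 hact]
        exact ⟨ih.1, .inl hact⟩
  obtain ⟨hinv, hact⟩ := key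
  have hpot : N.potential (D + 2 * N.agents.card) s =
      (D + 2 * N.agents.card + 1) * (N.m * N.m) := by
    simp [potential, hh]
  have hact : ¬ ∃ x, N.Active s' x := hact.resolve_right (by omega)
  push Not at hact
  constructor
  · rintro ⟨cur, f, halloc, hle⟩ x hx
    by_contra hlt
    obtain ⟨z, hz, hz'⟩ := hinv.not_feasible hN hact hx (not_le.1 hlt) halloc
    exact absurd (hle z hz) (not_le.2 hz')
  · exact fun h => ⟨_, _, hinv.alloc, h⟩

end Network

/-! ### Winners and minimal manipulations under 2-approval -/

namespace Voting

theorem Vote.mem_top {m k : ℕ} {v : Vote m} {c : Fin m} :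
    c ∈ Vote.top k v ↔ (v.symm c : ℕ) < k := by simp [Vote.top]

theorem Vote.card_top {m k : ℕ} (hk : k ≤ m) (v : Vote m) : (Vote.top k v).card = k := by
  have : Vote.top k v = (Finset.univ.filter fun r : Fin m => (r : ℕ) < k).map v.toEmbedding := by
    ext c
    simp [Vote.mem_top, Finset.mem_map_equiv]
  rw [this, Finset.card_map, Fin.card_filter_val_lt]
  omega

/-- The score of `c` without the vote of `i`. -/
def othersScore {n m : ℕ} (k : ℕ) (V : Profile n m) (i : Fin n) (c : Fin m) : ℕ :=
  (Finset.univ.filter fun j => j ≠ i ∧ c ∈ Vote.top k (V j)).card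

theorem score_update {n m : ℕ} (k : ℕ) (V : Profile n m) (i : Fin n) (v : Vote m) (c : Fin m) :
    score k (Function.update V i v) c =
      othersScore k V i c + if c ∈ Vote.top k v then 1 else 0 := by
  unfold score othersScore
  rw [Finset.card_filter, Finset.card_filter, ← Finset.add_sum_erase _ _ (Finset.mem_univ i),
    ← Finset.add_sum_erase Finset.univ (fun j => if j ≠ i ∧ _ then 1 else 0) (Finset.mem_univ i)]
  rw [Function.update_self]
  simp only [ne_eq, not_true_eq_false, false_and, if_false, zero_add]
  rw [add_comm]
  congr 1
  refine Finset.sum_congr rfl fun j hj => ?_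
  have hj := Finset.ne_of_mem_erase hj
  simp [hj]

theorem score_eq {n m : ℕ} (k : ℕ) (V : Profile n m) (i : Fin n) (c : Fin m) :
    score k V c = othersScore k V i c + if c ∈ Vote.top k (V i) then 1 else 0 := by
  rw [← score_update, Function.update_eq_self]

/-- Tie-breaking enters as a penalty of one point against those candidates whom the order ranks
above the winner. This turns winning into linear inequalities between scores. -/
theorem winner_spec {n m : ℕ} [NeZero m] (k : ℕ) (tie : Vote m) (V : Profile n m) (e : Fin m) :
    score k V e + (if tie.symm e < tie.symm (winner k tie V) then 1 else 0) ≤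
      score k V (winner k tie V) := by
  have hmem := Finset.min'_mem _ (exists_max_score k tie V)
  have hmax : ∀ d, score k V d ≤ score k V (winner k tie V) := (Finset.mem_filter.1 hmem).2
  split_ifs with h
  · by_contra! hc
    have heq : score k V e = score k V (winner k tie V) := le_antisymm (hmax e) (by omega)
    have h1 : tie.symm (winner k tie V) ≤ tie.symm e := by
      rw [winner, Equiv.symm_apply_apply]
      refine Finset.min'_le _ _ ?_
      simp only [Finset.mem_filter, Finset.mem_univ, true_and, Equiv.apply_symm_apply]
      exact fun d => (hmax d).trans heq.ge
    exact absurd h (not_lt.2 h1)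
  · exact hmax e

theorem winner_eq_iff {n m : ℕ} [NeZero m] (k : ℕ) (tie : Vote m) (V : Profile n m) (c : Fin m) :
    winner k tie V = c ↔ ∀ e, e ≠ c →
      score k V e + (if tie.symm e < tie.symm c then 1 else 0) ≤ score k V c := by
  constructor
  · rintro rfl e -
    exact winner_spec k tie V e
  · intro h
    by_contra hne
    have h1 := h _ hne
    have h2 := winner_spec k tie V c
    have h3 : tie.symm (winner k tie V) ≠ tie.symm c := fun e => hne (tie.symm.injective e)
    rcases lt_or_gt_of_ne h3 with h4 | h4
    · simp only [h4, if_true] at h1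
      split_ifs at h2 <;> omega
    · simp only [h4, if_true] at h2
      split_ifs at h1 <;> omega

theorem exists_top_pair {m : ℕ} {a q : Fin m} (haq : a ≠ q) (hm : 2 < m) :
    ∃ v : Vote m, ∀ c, c ∈ Vote.top 2 v ↔ c = a ∨ c = q := by
  let p0 : Fin m := ⟨0, by omega⟩
  let p1 : Fin m := ⟨1, by omega⟩
  have h01 : p0 ≠ p1 := by simp [p0, p1]
  let σ := Equiv.swap p0 a
  have hσ : σ.symm q ≠ p0 := by
    intro h
    rw [Equiv.symm_apply_eq] at h
    exact haq (by rw [h]; simp [σ])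
  refine ⟨(Equiv.swap p1 (σ.symm q)).trans σ, fun c => ?_⟩
  have h0 : ((Equiv.swap p1 (σ.symm q)).trans σ) p0 = a := by
    rw [Equiv.trans_apply, Equiv.swap_apply_of_ne_of_ne h01 hσ.symm, Equiv.swap_apply_left]
  have h1 : ((Equiv.swap p1 (σ.symm q)).trans σ) p1 = q := by simp
  generalize (Equiv.swap p1 (σ.symm q)).trans σ = w at h0 h1
  rw [Vote.mem_top, ← h0, ← h1, ← Equiv.symm_apply_eq, ← Equiv.symm_apply_eq]
  simp only [Fin.ext_iff, p0, p1]
  omega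

/-- If v approves of a but not of q, and u of q but not of a, let all other voters approve exactly
of a and q. These two are then tied up to the vote of i, so u elects q and v elects a. At least one
other voter is needed to rule out all further candidates. -/
theorem Equivalent.top_subset {n m : ℕ} [NeZero m] {tie u v : Vote m}
    (h : Equivalent n 2 tie u v) (i : Fin n) (hn : 1 < n) (hm : 2 < m) {a : Fin m}
    (ha : a ∈ Vote.top 2 v) : a ∈ Vote.top 2 u := by
  by_contra hau
  obtain ⟨q, hq, hq'⟩ : ∃ q ∈ Vote.top 2 u, q ∉ Vote.top 2 v := by
    by_contra! hc
    have := Finset.eq_of_subset_of_card_le (show Vote.top 2 u ⊆ Vote.top 2 v from hc)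
      (by rw [Vote.card_top hm.le, Vote.card_top hm.le])
    exact hau (this ▸ ha)
  have haq : a ≠ q := fun e => hq' (e ▸ ha)
  obtain ⟨t, ht⟩ := exists_top_pair haq hm
  have ho : ∀ c, othersScore 2 (fun _ : Fin n => t) i c = if c = a ∨ c = q then n - 1 else 0 := by
    intro c
    unfold othersScore
    split_ifs with hc
    · simp only [(ht c).2 hc, and_true]
      rw [Finset.filter_ne', Finset.card_erase_of_mem (Finset.mem_univ i)]
      simp
    · simp only [mt (ht c).1 hc, and_false]
      simp
  have h1 : winner 2 tie (Function.update (fun _ : Fin n => t) i u) = q := by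
    rw [winner_eq_iff]
    intro e he
    simp only [score_update, ho, hq, if_true, or_true]
    by_cases hea : e = a
    · subst hea; simp only [hau, if_false, true_or, if_true]; split_ifs <;> omega
    · simp only [hea, he, or_self, if_false]; split_ifs <;> omega
  have h2 : winner 2 tie (Function.update (fun _ : Fin n => t) i v) = a := by
    rw [winner_eq_iff]
    intro e he
    simp only [score_update, ho, ha, if_true, true_or]
    by_cases heq : e = q
    · subst heq; simp only [hq', if_false, or_true, if_true]; split_ifs <;> omega
    · simp only [heq, he, or_self, if_false]; split_ifs <;> omega
  exact haq (by rw [← h1, ← h2, h i])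

/-! ### What a manipulator approves of -/

section Manipulation

variable {n m : ℕ} [NeZero m] {tie : Vote m} {V : Profile n m} {i : Fin n} {v : Vote m}

theorem IsManipulative.winner_ne {k : ℕ} (h : IsManipulative k tie V i v) :
    winner k tie (Function.update V i v) ≠ winner k tie V := fun e => by
  unfold IsManipulative at h
  rw [e] at h
  exact lt_irrefl _ h

/-- The comparison of the old and the new winner at both profiles. -/
theorem IsManipulative.compare {k : ℕ} (h : IsManipulative k tie V i v) :
    othersScore k V i (winner k tie (Function.update V i v)) +
        (if winner k tie (Function.update V i v) ∈ Vote.top k (V i) then 1 else 0) +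
        (if winner k tie V ∈ Vote.top k v then 1 else 0) + 1 ≤
      (if winner k tie V ∈ Vote.top k (V i) then 1 else 0) +
        (if winner k tie (Function.update V i v) ∈ Vote.top k v then 1 else 0) +
      othersScore k V i (winner k tie (Function.update V i v)) := by
  have hne := h.winner_ne
  have h1 := winner_spec k tie V (winner k tie (Function.update V i v))
  have h2 := winner_spec k tie (Function.update V i v) (winner k tie V)
  rw [score_eq k V i, score_eq k V i] at h1
  rw [score_update, score_update] at h2
  have h3 : tie.symm (winner k tie (Function.update V i v)) ≠ tie.symm (winner k tie V) :=
    fun e => hne (tie.symm.injective e)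
  -- One of the two winners is ahead in the tie-breaking order, so one of the two comparisons is
  -- strict.
  have h4 : (1 : ℕ) ≤ (if tie.symm (winner k tie (Function.update V i v)) <
      tie.symm (winner k tie V) then 1 else 0) + (if tie.symm (winner k tie V) <
      tie.symm (winner k tie (Function.update V i v)) then 1 else 0) := by
    rcases lt_or_gt_of_ne h3 with h4 | h4 <;> simp [h4]
  omega

/-- A sincere vote that gives the old winner nothing cannot be made to hurt him, so the new winner
has to gain a point. -/
theorem IsManipulative.mem_top {k : ℕ} (h : IsManipulative k tie V i v)
    (hw : winner k tie V ∉ Vote.top k (V i)) :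
    winner k tie (Function.update V i v) ∈ Vote.top k v := by
  by_contra hz
  have := h.compare
  simp only [hw, hz, if_false] at this
  omega

/-- Only the favourite is preferred to an approved winner. He has his point already, so the
manipulation must take away the point of the old winner, who is in second position. -/
theorem IsManipulative.of_mem_top (h : IsManipulative 2 tie V i v)
    (hw : winner 2 tie V ∈ Vote.top 2 (V i)) :
    winner 2 tie V ∉ Vote.top 2 v ∧
      ((V i).symm (winner 2 tie (Function.update V i v)) : ℕ) = 0 ∧
      ((V i).symm (winner 2 tie V) : ℕ) = 1 := by
  have h1 : ((V i).symm (winner 2 tie (Function.update V i v)) : ℕ) <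
    ((V i).symm (winner 2 tie V) : ℕ) := h
  have h2 := Vote.mem_top.1 hw
  refine ⟨fun hw' => ?_, by omega, by omega⟩
  have hz : winner 2 tie (Function.update V i v) ∈ Vote.top 2 (V i) := Vote.mem_top.2 (by omega)
  have := h.compare
  simp only [hw, hz, hw', if_true] at this
  split_ifs at this <;> omega

/-- A minimal manipulation under 2-approval keeps one of the two approved candidates. -/
theorem IsMinimalManipulation.inter_nonempty (h : IsMinimalManipulation 2 tie V i v) (hn : 1 < n)
    (hm : 2 < m) : (Vote.top 2 v ∩ Vote.top 2 (V i)).Nonempty := by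
  by_contra hdis
  obtain ⟨hman, ℓ, ⟨x, y, hx, hy, hxy, hfix⟩, hmin⟩ := h
  have hdis : ∀ c, c ∈ Vote.top 2 v → c ∉ Vote.top 2 (V i) := fun c h1 h2 =>
    hdis ⟨c, Finset.mem_inter.2 ⟨h1, h2⟩⟩
  set a := V i ⟨0, by omega⟩ with ha
  set b := V i ⟨1, by omega⟩ with hb
  have hab : a ≠ b := by simp [ha, hb]
  have htop : ∀ c, c ∈ Vote.top 2 (V i) ↔ c = a ∨ c = b := by
    intro c
    rw [Vote.mem_top, ha, hb, ← Equiv.symm_apply_eq, ← Equiv.symm_apply_eq]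
    simp only [Fin.ext_iff]
    omega
  have hrange : ∀ c ∈ Vote.top 2 (V i), c ∈ Set.range x := by
    intro c hc
    by_contra hcx
    have hcy : c ∉ Set.range y := by
      rintro ⟨j, rfl⟩; exact hy j hc
    have := hfix c hcx hcy
    exact hdis c (by rw [Vote.mem_top, this]; exact Vote.mem_top.1 hc) hc
  -- A vote that drops both approved candidates swaps both of them.
  have hℓ : 2 ≤ ℓ := by
    have hsub : Vote.top 2 (V i) ⊆ Finset.univ.map x := fun c hc => by
      obtain ⟨j, hj⟩ := hrange c hc
      exact Finset.mem_map.2 ⟨j, Finset.mem_univ j, hj⟩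
    have := Finset.card_le_card hsub
    rwa [Vote.card_top hm.le, Finset.card_map, Finset.card_univ, Fintype.card_fin] at this
  set z := winner 2 tie (Function.update V i v) with hz
  -- No manipulation keeps the favourite a. By minimality it would be equivalent to a swap of at
  -- least two candidates, that is, of both approved ones; such a swap drops a, while equivalent
  -- votes approve of the same candidates.
  have key : ∀ r, r ∉ Vote.top 2 (V i) → ∀ v' : Vote m, (∀ c, c ∈ Vote.top 2 v' ↔ c = a ∨ c = r) →
      ¬ IsManipulative 2 tie V i v' := by
    intro r hr v' hv' hman'
    have hav' : a ∈ Vote.top 2 v' := (hv' a).2 (.inl rfl)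
    have hne : v' ≠ v := by
      rintro rfl
      exact hdis a hav' ((htop a).2 (.inl rfl))
    obtain ⟨ℓ', u, ⟨x', y', hx', hy', hxy', -⟩, heq, hle⟩ := hmin v' hne hman'
    have hau := heq.top_subset i hn hm hav'
    have : Finset.univ.map x' = Vote.top 2 (V i) := by
      refine Finset.eq_of_subset_of_card_le ?_ ?_
      · intro c hc
        obtain ⟨j, -, rfl⟩ := Finset.mem_map.1 hc
        exact hx' j
      · rw [Vote.card_top hm.le, Finset.card_map, Finset.card_univ, Fintype.card_fin]
        omega
    have haT : a ∈ Finset.univ.map x' := this ▸ (htop a).2 (.inl rfl)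
    obtain ⟨j, -, hj⟩ := Finset.mem_map.1 haT
    rw [Vote.mem_top, ← hj, (hxy' j).1] at hau
    exact hy' j (Vote.mem_top.2 hau)
  have hpair : ∀ r, r ∉ Vote.top 2 (V i) → a ≠ r := by
    rintro r hr rfl
    exact hr ((htop a).2 (.inl rfl))
  have hspec := (winner_eq_iff 2 tie (Function.update V i v) z).1 hz.symm
  simp only [score_update] at hspec
  have hpref : Vote.Prefers (V i) z (winner 2 tie V) := hman
  by_cases hw : winner 2 tie V ∈ Vote.top 2 (V i)
  · obtain ⟨hw', hz0, hw1⟩ := hman.of_mem_top hw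
    have hza : z = a := by
      rw [ha, ← Equiv.symm_apply_eq]; exact Fin.ext hz0
    obtain ⟨p, hp⟩ : (Vote.top 2 v).Nonempty := by
      rw [← Finset.card_pos, Vote.card_top hm.le]; omega
    have hp' := hdis p hp
    obtain ⟨v', hv'⟩ := exists_top_pair (hpair p hp') hm
    -- Here z = a. Compared with `v`, the vote for {a, p} gives z a point that was missing, and
    -- every rival gains at most one point.
    refine key p hp' v' hv' ?_
    have : winner 2 tie (Function.update V i v') = z := by
      rw [winner_eq_iff]
      intro e he
      have h1 := hspec e he
      have h2 : z ∉ Vote.top 2 v := fun h => hdis z h ((htop z).2 (.inl hza))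
      have h3 : z ∈ Vote.top 2 v' := (hv' z).2 (.inl hza)
      simp only [score_update, h2, h3, if_true, if_false] at h1 ⊢
      have : (if e ∈ Vote.top 2 v' then 1 else 0) ≤ 1 := by split_ifs <;> omega
      omega
    unfold IsManipulative
    rwa [this]
  · have hzv : z ∈ Vote.top 2 v := hman.mem_top hw
    have hz' := hdis z hzv
    obtain ⟨v', hv'⟩ := exists_top_pair (hpair z hz') hm
    -- Here the vote for {a, z} helps no rival but a, compared with `v`. With his sincere point, a
    -- did not beat the old winner at `V`, and the old winner does not beat z at the new profile; so
    -- a does not beat z.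
    refine key z hz' v' hv' ?_
    have : winner 2 tie (Function.update V i v') = z := by
      rw [winner_eq_iff]
      intro e he
      have h3 : z ∈ Vote.top 2 v' := (hv' z).2 (.inr rfl)
      have h1 := hspec e he
      simp only [score_update, hzv, h3, if_true] at h1 ⊢
      by_cases hea : e = a
      · have haT : a ∈ Vote.top 2 (V i) := (htop a).2 (.inl rfl)
        have h4 := winner_spec 2 tie V a
        have h5 := hspec _ hman.winner_ne.symm
        have h6 : e ∈ Vote.top 2 v' := (hv' e).2 (.inl hea)
        rw [score_eq 2 V i, score_eq 2 V i] at h4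
        simp only [haT, hw, hzv, if_true, if_false] at h4 h5
        rw [hea] at h6 ⊢
        simp only [h6, if_true]
        -- Transitivity of the tie-breaking order, written as subadditivity of the penalties.
        have h7 : (if tie.symm a < tie.symm z then 1 else 0) ≤
            (if tie.symm a < tie.symm (winner 2 tie V) then 1 else 0) +
              (if tie.symm (winner 2 tie V) < tie.symm z then 1 else 0) := by
          by_cases g2 : tie.symm a < tie.symm (winner 2 tie V)
          · rw [if_pos g2]; split_ifs <;> omega
          · by_cases g3 : tie.symm (winner 2 tie V) < tie.symm z
            · rw [if_pos g3]; split_ifs <;> omega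
            · rw [if_neg ((not_lt.1 g3).trans (not_lt.1 g2)).not_gt]
              exact Nat.zero_le _
        omega
      · have h6 : e ∉ Vote.top 2 v' := fun h => by
          rcases (hv' e).1 h with h | h
          exacts [hea h, he h]
        simp only [h6, if_false]
        omega
    unfold IsManipulative
    rwa [this]

end Manipulation

/-! ### Intersecting options, and weak dominance in terms of outcomes -/

namespace GSGame

variable {n m : ℕ} [NeZero n] [NeZero m]

/-- Prepending the sincere vote treats players and non-players alike: the list of a non-player is
empty, and a player has his sincere vote among his strategies anyway. -/
theorem isGSProfile_iff {k : ℕ} (G : GSGame k n m) (W : Profile n m) :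
    G.IsGSProfile W ↔ ∀ i, i ≠ 0 → W i ∈ G.V i :: G.A i := by
  refine forall_congr' fun i => imp_congr_right fun hi => ?_
  by_cases h : IsGSManipulator k G.tie G.V i
  · simp only [h, true_implies, not_true_eq_false, false_implies, and_true, List.mem_cons]
    refine ⟨.inr, ?_⟩
    rintro (h' | h')
    · rw [h']; exact G.truthful_mem i hi h
    · exact h'
  · simp [h, G.A_eq_nil i (.inr h)]

/-- The sets of approved candidates of any two options of a voter have a common element. -/
theorem OthersMinimal.inter_nonempty {G : GSGame 2 n m} (hG : G.OthersMinimal) {i : Fin n}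
    (hi : i ≠ 0) {v v' : Vote m} (hv : v ∈ G.V i :: G.A i) (hv' : v' ∈ G.V i :: G.A i) :
    (Vote.top 2 v ∩ Vote.top 2 v').Nonempty := by
  have hm := G.k_lt_m
  have hn : 1 < n := by
    have h1 := i.isLt
    have h2 : (i : ℕ) ≠ 0 := fun h => hi (Fin.ext (by simpa using h))
    omega
  have hself : ∀ v : Vote m, (Vote.top 2 v ∩ Vote.top 2 v).Nonempty := fun v => by
    rw [Finset.inter_self, ← Finset.card_pos, Vote.card_top hm.le]; omega
  by_cases hman : IsGSManipulator 2 G.tie G.V i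
  · have cases : ∀ v, v ∈ G.V i :: G.A i → v = G.V i ∨
        (IsMinimalManipulation 2 G.tie G.V i v ∧ IsLevelOne 2 G.tie G.V i v) := by
      intro v hv
      rcases List.mem_cons.1 hv with hv | hv
      · exact .inl hv
      · rcases hG i hi hman v hv with h1 | h1
        · exact .inl h1
        · rcases G.levelOne i hi hman v hv with h2 | h2
          · exact .inl h2
          · exact .inr ⟨h1, h2⟩
    rcases cases v hv with rfl | ⟨h1, l1⟩
    · rcases cases v' hv' with rfl | ⟨h2, -⟩
      · exact hself _
      · rw [Finset.inter_comm]; exact h2.inter_nonempty hn hm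
    · rcases cases v' hv' with rfl | ⟨h2, l2⟩
      · exact h1.inter_nonempty hn hm
      · have hw : winner 2 G.tie (Function.update G.V i v) =
            winner 2 G.tie (Function.update G.V i v') := by
          by_contra hne
          exact lt_asymm (l1 _ ⟨v', rfl⟩ (Ne.symm hne)) (l2 _ ⟨v, rfl⟩ hne)
        by_cases hwt : winner 2 G.tie G.V ∈ Vote.top 2 (G.V i)
        -- A minimal manipulation keeps one of the two approved candidates. It drops the old winner,
        -- who is second, so it keeps the favourite, who is the new winner.
        · have key : ∀ v, IsMinimalManipulation 2 G.tie G.V i v →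
              winner 2 G.tie (Function.update G.V i v) ∈ Vote.top 2 v := by
            intro v h
            obtain ⟨g1, g2, g3⟩ := h.1.of_mem_top hwt
            obtain ⟨c, hc⟩ := h.inter_nonempty hn hm
            rw [Finset.mem_inter] at hc
            have hc2 := Vote.mem_top.1 hc.2
            have : ((G.V i).symm c : ℕ) ≠ 1 := by
              intro e
              have : c = winner 2 G.tie G.V :=
                (G.V i).symm.injective (Fin.ext (e.trans g3.symm))
              exact g1 (this ▸ hc.1)
            have : c = winner 2 G.tie (Function.update G.V i v) :=
              (G.V i).symm.injective (Fin.ext (by omega))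
            exact this ▸ hc.1
          exact ⟨_, Finset.mem_inter.2 ⟨key v h1, hw ▸ key v' h2⟩⟩
        · exact ⟨_, Finset.mem_inter.2 ⟨h1.1.mem_top hwt, hw ▸ h2.1.mem_top hwt⟩⟩
  · rw [G.A_eq_nil i (.inr hman)] at hv hv'
    rw [List.mem_singleton.1 hv, List.mem_singleton.1 hv']
    exact hself _

/-- Some profile of the game makes `c` the winner if voter `0` votes `u`, and `d` if voter `0`
votes `v`, where the other voters give `τ` points to `c` and `τ'` points to `d`. -/
def Outcome {k : ℕ} (G : GSGame k n m) (u v : Vote m) (c d : Fin m) (τ τ' : ℕ) : Prop :=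
  ∃ W, (∀ i, i ≠ 0 → W i ∈ G.V i :: G.A i) ∧
    winner k G.tie (Function.update W 0 u) = c ∧ winner k G.tie (Function.update W 0 v) = d ∧
    othersScore k W 0 c = τ ∧ othersScore k W 0 d = τ'

theorem othersScore_lt {n m : ℕ} [NeZero n] (k : ℕ) (W : Profile n m) (c : Fin m) :
    othersScore k W 0 c < n := by
  unfold othersScore
  refine (Finset.card_lt_card (t := Finset.univ) ?_).trans_eq (by simp)
  refine ⟨Finset.subset_univ _, fun h => ?_⟩
  have := h (Finset.mem_univ 0)
  simp at this

/-- Preferences are strict, so domination fails at a profile exactly if d is strictly preferred to c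
there. The bounds on τ and τ' make the search finite and lose nothing, since voter `0` is not
counted in these scores. -/
theorem weaklyDominates_iff {k : ℕ} (G : GSGame k n m) (u v : Vote m) :
    G.WeaklyDominates u v ↔
      (¬ ∃ c d τ τ', τ < n ∧ τ' < n ∧ G.Outcome u v c d τ τ' ∧ Vote.Prefers (G.V 0) d c) ∧
      ∃ c d τ τ', τ < n ∧ τ' < n ∧ G.Outcome u v c d τ τ' ∧ Vote.Prefers (G.V 0) c d := by
  unfold WeaklyDominates
  refine and_congr ?_ ?_
  · constructor
    · rintro h ⟨c, d, τ, τ', -, -, ⟨W, hW, rfl, rfl, -⟩, hp⟩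
      rcases h W ((G.isGSProfile_iff W).2 hW) with h' | h'
      · exact lt_asymm hp h'
      · rw [h'] at hp
        exact lt_irrefl _ hp
    · intro h W hW
      by_contra hc
      unfold AtLeastAsGood at hc
      push Not at hc
      refine h ⟨_, _, _, _, othersScore_lt k W _, othersScore_lt k W _,
        ⟨W, (G.isGSProfile_iff W).1 hW, rfl, rfl, rfl, rfl⟩, ?_⟩
      exact lt_of_le_of_ne (not_lt.1 hc.1) fun e => hc.2 ((G.V 0).symm.injective e.symm)
  · constructor
    · rintro ⟨W, hW, hs⟩
      exact ⟨_, _, _, _, othersScore_lt k W _, othersScore_lt k W _,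
        ⟨W, (G.isGSProfile_iff W).1 hW, rfl, rfl, rfl, rfl⟩, hs⟩
    · rintro ⟨c, d, τ, τ', -, -, ⟨W, hW, rfl, rfl, -⟩, hp⟩
      exact ⟨W, (G.isGSProfile_iff W).2 hW, hp⟩

end GSGame

end Voting

/-! ### The algorithm -/

/-! ### Effects of structured programs, and Boolean terms -/

namespace RAM

theorem Cmd.sem_set {B x : ℕ} {t : Tm} {s : State} :
    (Cmd.set x t).sem B s = s.set x (t.eval B s) := rfl

theorem Cmd.sem_put {B a : ℕ} {t t' : Tm} {s : State} :
    (Cmd.put a t t').sem B s = s.put a (t.eval B s) (t'.eval B s) := rfl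

theorem Cmd.sem_seq {B : ℕ} {C D : Cmd} {s : State} :
    (Cmd.seq C D).sem B s = D.sem B (C.sem B s) := rfl

theorem Cmd.sem_skip {B : ℕ} {s : State} : Cmd.skip.sem B s = s := rfl

theorem Cmd.sem_ite_pos {B : ℕ} {t : Tm} {C D : Cmd} {s : State} (h : t.eval B s ≠ 0) :
    (Cmd.ite t C D).sem B s = C.sem B s := if_pos h

theorem Cmd.sem_ite_neg {B : ℕ} {t : Tm} {C D : Cmd} {s : State} (h : ¬ t.eval B s ≠ 0) :
    (Cmd.ite t C D).sem B s = D.sem B s := if_neg h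

/-- The variables that a program may change. -/
def Cmd.modVars : Cmd → List ℕ
  | .set x _ => [x]
  | .put _ _ _ => []
  | .seq C D => C.modVars ++ D.modVars
  | .ite _ C D => C.modVars ++ D.modVars
  | .skip => []
  | .loop x C => x :: C.modVars

/-- The arrays that a program may change. -/
def Cmd.modArrs : Cmd → List ℕ
  | .set _ _ => []
  | .put a _ _ => [a]
  | .seq C D => C.modArrs ++ D.modArrs
  | .ite _ C D => C.modArrs ++ D.modArrs
  | .skip => []
  | .loop _ C => C.modArrs

/-- The frame rule. For the concrete programs below its hypothesis is settled by `decide`. -/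
theorem Cmd.sem_vars (B : ℕ) {y : ℕ} (C : Cmd) :
    y ∉ C.modVars → ∀ s, (C.sem B s).vars y = s.vars y := by
  induction C with
  | set x t => intro h s; simp_all [Cmd.modVars, Cmd.sem]
  | put a t₁ t₂ => intro _ s; simp [Cmd.sem]
  | seq C D ihC ihD => intro h s; simp_all [Cmd.modVars, Cmd.sem]
  | ite t C D ihC ihD =>
    intro h s
    simp only [Cmd.modVars, List.mem_append, not_or] at h
    simp only [Cmd.sem]
    split_ifs
    exacts [ihC h.1 s, ihD h.2 s]
  | skip => intro _ s; rfl
  | loop x C ih =>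
    intro h s
    simp only [Cmd.modVars, List.mem_cons, not_or] at h
    refine iterate_induction (fun _ s' => s'.vars y = s.vars y) rfl fun i _ s' hs' => ?_
    rw [ih h.2, State.set_vars, Function.update_of_ne h.1, hs']

theorem Cmd.sem_arrs (B : ℕ) {a : ℕ} (C : Cmd) :
    a ∉ C.modArrs → ∀ s, (C.sem B s).arrs a = s.arrs a := by
  induction C with
  | set x t => intro _ s; simp [Cmd.sem]
  | put b t₁ t₂ => intro h s; simp_all [Cmd.modArrs, Cmd.sem]
  | seq C D ihC ihD => intro h s; simp_all [Cmd.modArrs, Cmd.sem]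
  | ite t C D ihC ihD =>
    intro h s
    simp only [Cmd.modArrs, List.mem_append, not_or] at h
    simp only [Cmd.sem]
    split_ifs
    exacts [ihC h.1 s, ihD h.2 s]
  | skip => intro _ s; rfl
  | loop x C ih =>
    intro h s
    simp only [Cmd.modArrs] at h
    refine iterate_induction (fun _ s' => s'.arrs a = s.arrs a) rfl fun i _ s' hs' => ?_
    rw [ih h, State.set_arrs, hs']

/-- Filling an array with the values of a term. -/
theorem Cmd.sem_loop_put {B x a : ℕ} {t : Tm} {s : State} {j y : ℕ} (hj : j < B)
    (h : ∀ s' : State, s'.vars x = j → (∀ z, z ≠ x → s'.vars z = s.vars z) →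
      (∀ b, b ≠ a → s'.arrs b = s.arrs b) → t.eval B s' = y) :
    ((Cmd.loop x (.put a (.var x) t)).sem B s).arrs a j = y := by
  refine (iterate_induction (fun i s' => (∀ z, z ≠ x → s'.vars z = s.vars z) ∧
    (∀ b, b ≠ a → s'.arrs b = s.arrs b) ∧ (j < i → s'.arrs a j = y))
    ⟨fun _ _ => rfl, fun _ _ => rfl, by simp⟩ ?_).2.2 hj
  rintro i - s' ⟨h1, h2, h3⟩
  have h1' : ∀ z, z ≠ x → (s'.set x i).vars z = s.vars z := fun z hz => by
    simp [hz, h1 z hz]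
  refine ⟨h1', fun b hb => by simp [Cmd.sem, hb, h2 b hb], fun hji => ?_⟩
  by_cases e : j = i
  · subst e; simp [Cmd.sem, Tm.eval, h (s'.set x j) (by simp) h1' h2]
  · simp [Cmd.sem, Tm.eval, e, h3 (by omega)]

namespace Tm

/-- `a < b` -/
def lt (a b : Tm) : Tm := .sub b a

/-- `a = b` -/
def eq (a b : Tm) : Tm := .ite (.add (.sub a b) (.sub b a)) (.num 0) (.num 1)

/-- conjunction -/
def and (a b : Tm) : Tm := .ite a b (.num 0)

/-- disjunction -/
def or (a b : Tm) : Tm := .ite a (.num 1) b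

/-- negation -/
def not (a : Tm) : Tm := .ite a (.num 0) (.num 1)

variable {B : ℕ} {s : State} {a b : Tm}

theorem eval_lt : (lt a b).eval B s ≠ 0 ↔ a.eval B s < b.eval B s := by
  simp only [lt, Tm.eval]; omega

theorem eval_eq : (eq a b).eval B s = if a.eval B s = b.eval B s then 1 else 0 := by
  simp only [eq, Tm.eval]
  by_cases h : a.eval B s = b.eval B s
  · simp [h]
  · simp [h]; omega

theorem eval_eq_ne : (eq a b).eval B s ≠ 0 ↔ a.eval B s = b.eval B s := by
  simp [eval_eq]

theorem eval_and : (and a b).eval B s ≠ 0 ↔ a.eval B s ≠ 0 ∧ b.eval B s ≠ 0 := by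
  simp only [and, Tm.eval]; split_ifs <;> simp_all

theorem eval_or : (or a b).eval B s ≠ 0 ↔ a.eval B s ≠ 0 ∨ b.eval B s ≠ 0 := by
  simp only [or, Tm.eval]; split_ifs <;> simp_all

theorem eval_not : (not a).eval B s ≠ 0 ↔ ¬ a.eval B s ≠ 0 := by
  simp only [not, Tm.eval]; split_ifs <;> simp_all

theorem eval_sum_ne {x : ℕ} : (Tm.sum x a).eval B s ≠ 0 ↔ ∃ j < B, a.eval B (s.set x j) ≠ 0 := by
  simp [Tm.eval]

end Tm

end RAM

/-! ### The program -/

namespace Voting.Algorithm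

open RAM

/-! Array `0` holds the input word, array `1` the owners of the options, array `2` the options that
the agents hold, array `3` the filler tokens, array `4` the heights, and array `5` the capacities.
An option is named by its position in the input word. Variables `1` and `2` hold `n` and `m`,
variables `3` to `6` hold `c`, `d` and their targets. -/

/-- The entry of the input word at a position. -/
def inp (t : Tm) : Tm := .get 0 t

/-- The position of the first strategy of player `0` in the input word. -/
def uAt : Tm := .add (.num 2) (.var 2)

/-- The position of the second strategy of player `0` in the input word. -/
def vAt : Tm := .add uAt (.var 2)

/-- The position of the sincere vote of player `0` in the input word. -/
def sincereAt : Tm := .add vAt (.var 2)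

/-- `1` if the vote at position `p` approves of `e`, else `0`. -/
def isTop (p e : Tm) : Tm := .or (.eq (inp p) e) (.eq (inp (.add p (.num 1))) e)

/-- The rank of `e` in the vote at position `p`. -/
def rankOf (p e : Tm) : Tm :=
  .find 31 (.and (.lt (.var 31) (.var 2)) (.eq (inp (.add p (.var 31))) e))

/-- `1` if the vote at position `p` prefers `a` to `b`, else `0`. -/
def above (p a b : Tm) : Tm := .ite (.lt (rankOf p a) (rankOf p b)) (.num 1) (.num 0)

/-- The points that `c` must have in addition to those that `e` receives from the other voters. -/
def penaltyU (e : Tm) : Tm := .add (isTop uAt e) (above (.num 2) e (.var 3))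

/-- The points that `d` must have in addition to those that `e` receives from the other voters. -/
def penaltyV (e : Tm) : Tm := .add (isTop vAt e) (above (.num 2) e (.var 4))

/-- The score of `c`. -/
def totalU : Tm := .add (.var 5) (isTop uAt (.var 3))

/-- The score of `d`. -/
def totalV : Tm := .add (.var 6) (isTop vAt (.var 4))

/-- The smaller of two values. -/
def minOf (a b : Tm) : Tm := .ite (.lt a b) a b

/-- The capacity of the candidate in variable `7`. -/
def capacity : Tm := .ite (.eq (.var 7) (.var 3)) (.var 5) (.ite (.eq (.var 7) (.var 4)) (.var 6)
  (minOf (.sub totalU (penaltyU (.var 7))) (.sub totalV (penaltyV (.var 7)))))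

/-- The number of tokens on `x`. -/
def loadOf (x : Tm) : Tm := .add (.get 3 x) (.sum 30
  (.ite (.and (.lt (.num 0) (.var 30)) (.lt (.var 30) (.var 1))) (isTop (.get 2 (.var 30)) x)
    (.num 0)))

/-- `x` is active. -/
def isActive (x : Tm) : Tm :=
  .and (.lt x (.var 2)) (.and (.lt (.get 5 x) (loadOf x)) (.lt (.get 4 x) (.var 2)))

/-- A candidate approved by the option `p` but not by the option `q`. -/
def newOf (q p : Tm) : Tm := .ite (isTop q (inp p)) (inp (.add p (.num 1))) (inp p)

/-- The option that the owner of the option in variable `32` holds. -/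
def heldOption : Tm := .get 2 (.get 1 (.var 32))

/-- The option in variable `32` allows a push of the candidate in variable `15`. -/
def canPush : Tm := .and (.get 1 (.var 32)) (.and (isTop heldOption (.var 15))
  (.and (.not (isTop (.var 32) (.var 15)))
    (.eq (.get 4 (.var 15)) (.add (.get 4 (newOf heldOption (.var 32))) (.num 1)))))

/-- The candidate in variable `33` may have filler tokens. -/
def isFree : Tm := .and (.lt (.var 33) (.var 2))
  (.and (.not (.eq (.var 33) (.var 3))) (.not (.eq (.var 33) (.var 4))))

/-- A filler token can be pushed from the candidate in variable `15` to the one in variable `33`. -/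
def canFill : Tm := .and (.get 3 (.var 15))
  (.and isFree (.eq (.get 4 (.var 15)) (.add (.get 4 (.var 33)) (.num 1))))

/-- One step of the push-relabel algorithm. -/
def stepCmd : Cmd :=
  .seq (.set 15 (.find 34 (isActive (.var 34))))
    (.ite (.lt (.var 15) .bound)
      (.seq (.set 16 (.find 32 canPush))
        (.ite (.lt (.var 16) .bound) (.put 2 (.get 1 (.var 16)) (.var 16))
          (.seq (.set 17 (.find 33 canFill))
            (.ite (.lt (.var 17) .bound)
              (.seq (.put 3 (.var 15) (.sub (.get 3 (.var 15)) (.num 1)))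
                (.put 3 (.var 17) (.add (.get 3 (.var 17)) (.num 1))))
              (.put 4 (.var 15) (.add (.get 4 (.var 15)) (.num 1)))))))
      .skip)

/-- Twice the number of agents. -/
def agentTokens : Tm := .add (.sub (.var 1) (.num 1)) (.sub (.var 1) (.num 1))

/-- The initial configuration of the push-relabel algorithm. -/
def setupCmd : Cmd :=
  .seq (.loop 7 (.put 5 (.var 7) capacity))
    (.seq (.set 8 (.sum 30 (.ite (.lt (.var 30) (.var 2)) (.get 5 (.var 30)) (.num 0))))
      (.seq (.set 17 (.find 33 isFree))
        (.seq (.loop 7 (.put 4 (.var 7) (.num 0)))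
          -- All filler tokens start on one free candidate; the algorithm spreads them.
          (.seq (.loop 7 (.put 3 (.var 7)
              (.ite (.eq (.var 7) (.var 17)) (.sub (.var 8) agentTokens) (.num 0))))
            (.loop 7 (.put 2 (.var 7) (.find 32 (.eq (.get 1 (.var 32)) (.var 7)))))))))

/-- The conditions on the targets that do not concern the votes of the agents. -/
def isConsistent : Tm :=
  .and (.not (.lt (.var 8) agentTokens))
    (.and (.not (.lt totalU (.add (.var 6) (penaltyU (.var 4)))))
      (.and (.not (.lt totalV (.add (.var 5) (penaltyV (.var 3)))))
        (.not (.sum 33 (.and isFree (.or (.lt totalU (penaltyU (.var 33)))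
          (.lt totalV (penaltyV (.var 33)))))))))

/-- No candidate is overloaded. -/
def isFeasible : Tm :=
  .not (.sum 34 (.and (.lt (.var 34) (.var 2)) (.lt (.get 5 (.var 34)) (loadOf (.var 34)))))

/-- Record in variable `9` or `10` that an outcome is possible that player `0` likes better with
the first or with the second strategy. -/
def recordCmd : Cmd :=
  .ite (.and isConsistent isFeasible)
    (.ite (.lt (rankOf sincereAt (.var 4)) (rankOf sincereAt (.var 3)))
      (.set 10 (.num 1)) (.set 9 (.num 1)))
    .skip

/-- Treat one choice of `c`, `d` and their targets. -/
def bodyCmd : Cmd :=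
  .ite (.and (.lt (.var 3) (.var 2)) (.and (.lt (.var 4) (.var 2)) (.not (.eq (.var 3) (.var 4)))))
    -- Four nested loops provide B⁴ steps, which is more than the initial potential whenever the
    -- targets are consistent.
    (.seq setupCmd (.seq (.loop 20 (.loop 21 (.loop 22 (.loop 23 stepCmd)))) recordCmd))
    .skip

/-- Store the owner, which is in variable `13`, of the option at the position in variable `11`,
and go to the next option. -/
def storeCmd : Cmd := .seq (.put 1 (.var 11) (.var 13)) (.set 11 (.add (.var 11) (.var 2)))

/-- Find the options of all voters in the input word. -/
def parseCmd : Cmd :=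
  .seq (.set 1 (inp (.num 0))) (.seq (.set 2 (inp (.num 1))) (.seq (.set 11 sincereAt)
    (.seq (.loop 13 (.ite (.lt (.var 13) (.var 1)) storeCmd .skip))
      (.loop 13 (.ite (.lt (.var 13) (.var 1))
        (.seq (.set 12 (inp (.var 11))) (.seq (.set 11 (.add (.var 11) (.num 1)))
          (.loop 14 (.ite (.lt (.var 14) (.var 12)) storeCmd .skip))))
        .skip)))))

/-- The algorithm. -/
def mainCmd : Cmd :=
  .seq parseCmd (.seq (.loop 3 (.loop 4 (.loop 5 (.loop 6 bodyCmd))))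
    (.set 0 (.ite (.and (.var 9) (.not (.var 10))) (.num 1) (.num 0))))

end Voting.Algorithm

/-! ### Reading the input word -/

namespace Voting.Algorithm

open RAM

/-- The word `l` occurs in `w` at position `p`. -/
def At (w : List ℕ) (p : ℕ) (l : List ℕ) : Prop := l <+: w.drop p

theorem at_append {w l l' : List ℕ} {p : ℕ} :
    At w p (l ++ l') ↔ At w p l ∧ At w (p + l.length) l' := by
  unfold At
  constructor
  · rintro ⟨t, ht⟩
    refine ⟨⟨l' ++ t, by rw [← ht, List.append_assoc]⟩, ⟨t, ?_⟩⟩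
    rw [← List.drop_drop, ← ht, List.append_assoc, List.drop_left]
  · rintro ⟨⟨t, ht⟩, ⟨t', ht'⟩⟩
    refine ⟨t', ?_⟩
    rw [← List.drop_drop, ← ht, List.drop_left] at ht'
    rw [← ht, ← ht', List.append_assoc]

theorem at_self (w : List ℕ) : At w 0 w := by simp [At]

theorem At.getD {w l : List ℕ} {p : ℕ} (h : At w p l) {r : ℕ} (hr : r < l.length) :
    w.getD (p + r) 0 = l[r] := by
  obtain ⟨t, ht⟩ := h
  have : (w.drop p)[r]? = some l[r] := by
    rw [← ht, List.getElem?_append_left hr, List.getElem?_eq_getElem hr]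
  rw [List.getElem?_drop] at this
  rw [List.getD_eq_getElem?_getD, this, Option.getD_some]

theorem At.le_length {w l : List ℕ} {p : ℕ} (h : At w p l) (hl : 0 < l.length) :
    p + l.length ≤ w.length := by
  have := h.length_le
  rw [List.length_drop] at this
  omega

theorem At.flatMap {α : Type*} {w : List ℕ} {p : ℕ} {L : List α} {f : α → List ℕ}
    (h : At w p (L.flatMap f)) {i : ℕ} (hi : i < L.length) :
    At w (p + ((L.take i).flatMap f).length) (f L[i]) := by
  have e : L.flatMap f = (L.take i).flatMap f ++ (f L[i] ++ (L.drop (i + 1)).flatMap f) := by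
    have e₀ : L = L.take i ++ L[i] :: L.drop (i + 1) := by
      rw [← List.drop_eq_getElem_cons hi, List.take_append_drop]
    exact (congrArg (List.flatMap f) e₀).trans (by rw [List.flatMap_append, List.flatMap_cons])
  rw [e, at_append, at_append] at h
  exact h.2.1

variable {n m : ℕ}

@[simp] theorem length_encodeVote (v : Vote m) : (encodeVote v).length = m := by
  simp [encodeVote]

theorem At.vote {w : List ℕ} {p : ℕ} {v : Vote m} (h : At w p (encodeVote v)) (r : Fin m) :
    w.getD (p + r) 0 = v r := by
  rw [h.getD (by simp)]
  simp [encodeVote]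

theorem length_flatMap_encodeVote (L : List (Vote m)) :
    (L.flatMap encodeVote).length = L.length * m := by
  induction L with
  | nil => simp
  | cons a L ih => simp [ih]; ring

/-- The array `own` names the owners of the options in `P` whose positions are below `pos`. -/
structure Parsed (w : List ℕ) (P : Fin n → Vote m → Prop) (own : ℕ → ℕ) (pos : ℕ) : Prop where
  sound : ∀ p, own p ≠ 0 → ∃ i x, P i x ∧ own p = i ∧ At w p (encodeVote x)
  complete : ∀ i x, P i x → (i : ℕ) ≠ 0 → ∃ p, own p = i ∧ At w p (encodeVote x)
  fresh : ∀ p, pos ≤ p → own p = 0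

/-- Owner 0 also means that no option starts at a position. The votes of voter `0` are therefore
stored without effect, and `complete` does not ask for them. By `fresh`, nothing stored earlier is
overwritten. -/
theorem Parsed.store {w : List ℕ} {P P' : Fin n → Vote m → Prop} {own : ℕ → ℕ} {pos : ℕ}
    (h : Parsed w P own pos) (hm : 0 < m) {i : Fin n} {x : Vote m}
    (hx : At w pos (encodeVote x)) (hP : ∀ j y, P' j y ↔ P j y ∨ (j = i ∧ y = x)) :
    Parsed w P' (Function.update own pos i) (pos + m) where
  sound p hp := by
    by_cases e : p = pos
    · subst e
      exact ⟨i, x, (hP _ _).2 (.inr ⟨rfl, rfl⟩), by simp, hx⟩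
    · rw [Function.update_of_ne e] at hp ⊢
      obtain ⟨j, y, h1, h2⟩ := h.sound p hp
      exact ⟨j, y, (hP _ _).2 (.inl h1), h2⟩
  complete j y hy hj := by
    rcases (hP _ _).1 hy with hy | ⟨rfl, rfl⟩
    · obtain ⟨p, h1, h2⟩ := h.complete j y hy hj
      refine ⟨p, ?_, h2⟩
      rw [Function.update_of_ne, h1]
      rintro rfl
      rw [h.fresh p le_rfl] at h1
      omega
    · exact ⟨pos, by simp, hx⟩
  fresh p hp := by
    rw [Function.update_of_ne (by omega), h.fresh p (by omega)]

theorem Parsed.mono {w : List ℕ} {P P' : Fin n → Vote m → Prop} {own : ℕ → ℕ} {pos pos' : ℕ}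
    (h : Parsed w P own pos) (hP : ∀ j y, P' j y ↔ P j y) (hpos : pos ≤ pos') :
    Parsed w P' own pos' where
  sound p hp := by
    obtain ⟨j, y, h1, h2⟩ := h.sound p hp
    exact ⟨j, y, (hP _ _).2 h1, h2⟩
  complete j y hy hj := h.complete j y ((hP _ _).1 hy) hj
  fresh p hp := h.fresh p (hpos.trans hp)

theorem finRange_take_succ {j : ℕ} (hj : j < n) :
    (List.finRange n).take (j + 1) = (List.finRange n).take j ++ [⟨j, hj⟩] := by
  rw [List.take_add_one, List.getElem?_eq_getElem (by simpa using hj)]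
  simp

theorem finRange_take_of_le {j : ℕ} (hj : n ≤ j) :
    (List.finRange n).take j = List.finRange n := List.take_of_length_le (by simpa using hj)

theorem At.finRange {w : List ℕ} {p : ℕ} {f : Fin n → List ℕ}
    (h : At w p ((List.finRange n).flatMap f)) {j : ℕ} (hj : j < n) :
    At w (p + (((List.finRange n).take j).flatMap f).length) (f ⟨j, hj⟩) := by
  have := h.flatMap (i := j) (by simpa using hj)
  rwa [show (List.finRange n)[j]'(by simpa using hj) = ⟨j, hj⟩ by simp] at this

theorem sem_storeCmd {B : ℕ} (s : State) : storeCmd.sem B s =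
    ⟨Function.update s.vars 11 (s.vars 11 + s.vars 2),
      Function.update s.arrs 1 (Function.update (s.arrs 1) (s.vars 11) (s.vars 13))⟩ := by
  simp [storeCmd, Cmd.sem, Tm.eval, State.set, State.put]

/-- The memory while the input word is parsed. -/
structure Parsing (w : List ℕ) (P : Fin n → Vote m → Prop) (pos : ℕ) (s : State) : Prop where
  word : s.arrs 0 = fun j => w.getD j 0
  n_eq : s.vars 1 = n
  m_eq : s.vars 2 = m
  pos_eq : s.vars 11 = pos
  parsed : Parsed w P (s.arrs 1) pos
  zero : s.vars 9 = 0 ∧ s.vars 10 = 0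

theorem Parsing.set {w : List ℕ} {P : Fin n → Vote m → Prop} {pos : ℕ} {s : State}
    (h : Parsing w P pos s) {x j : ℕ} (hx : 12 ≤ x) : Parsing w P pos (s.set x j) where
  word := h.word
  n_eq := by simp [Function.update_of_ne (show 1 ≠ x by omega), h.n_eq]
  m_eq := by simp [Function.update_of_ne (show 2 ≠ x by omega), h.m_eq]
  pos_eq := by simp [Function.update_of_ne (show 11 ≠ x by omega), h.pos_eq]
  parsed := h.parsed
  zero := by
    simp [Function.update_of_ne (show 9 ≠ x by omega),
      Function.update_of_ne (show 10 ≠ x by omega), h.zero]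

theorem Parsing.mono {w : List ℕ} {P P' : Fin n → Vote m → Prop} {pos : ℕ} {s : State}
    (h : Parsing w P pos s) (hP : ∀ j y, P' j y ↔ P j y) : Parsing w P' pos s :=
  ⟨h.word, h.n_eq, h.m_eq, h.pos_eq, h.parsed.mono hP le_rfl, h.zero⟩

theorem Parsing.store {w : List ℕ} {P P' : Fin n → Vote m → Prop} {pos B : ℕ} {s : State}
    (h : Parsing w P pos s) {i : Fin n} {x : Vote m} (hi : s.vars 13 = i)
    (hx : At w pos (encodeVote x)) (hm : 0 < m)
    (hP : ∀ j y, P' j y ↔ P j y ∨ (j = i ∧ y = x)) :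
    Parsing w P' (pos + m) (storeCmd.sem B s) := by
  rw [sem_storeCmd]
  refine ⟨by simp [h.word], by simp [h.n_eq], by simp [h.m_eq], by simp [h.pos_eq, h.m_eq], ?_,
    by simp [h.zero]⟩
  simp only [Function.update_self, h.pos_eq, hi]
  exact h.parsed.store hm hx hP

variable [NeZero n] [NeZero m] (G : GSGame 2 n m) (u v : Vote m)

/-- The parts of the input word. -/
theorem at_encode {w : List ℕ} (hw : w = G.encode u v) :
    w.getD 0 0 = n ∧ w.getD 1 0 = m ∧ At w 2 (encodeVote G.tie) ∧
      At w (2 + m) (encodeVote u) ∧ At w (2 + m + m) (encodeVote v) ∧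
      At w (2 + m + m + m) ((List.finRange n).flatMap fun i => encodeVote (G.V i)) ∧
      At w (2 + m + m + m + n * m)
        ((List.finRange n).flatMap fun i => (G.A i).length :: (G.A i).flatMap encodeVote) := by
  have h := at_self w
  conv at h => arg 3; rw [hw]
  unfold GSGame.encode at h
  rw [at_append, at_append, at_append, at_append, at_append] at h
  obtain ⟨⟨⟨⟨⟨h1, h2⟩, h3⟩, h4⟩, h5⟩, h6⟩ := h
  have hl : ((List.finRange n).flatMap fun i => encodeVote (G.V i)).length = n * m := by
    have := length_flatMap_encodeVote ((List.finRange n).map G.V)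
    rw [List.flatMap_map] at this
    rw [this]; simp
  simp only [List.length_append, hl, length_encodeVote, List.length_cons, List.length_nil]
    at h2 h3 h4 h5 h6
  refine ⟨h1.getD (r := 0) (by simp), h1.getD (r := 1) (by simp), ?_, ?_, ?_, ?_, ?_⟩
  · exact h2
  · convert h3 using 1; omega
  · convert h4 using 1; omega
  · convert h5 using 1; omega
  · convert h6 using 1; omega

/-- The options of the voters. -/
def IsOption (i : Fin n) (x : Vote m) : Prop := x ∈ G.V i :: G.A i

/-- The memory holds the input word and the owners of all options. -/
structure Base (w : List ℕ) (s : State) : Prop where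
  word : s.arrs 0 = fun j => w.getD j 0
  n_eq : s.vars 1 = n
  m_eq : s.vars 2 = m
  sound : ∀ p, s.arrs 1 p ≠ 0 → ∃ i x, IsOption G i x ∧ s.arrs 1 p = i ∧ At w p (encodeVote x)
  complete : ∀ i x, IsOption G i x → (i : ℕ) ≠ 0 →
    ∃ p, s.arrs 1 p = i ∧ At w p (encodeVote x)

variable {G u v}

/-- All loops run up to the length of the word, so it has to exceed both n and m for them to reach
every voter and every candidate. -/
theorem length_bounds (hm : 2 < m) {w : List ℕ} (hw : w = G.encode u v) :
    n < w.length ∧ m < w.length := by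
  obtain ⟨-, -, -, -, -, h, -⟩ := at_encode G u v hw
  have hl : ((List.finRange n).flatMap fun i => encodeVote (G.V i)).length = n * m := by
    have := length_flatMap_encodeVote ((List.finRange n).map G.V)
    rw [List.flatMap_map] at this
    rw [this]; simp
  have hn := Nat.pos_of_neZero n
  have h1 := h.le_length (by rw [hl]; positivity)
  rw [hl] at h1
  have : n ≤ n * m := Nat.le_mul_of_pos_right n (by omega)
  omega

/-- The reading position is always the start of a block plus the length of the encoding of what has
been read from it. The invariants of the two passes add the sincere votes first and the listed
strategies afterwards. -/
theorem parseCmd_spec (hm : 2 < m) {w : List ℕ} (hw : w = G.encode u v) :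
    Base G w (parseCmd.sem w.length (initial w)) ∧
      (parseCmd.sem w.length (initial w)).vars 9 = 0 ∧
      (parseCmd.sem w.length (initial w)).vars 10 = 0 := by
  obtain ⟨w0, w1, -, -, -, hV, hA⟩ := at_encode G u v hw
  obtain ⟨hnN, hmN⟩ := length_bounds hm hw
  set B := w.length
  let g : Fin n → List ℕ := fun i => encodeVote (G.V i)
  let g' : Fin n → List ℕ := fun i => (G.A i).length :: (G.A i).flatMap encodeVote
  have hg : ∀ L : List (Fin n), (L.flatMap g).length = L.length * m := fun L => by
    have := length_flatMap_encodeVote (L.map G.V)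
    rw [List.flatMap_map] at this
    rw [this, List.length_map]
  unfold parseCmd
  simp only [Cmd.sem]
  set s₀ := (((initial w).set 1 ((inp (.num 0)).eval B (initial w))).set 2
    ((inp (.num 1)).eval B ((initial w).set 1 ((inp (.num 0)).eval B (initial w))))) with hs₀
  have h₀ : Parsing (n := n) (m := m) w (fun _ _ => False) (2 + m + m + m)
      (s₀.set 11 (sincereAt.eval B s₀)) := by
    have e1 : s₀.vars 1 = n := by
      simp [s₀, inp, Tm.eval, initial, ← w0]
    have e2 : s₀.vars 2 = m := by
      simp [s₀, inp, Tm.eval, initial, ← w1]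
    refine ⟨by simp [s₀, initial], by simpa using e1, by simpa using e2, ?_, ?_, ?_⟩
    · simp [sincereAt, vAt, uAt, Tm.eval, e2]
    · exact ⟨by simp [s₀, initial], by simp, by simp [s₀, initial]⟩
    · simp [s₀, initial]
  generalize s₀.set 11 (sincereAt.eval B s₀) = s₁ at h₀
  have h₁ : ∀ B', Parsing w (fun i x => i ∈ (List.finRange n).take B' ∧ x = G.V i)
      (2 + m + m + m + (((List.finRange n).take B').flatMap g).length)
      (iterate (fun j s => if (Tm.lt (.var 13) (.var 1)).eval B (s.set 13 j) ≠ 0 then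
        storeCmd.sem B (s.set 13 j) else s.set 13 j) B' s₁) := by
    intro B'
    refine iterate_induction (fun j s => Parsing w
      (fun i x => i ∈ (List.finRange n).take j ∧ x = G.V i)
      (2 + m + m + m + (((List.finRange n).take j).flatMap g).length) s) ?_ ?_
    · simpa using h₀
    · intro j _ s hs
      have hs' := hs.set (x := 13) (j := j) (by omega)
      have hn : (s.set 13 j).vars 1 = n := hs'.n_eq
      simp only [Tm.eval_lt, Tm.eval, hn]
      rw [show (s.set 13 j).vars 13 = j by simp]
      split_ifs with hj
      · have hpos := hV.finRange hj
        have := hs'.store (B := B) (i := ⟨j, hj⟩) (x := G.V ⟨j, hj⟩)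
          (P' := fun i x => i ∈ (List.finRange n).take (j + 1) ∧ x = G.V i) (by simp)
          hpos (by omega) (by
            intro i y
            rw [finRange_take_succ hj, List.mem_append, List.mem_singleton]
            constructor
            · rintro ⟨h | h, h'⟩
              · exact .inl ⟨h, h'⟩
              · exact .inr ⟨h, h ▸ h'⟩
            · rintro (⟨h, h'⟩ | ⟨h, h'⟩)
              · exact ⟨.inl h, h'⟩
              · exact ⟨.inr h, h ▸ h'⟩)
        have e : (((List.finRange n).take (j + 1)).flatMap g).length =
            (((List.finRange n).take j).flatMap g).length + m := by
          rw [finRange_take_succ hj]; simp [g]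
        rw [e, ← add_assoc]
        exact this
      · rw [finRange_take_of_le (not_lt.1 hj)] at hs'
        rw [finRange_take_of_le (by omega)]
        exact hs'
  have h₁ := h₁ B
  rw [finRange_take_of_le hnN.le, hg, List.length_finRange] at h₁
  generalize iterate _ B s₁ = s₂ at h₁
  have h₂ := iterate_induction (s := s₂) (B := B)
    (f := fun j s => if (Tm.lt (.var 13) (.var 1)).eval B (s.set 13 j) ≠ 0 then
        iterate (fun j s => if (Tm.lt (.var 14) (.var 12)).eval B (s.set 14 j) ≠ 0 then
          storeCmd.sem B (s.set 14 j) else s.set 14 j) B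
          (((s.set 13 j).set 12 ((inp (.var 11)).eval B (s.set 13 j))).set 11
            ((Tm.add (.var 11) (.num 1)).eval B
              ((s.set 13 j).set 12 ((inp (.var 11)).eval B (s.set 13 j)))))
        else s.set 13 j) (fun j s => Parsing w
      (fun i x => x = G.V i ∨ (i ∈ (List.finRange n).take j ∧ x ∈ G.A i))
      (2 + m + m + m + n * m + (((List.finRange n).take j).flatMap g').length) s) (by
        have := h₁.mono (P' := fun i x => x = G.V i ∨
          (i ∈ (List.finRange n).take 0 ∧ x ∈ G.A i)) (by simp)
        simpa using this) (by
    intro j _ s hs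
    have hs' := hs.set (x := 13) (j := j) (by omega)
    have hn : (s.set 13 j).vars 1 = n := hs'.n_eq
    simp only [Tm.eval_lt, Tm.eval, hn]
    rw [show (s.set 13 j).vars 13 = j by simp]
    have hj13 : (s.set 13 j).vars 13 = j := by simp
    generalize s.set 13 j = s' at hs' hj13
    split_ifs with hj
    · have hblock : At w (2 + m + m + m + n * m +
          (((List.finRange n).take j).flatMap g').length) (g' ⟨j, hj⟩) :=
        hA.finRange hj
      set q := 2 + m + m + m + n * m + (((List.finRange n).take j).flatMap g').length
      have hcons : g' ⟨j, hj⟩ = [(G.A ⟨j, hj⟩).length] ++ (G.A ⟨j, hj⟩).flatMap encodeVote := rfl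
      rw [hcons, at_append] at hblock
      obtain ⟨hb1, hb2⟩ := hblock
      have hlen : w.getD q 0 = (G.A ⟨j, hj⟩).length := hb1.getD (r := 0) (by simp)
      simp only [List.length_singleton] at hb2
      -- The inner loop makes B rounds, so a list must not be longer than that; each listed vote
      -- takes up m > 0 entries of the word.
      have hlenB : (G.A ⟨j, hj⟩).length ≤ B := by
        rcases Nat.eq_zero_or_pos (G.A ⟨j, hj⟩).length with h0 | h0
        · omega
        · have hl := length_flatMap_encodeVote (G.A ⟨j, hj⟩)
          have h3 := hb2.le_length (by rw [hl]; exact Nat.mul_pos h0 (by omega))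
          rw [hl] at h3
          have : (G.A ⟨j, hj⟩).length ≤ (G.A ⟨j, hj⟩).length * m :=
            Nat.le_mul_of_pos_right _ (by omega)
          omega
      have e12 : (inp (.var 11)).eval B s' = (G.A ⟨j, hj⟩).length := by
        simp [inp, Tm.eval, hs'.word, hs'.pos_eq, ← hlen]
      rw [e12]
      have e11 : (s'.set 12 (G.A ⟨j, hj⟩).length).vars 11 = q := by
        simpa using hs'.pos_eq
      rw [e11]
      have hin := iterate_induction (B := B)
        (s := (s'.set 12 (G.A ⟨j, hj⟩).length).set 11 (q + 1))
        (f := fun j s => if s.vars 12 = s.vars 12 ∧ (s.set 14 j).vars 14 < (s.set 14 j).vars 12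
          then storeCmd.sem B (s.set 14 j) else s.set 14 j)
        (fun l s => Parsing w (fun i x => (x = G.V i ∨
            (i ∈ (List.finRange n).take j ∧ x ∈ G.A i)) ∨
            (i = ⟨j, hj⟩ ∧ x ∈ (G.A ⟨j, hj⟩).take l))
          (q + 1 + (((G.A ⟨j, hj⟩).take l).flatMap encodeVote).length) s ∧
          s.vars 12 = (G.A ⟨j, hj⟩).length ∧ s.vars 13 = j) (by
          refine ⟨?_, by simp, by simpa using hj13⟩
          refine ⟨hs'.word, by simpa using hs'.n_eq, by simpa using hs'.m_eq, by simp, ?_,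
            by simpa using hs'.zero⟩
          simpa using hs'.parsed.mono (fun _ _ => Iff.rfl) (by omega)) (by
          rintro l - s ⟨hs, hs12, hs13⟩
          have hs' := hs.set (x := 14) (j := l) (by omega)
          simp only [true_and]
          rw [show (s.set 14 l).vars 14 = l by simp,
            show (s.set 14 l).vars 12 = (G.A ⟨j, hj⟩).length by simpa using hs12]
          have e13 : (s.set 14 l).vars 13 = j := by simpa using hs13
          have e12 : (s.set 14 l).vars 12 = (G.A ⟨j, hj⟩).length := by simpa using hs12
          split_ifs with hl
          · have htake : (G.A ⟨j, hj⟩).take (l + 1) =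
                (G.A ⟨j, hj⟩).take l ++ [(G.A ⟨j, hj⟩)[l]] := by
              rw [List.take_add_one, List.getElem?_eq_getElem hl]; simp
            have := hs'.store (B := B) (i := ⟨j, hj⟩) (x := (G.A ⟨j, hj⟩)[l])
              (P' := fun i x => (x = G.V i ∨ (i ∈ (List.finRange n).take j ∧ x ∈ G.A i)) ∨
                (i = ⟨j, hj⟩ ∧ x ∈ (G.A ⟨j, hj⟩).take (l + 1))) e13
              (At.flatMap hb2 hl) (by omega) (by
                intro i y
                rw [htake, List.mem_append, List.mem_singleton]
                tauto)
            refine ⟨?_, ?_, ?_⟩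
            · rw [htake, List.flatMap_append, List.length_append, ← add_assoc]
              simpa using this
            · rw [sem_storeCmd]; simpa using e12
            · rw [sem_storeCmd]; simpa using e13
          · have hle := not_lt.1 hl
            rw [List.take_of_length_le hle] at hs'
            rw [List.take_of_length_le (show (G.A ⟨j, hj⟩).length ≤ l + 1 by omega)]
            exact ⟨hs', e12, e13⟩)
      have hin := hin.1
      simp only [true_and] at hin
      rw [List.take_of_length_le hlenB] at hin
      have hin := hin.mono (P' := fun i x => x = G.V i ∨
        (i ∈ (List.finRange n).take (j + 1) ∧ x ∈ G.A i)) (by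
          intro i y
          rw [finRange_take_succ hj, List.mem_append, List.mem_singleton]
          constructor
          · rintro (h | ⟨h | h, h'⟩)
            · exact .inl (.inl h)
            · exact .inl (.inr ⟨h, h'⟩)
            · exact .inr ⟨h, h ▸ h'⟩
          · rintro ((h | ⟨h, h'⟩) | ⟨h, h'⟩)
            · exact .inl h
            · exact .inr ⟨.inl h, h'⟩
            · exact .inr ⟨.inr h, h ▸ h'⟩)
      have e : 2 + m + m + m + n * m + (((List.finRange n).take (j + 1)).flatMap g').length =
          q + 1 + ((G.A ⟨j, hj⟩).flatMap encodeVote).length := by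
        rw [finRange_take_succ hj]; simp [g', q]; ring
      rw [e]
      exact hin
    · rw [finRange_take_of_le (not_lt.1 hj)] at hs'
      rw [finRange_take_of_le (by omega)]
      exact hs')
  rw [finRange_take_of_le hnN.le] at h₂
  have h₃ := h₂.mono (P' := IsOption G) (by
    intro i x
    simp [IsOption])
  exact ⟨⟨h₃.word, h₃.n_eq, h₃.m_eq, h₃.parsed.sound, h₃.parsed.complete⟩, h₃.zero⟩

end Voting.Algorithm

/-! ### Outcomes as allocations of a network -/

namespace Voting.Algorithm

open RAM

/-- The network in which the options are given by their positions in the input word. -/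
def net (n m : ℕ) (word own cap : ℕ → ℕ) (c d : ℕ) : Network where
  m := m
  agents := (Finset.range n).erase 0
  own := own
  T p := {word p, word (p + 1)}
  Z := (Finset.range m).filter fun x => x ≠ c ∧ x ≠ d
  cap := cap

theorem card_agents (n m : ℕ) (hn : 0 < n) (word own cap : ℕ → ℕ) (c d : ℕ) :
    (net n m word own cap c d).agents.card = n - 1 := by
  simp only [net]
  rw [Finset.card_erase_of_mem (by simpa using hn), Finset.card_range]

section

variable {n m : ℕ} {w : List ℕ}

theorem mem_top_iff (hm : 2 < m) {p : ℕ} {x : Vote m} (h : At w p (encodeVote x)) (e : Fin m) :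
    e ∈ Vote.top 2 x ↔ w.getD p 0 = e ∨ w.getD (p + 1) 0 = e := by
  have h0 := h.vote ⟨0, by omega⟩
  have h1 := h.vote ⟨1, by omega⟩
  simp only [add_zero] at h0 h1
  rw [h0, h1, Vote.mem_top, ← Fin.ext_iff, ← Fin.ext_iff, ← Equiv.eq_symm_apply,
    ← Equiv.eq_symm_apply, Fin.ext_iff, Fin.ext_iff]
  change _ ↔ 0 = (x.symm e : ℕ) ∨ 1 = (x.symm e : ℕ)
  omega

theorem pair_eq (hm : 2 < m) {p : ℕ} {x : Vote m} (h : At w p (encodeVote x)) :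
    ({w.getD p 0, w.getD (p + 1) 0} : Finset ℕ) = (Vote.top 2 x).map Fin.valEmbedding := by
  have h0 := h.vote ⟨0, by omega⟩
  have h1 := h.vote ⟨1, by omega⟩
  simp only [add_zero] at h0 h1
  ext z
  simp only [Finset.mem_insert, Finset.mem_singleton, Finset.mem_map, Fin.valEmbedding_apply]
  constructor
  · rintro (rfl | rfl)
    · exact ⟨x ⟨0, by omega⟩, (mem_top_iff hm h _).2 (.inl h0), h0.symm⟩
    · exact ⟨x ⟨1, by omega⟩, (mem_top_iff hm h _).2 (.inr h1), h1.symm⟩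
  · rintro ⟨e, he, rfl⟩
    rcases (mem_top_iff hm h e).1 he with h | h
    exacts [.inl h.symm, .inr h.symm]

variable [NeZero n]

theorem sum_agents (hm : 2 < m) {own cap : ℕ → ℕ} {c d : ℕ} {cur : ℕ → ℕ} {W : Profile n m}
    (h : ∀ i : Fin n, i ≠ 0 → At w (cur i) (encodeVote (W i))) (e : Fin m) :
    ∑ i ∈ (net n m (fun j => w.getD j 0) own cap c d).agents,
      (if (e : ℕ) ∈ (net n m (fun j => w.getD j 0) own cap c d).T (cur i) then 1 else 0) =
      othersScore 2 W 0 e := by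
  have hn := Nat.pos_of_neZero n
  unfold othersScore
  rw [Finset.card_filter]
  have e1 : ∀ i : Fin n, (if i ≠ 0 ∧ e ∈ Vote.top 2 (W i) then 1 else 0) =
      (fun i : ℕ => if i ≠ 0 then (if (e : ℕ) ∈ (net n m (fun j => w.getD j 0) own cap c d).T
        (cur i) then 1 else 0) else 0) i := by
    intro i
    by_cases hi : i = 0
    · subst hi; simp
    · have hi' : (i : ℕ) ≠ 0 := fun h => hi (Fin.ext (by simpa using h))
      have hmap : (e : ℕ) ∈ (Vote.top 2 (W i)).map Fin.valEmbedding ↔ e ∈ Vote.top 2 (W i) :=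
        Finset.mem_map' Fin.valEmbedding
      simp only [ne_eq, hi, not_false_eq_true, true_and, hi', if_true, net, pair_eq hm (h i hi),
        hmap]
  rw [Finset.sum_congr rfl fun i _ => e1 i, Fin.sum_univ_eq_sum_range (fun i : ℕ =>
    if i ≠ 0 then (if (e : ℕ) ∈ (net n m (fun j => w.getD j 0) own cap c d).T
        (cur i) then 1 else 0) else 0) n]
  have hag : (net n m (fun j => w.getD j 0) own cap c d).agents =
      (Finset.range n).filter fun i => i ≠ 0 := (Finset.filter_ne' _ _).symm
  rw [hag, Finset.sum_filter]

variable [NeZero m] {G : GSGame 2 n m} {own : ℕ → ℕ}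

/-- The array `own` names the owners of the options. -/
structure Owners (G : GSGame 2 n m) (w : List ℕ) (own : ℕ → ℕ) : Prop where
  sound : ∀ p, own p ≠ 0 → ∃ i x, IsOption G i x ∧ own p = i ∧ At w p (encodeVote x)
  complete : ∀ i x, IsOption G i x → (i : ℕ) ≠ 0 → ∃ p, own p = i ∧ At w p (encodeVote x)

/-- The game-theoretic hypothesis is used only here: it makes the options of each agent pairwise
intersecting. -/
theorem Owners.proper (h : Owners G w own) (hG : G.OthersMinimal) (cap : ℕ → ℕ) (c d : ℕ) :
    (net n m (fun j => w.getD j 0) own cap c d).Proper := by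
  have hm := G.k_lt_m
  have key : ∀ p, own p ∈ (Finset.range n).erase 0 → own p ≠ 0 := fun p hp =>
    Finset.ne_of_mem_erase hp
  refine ⟨?_, ?_, ?_, Finset.filter_subset _ _⟩
  · intro p hp
    obtain ⟨i, x, -, -, hx⟩ := h.sound p (key p hp)
    simp only [net]
    rw [pair_eq hm hx, Finset.card_map, Vote.card_top hm.le]
  · intro p hp
    obtain ⟨i, x, -, -, hx⟩ := h.sound p (key p hp)
    simp only [net]
    rw [pair_eq hm hx]
    intro z hz
    obtain ⟨e, -, rfl⟩ := Finset.mem_map.1 hz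
    exact Finset.mem_range.2 e.isLt
  · intro p q hp hpq
    have hp0 := key p hp
    simp only [net] at hpq
    obtain ⟨i, x, hx, hi, hpx⟩ := h.sound p hp0
    obtain ⟨j, y, hy, hj, hqy⟩ := h.sound q (hpq ▸ hp0)
    have hij : i = j := Fin.ext (by rw [← hi, ← hj, hpq])
    subst hij
    have hi0 : i ≠ 0 := by
      rintro rfl
      exact hp0 (by simpa using hi)
    simp only [net]
    rw [pair_eq hm hpx, pair_eq hm hqy, ← Finset.map_inter]
    exact (hG.inter_nonempty hi0 hx hy).map

/-- The indicator of a proposition. -/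
def ind (P : Prop) [Decidable P] : ℕ := if P then 1 else 0

theorem othersWinner_iff (tie : Vote m) (W : Profile n m) (u : Vote m) (c : Fin m) :
    winner 2 tie (Function.update W 0 u) = c ↔ ∀ e, e ≠ c →
      othersScore 2 W 0 e + (ind (e ∈ Vote.top 2 u) + ind (tie.symm e < tie.symm c)) ≤
        othersScore 2 W 0 c + ind (c ∈ Vote.top 2 u) := by
  rw [winner_eq_iff]
  simp only [score_update, ind, add_assoc]

/-- A candidate e other than c and d may receive at most tU - pU e and tV - pV e points from the
others. The inequalities before the allocation ensure that these truncated subtractions are genuine,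
that c and d respect each other, and that the capacities have room for all 2(n - 1) approvals. The
filler takes up whatever capacity remains. -/
theorem Owners.outcome_iff (h : Owners G w own) (hG : G.OthersMinimal) (u v : Vote m)
    {c d : Fin m} (hcd : c ≠ d) {τ τ' : ℕ} {cap : ℕ → ℕ} {tU tV : ℕ}
    {pU pV : Fin m → ℕ}
    (hpU : ∀ e, pU e = ind (e ∈ Vote.top 2 u) + ind (G.tie.symm e < G.tie.symm c))
    (hpV : ∀ e, pV e = ind (e ∈ Vote.top 2 v) + ind (G.tie.symm e < G.tie.symm d))
    (htU : tU = τ + ind (c ∈ Vote.top 2 u)) (htV : tV = τ' + ind (d ∈ Vote.top 2 v))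
    (hcap : ∀ e : Fin m, cap e = if e = c then τ else if e = d then τ' else
      min (tU - pU e) (tV - pV e)) {S : ℕ} (hS : S = ∑ x ∈ Finset.range m, cap x) :
    G.Outcome u v c d τ τ' ↔
      (2 * (n - 1) ≤ S ∧ τ' + pU d ≤ tU ∧ τ + pV c ≤ tV ∧
        ∀ e, e ≠ c → e ≠ d → pU e ≤ tU ∧ pV e ≤ tV) ∧
      ∃ cur f, (net n m (fun j => w.getD j 0) own cap c d).Alloc (S - 2 * (n - 1)) cur f ∧
        ∀ x < m, (net n m (fun j => w.getD j 0) own cap c d).load cur f x ≤ cap x := by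
  have hm := G.k_lt_m
  have hn := Nat.pos_of_neZero n
  have hN := h.proper hG cap c d
  have hcard := card_agents n m hn (fun j => w.getD j 0) own cap c d
  set N := net n m (fun j => w.getD j 0) own cap c d with hNdef
  have hcapc : cap c = τ := by rw [hcap]; simp
  have hcapd : cap d = τ' := by rw [hcap]; simp [hcd.symm]
  have hZ : ∀ x, x ∈ N.Z ↔ x < m ∧ x ≠ c ∧ x ≠ d := fun x => by simp [hNdef, net]
  have hag : ∀ i, i ∈ N.agents ↔ i ≠ 0 ∧ i < n := fun i => by simp [hNdef, net]
  constructor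
  · rintro ⟨W, hW, h1, h2, h3, h4⟩
    rw [othersWinner_iff] at h1 h2
    simp only [← hpU, ← hpV, h3, h4, ← htU, ← htV] at h1 h2
    have hch : ∀ i : ℕ, ∃ p, ∀ hi : i < n, i ≠ 0 →
        own p = i ∧ At w p (encodeVote (W ⟨i, hi⟩)) := by
      intro i
      by_cases hi : i < n ∧ i ≠ 0
      · have hi0 : (⟨i, hi.1⟩ : Fin n) ≠ 0 := fun e => hi.2 (by simpa using congrArg Fin.val e)
        obtain ⟨p, h5, h6⟩ := h.complete ⟨i, hi.1⟩ _ (hW _ hi0) hi.2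
        exact ⟨p, fun _ _ => ⟨h5, h6⟩⟩
      · exact ⟨0, fun h1 h2 => absurd ⟨h1, h2⟩ hi⟩
    choose cur hcur using hch
    have hsum := fun e => sum_agents (own := own) (cap := cap) (c := c) (d := d) hm
      (cur := cur) (W := W) (fun i hi => (hcur i i.isLt fun e =>
        hi (Fin.ext (by simpa using e))).2) e
    rw [← hNdef] at hsum
    let σ : ℕ → ℕ := fun x => ∑ i ∈ N.agents, if x ∈ N.T (cur i) then 1 else 0
    have hσ : ∀ e : Fin m, σ e = othersScore 2 W 0 e := hsum
    -- The filler is the slack of each free candidate, so that every capacity is met with equality.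
    let f : ℕ → ℕ := fun x => if x ∈ N.Z then cap x - σ x else 0
    have hle : ∀ e, e ≠ c → e ≠ d → σ e + pU e ≤ tU ∧ σ e + pV e ≤ tV := by
      intro e hec hed
      rw [hσ]
      exact ⟨h1 e hec, h2 e hed⟩
    have hload : ∀ x < m, N.load cur f x = cap x := by
      intro x hx
      show f x + σ x = cap x
      by_cases hxZ : x ∈ N.Z
      · have hx' := (hZ x).1 hxZ
        have hec : (⟨x, hx⟩ : Fin m) ≠ c := fun e => hx'.2.1 (by rw [← e])
        have hed : (⟨x, hx⟩ : Fin m) ≠ d := fun e => hx'.2.2 (by rw [← e])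
        have h5 := hle ⟨x, hx⟩ hec hed
        have h6 := hcap ⟨x, hx⟩
        simp only [hec, hed, if_false] at h6 h5
        simp only [f, hxZ, if_true]
        have : σ x ≤ min (tU - pU ⟨x, hx⟩) (tV - pV ⟨x, hx⟩) := le_min (by omega) (by omega)
        omega
      · simp only [f, hxZ, if_false, zero_add]
        have : x = c ∨ x = d := by
          by_contra! hne
          exact hxZ ((hZ x).2 ⟨hx, hne⟩)
        rcases this with rfl | rfl
        · rw [hσ, h3, hcapc]
        · rw [hσ, h4, hcapd]
    have halloc : N.Alloc (∑ x ∈ N.Z, f x) cur f := by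
      refine ⟨fun i hi => ?_, fun x hx => by simp [f, hx], rfl⟩
      have := (hag i).1 hi
      exact (hcur i this.2 this.1).1
    have htot := Network.sum_load hN halloc
    have hs : ∑ x ∈ Finset.range N.m, N.load cur f x = ∑ x ∈ Finset.range m, cap x :=
      Finset.sum_congr rfl fun x hx => hload x (Finset.mem_range.1 hx)
    rw [hcard, hs, ← hS] at htot
    refine ⟨⟨by omega, h1 d hcd.symm |>.trans' (by rw [h4]), h2 c hcd |>.trans' (by rw [h3]),
      fun e hec hed => ?_⟩, cur, f, ?_, fun x hx => (hload x hx).le⟩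
    · have := hle e hec hed
      omega
    · rwa [show S - 2 * (n - 1) = ∑ x ∈ N.Z, f x by omega]
  · rintro ⟨⟨h1, h2, h3, h4⟩, cur, f, halloc, hle⟩
    have htot := Network.sum_load hN halloc
    rw [hcard] at htot
    change ∑ x ∈ Finset.range m, _ = _ at htot
    -- There are as many tokens as the total capacity, so loads within the capacities equal them. As
    -- c and d carry no filler, their scores are exactly τ and τ'.
    have hload : ∀ x < m, N.load cur f x = cap x := by
      have hsum : ∑ x ∈ Finset.range m, N.load cur f x = ∑ x ∈ Finset.range m, cap x := by
        rw [htot, ← hS]; omega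
      have := (Finset.sum_eq_sum_iff_of_le fun x hx => hle x (Finset.mem_range.1 hx)).1 hsum
      exact fun x hx => this x (Finset.mem_range.2 hx)
    have hch : ∀ i : Fin n, ∃ x, IsOption G i x ∧ (i ≠ 0 → At w (cur i) (encodeVote x)) := by
      intro i
      by_cases hi : i = 0
      · exact ⟨G.V i, List.mem_cons_self, fun h => absurd hi h⟩
      · have hi' : (i : ℕ) ≠ 0 := fun h => hi (Fin.ext (by simpa using h))
        have ho : own (cur i) = i := halloc.own_cur i ((hag i).2 ⟨hi', i.isLt⟩)
        obtain ⟨j, x, hx, hj, hat⟩ := h.sound (cur i) (by rwa [ho])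
        have : i = j := Fin.ext (by rw [← ho, hj])
        subst this
        exact ⟨x, hx, fun _ => hat⟩
    choose W hW hWat using hch
    have hsum := fun e => sum_agents (own := own) (cap := cap) (c := c) (d := d) hm
      (cur := cur) (W := W) hWat e
    rw [← hNdef] at hsum
    have hscore : ∀ e : Fin m, f e + othersScore 2 W 0 e = cap e := fun e => by
      rw [← hload e e.isLt, ← hsum]; rfl
    have hc : othersScore 2 W 0 c = τ := by
      have := hscore c
      rwa [halloc.f_eq_zero c (by simp [hZ]), zero_add, hcapc] at this
    have hd : othersScore 2 W 0 d = τ' := by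
      have := hscore d
      rwa [halloc.f_eq_zero d (by simp [hZ]), zero_add, hcapd] at this
    have hother : ∀ e, e ≠ c → e ≠ d →
        othersScore 2 W 0 e + pU e ≤ tU ∧ othersScore 2 W 0 e + pV e ≤ tV := by
      intro e hec hed
      have h5 := hscore e
      have h6 := hcap e
      simp only [hec, hed, if_false] at h6
      have h7 := h4 e hec hed
      have h8 := min_le_left (tU - pU e) (tV - pV e)
      have h9 := min_le_right (tU - pU e) (tV - pV e)
      omega
    refine ⟨W, fun i _ => hW i, ?_, ?_, hc, hd⟩
    · rw [othersWinner_iff]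
      simp only [← hpU, hc, ← htU]
      intro e hec
      by_cases hed : e = d
      · subst hed; rwa [hd]
      · exact (hother e hec hed).1
    · rw [othersWinner_iff]
      simp only [← hpV, hd, ← htV]
      intro e hed
      by_cases hec : e = c
      · subst hec; rwa [hc]
      · exact (hother e hec hed).2

end

end Voting.Algorithm

/-! ### Evaluation of the terms of the algorithm -/

namespace Voting.Algorithm

open RAM

section

variable {B : ℕ} {s : State}

theorem eval_isTop {p e : Tm} : (isTop p e).eval B s =
    if s.arrs 0 (p.eval B s) = e.eval B s ∨ s.arrs 0 (p.eval B s + 1) = e.eval B s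
      then 1 else 0 := by
  have h : (isTop p e).eval B s = if (Tm.eq (inp p) e).eval B s ≠ 0 then 1 else
      (Tm.eq (inp (.add p (.num 1))) e).eval B s := rfl
  rw [h]
  have h2 : (Tm.eq (inp p) e).eval B s ≠ 0 ↔ s.arrs 0 (p.eval B s) = e.eval B s :=
    Tm.eval_eq_ne
  by_cases h1 : s.arrs 0 (p.eval B s) = e.eval B s
  · rw [if_pos (h2.2 h1), if_pos (.inl h1)]
  · rw [if_neg (mt h2.1 h1), Tm.eval_eq]
    exact if_congr (by simp [inp, Tm.eval, h1]) rfl rfl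

theorem eval_isTop_ne {p e : Tm} : (isTop p e).eval B s ≠ 0 ↔
    s.arrs 0 (p.eval B s) = e.eval B s ∨ s.arrs 0 (p.eval B s + 1) = e.eval B s := by
  rw [eval_isTop]
  simp only [ne_eq, ite_eq_right_iff, one_ne_zero, imp_false, not_not]

theorem eval_minOf {a b : Tm} : (minOf a b).eval B s = min (a.eval B s) (b.eval B s) := by
  have h : (minOf a b).eval B s = if (Tm.lt a b).eval B s ≠ 0 then a.eval B s else b.eval B s := rfl
  rw [h]
  simp only [Tm.eval_lt]
  split_ifs <;> omega

end

section

variable {n m : ℕ}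

/-- The network that the memory describes. -/
def netOf (m n : ℕ) (c d : Fin m) (s : State) : Network :=
  net n m (s.arrs 0) (s.arrs 1) (s.arrs 5) c d

/-- The configuration that the memory describes. -/
def cfgOf (m : ℕ) (s : State) : Network.Cfg where
  cur := s.arrs 2
  -- Because of the cut-off nothing need be known about array cells from m on.
  f x := if x < m then s.arrs 3 x else 0
  h x := if x < m then s.arrs 4 x else 0

theorem netOf_set {c d : Fin m} {s : State} (x j : ℕ) : netOf m n c d (s.set x j) = netOf m n c d s := rfl

theorem cfgOf_set {s : State} (x j : ℕ) : cfgOf m (s.set x j) = cfgOf m s := rfl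

end

variable {n m : ℕ} [NeZero n] [NeZero m]

/-- The places of the votes in the input word. -/
structure Layout (G : GSGame 2 n m) (u v : Vote m) (w : List ℕ) : Prop where
  tie : At w 2 (encodeVote G.tie)
  fst : At w (2 + m) (encodeVote u)
  snd : At w (2 + m + m) (encodeVote v)
  sincere : At w (2 + m + m + m) (encodeVote (G.V 0))
  n_lt : n < w.length
  m_lt : m < w.length

/-- The memory while one choice of `c`, `d` and their targets `τ`, `τ'` is treated. -/
structure Ctx (G : GSGame 2 n m) (w : List ℕ) (c d : Fin m) (τ τ' : ℕ) (s : State) : Prop where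
  word : s.arrs 0 = fun j => w.getD j 0
  n_eq : s.vars 1 = n
  m_eq : s.vars 2 = m
  owners : Owners G w (s.arrs 1)
  c_eq : s.vars 3 = c
  d_eq : s.vars 4 = d
  τ_eq : s.vars 5 = τ
  τ'_eq : s.vars 6 = τ'

variable {G : GSGame 2 n m} {u v : Vote m} {w : List ℕ} {c d : Fin m} {τ τ' : ℕ} {s : State}

theorem Ctx.congr {s' : State} (h : Ctx G w c d τ τ' s) (hv : ∀ x, 1 ≤ x → x ≤ 6 →
    s'.vars x = s.vars x) (h0 : s'.arrs 0 = s.arrs 0) (h1 : s'.arrs 1 = s.arrs 1) :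
    Ctx G w c d τ τ' s' where
  word := by rw [h0, h.word]
  n_eq := by rw [hv 1 (by omega) (by omega), h.n_eq]
  m_eq := by rw [hv 2 (by omega) (by omega), h.m_eq]
  owners := by rw [h1]; exact h.owners
  c_eq := by rw [hv 3 (by omega) (by omega), h.c_eq]
  d_eq := by rw [hv 4 (by omega) (by omega), h.d_eq]
  τ_eq := by rw [hv 5 (by omega) (by omega), h.τ_eq]
  τ'_eq := by rw [hv 6 (by omega) (by omega), h.τ'_eq]

theorem Ctx.set (h : Ctx G w c d τ τ' s) {x j : ℕ} (hx : 7 ≤ x) :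
    Ctx G w c d τ τ' (s.set x j) :=
  h.congr (fun y _ hy => by simp [Function.update_of_ne (show y ≠ x by omega)]) rfl rfl

theorem Ctx.sem (h : Ctx G w c d τ τ' s) (B : ℕ) (C : Cmd) (hv : ∀ x ∈ C.modVars, 7 ≤ x)
    (ha : ∀ a ∈ C.modArrs, 2 ≤ a) : Ctx G w c d τ τ' (C.sem B s) :=
  h.congr (fun x _ hx => C.sem_vars B (fun hm => by have := hv x hm; omega) s)
    (C.sem_arrs B (fun hm => by have := ha 0 hm; omega) s)
    (C.sem_arrs B (fun hm => by have := ha 1 hm; omega) s)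

/-- A search returns the last hit, but a candidate occurs only once in a vote, so the hit is unique.
The hypotheses for all r say that the two terms do not depend on the search variable. -/
theorem Ctx.eval_rankOf (h : Ctx G w c d τ τ' s) {p e : Tm} {q : ℕ} {x : Vote m} {e' : Fin m}
    (hq : At w q (encodeVote x)) (hp : ∀ r, p.eval w.length (s.set 31 r) = q)
    (he : ∀ r, e.eval w.length (s.set 31 r) = e') :
    (rankOf p e).eval w.length s = x.symm e' := by
  simp only [rankOf, Tm.eval]
  have key : ∀ r, ((Tm.lt (.var 31) (.var 2)).and (.eq (inp (.add p (.var 31))) e)).eval w.length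
      (s.set 31 r) ≠ 0 ↔ r < m ∧ w.getD (q + r) 0 = e' := by
    intro r
    have h1 : (s.set 31 r).vars 2 = m := (h.set (by omega)).m_eq
    rw [Tm.eval_and, Tm.eval_lt, Tm.eval_eq_ne]
    simp only [inp, Tm.eval, hp, he, h1, State.set_arrs, h.word]
    simp
  have hlt : (x.symm e' : ℕ) < w.length := by
    have := hq.le_length (by simp [Nat.pos_of_neZero m])
    have := (x.symm e').isLt
    rw [length_encodeVote] at *
    omega
  obtain ⟨-, h2⟩ := lastIndex_of_exists (f := fun j => ((Tm.lt (.var 31) (.var 2)).and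
    (.eq (inp (.add p (.var 31))) e)).eval w.length (s.set 31 j)) hlt
    ((key _).2 ⟨(x.symm e').isLt, by rw [hq.vote]; simp⟩)
  obtain ⟨h3, h4⟩ := (key _).1 h2
  have h5 := hq.vote ⟨_, h3⟩
  rw [h4] at h5
  have h6 : x.symm e' = ⟨_, h3⟩ := by
    rw [Equiv.symm_apply_eq]; exact Fin.ext h5
  rw [h6]

theorem Ctx.eval_above (h : Ctx G w c d τ τ' s) {p a b : Tm} {q : ℕ} {x : Vote m} {a' b' : Fin m}
    (hq : At w q (encodeVote x)) (hp : ∀ r, p.eval w.length (s.set 31 r) = q)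
    (ha : ∀ r, a.eval w.length (s.set 31 r) = a') (hb : ∀ r, b.eval w.length (s.set 31 r) = b') :
    (above p a b).eval w.length s = ind (x.symm a' < x.symm b') := by
  have e : (above p a b).eval w.length s =
    if (Tm.lt (rankOf p a) (rankOf p b)).eval w.length s ≠ 0 then 1 else 0 := rfl
  rw [e]
  simp only [Tm.eval_lt, h.eval_rankOf hq hp ha, h.eval_rankOf hq hp hb]
  rfl

theorem Ctx.eval_isTop_vote (h : Ctx G w c d τ τ' s) {p e : Tm} {q : ℕ} {x : Vote m} {e' : Fin m}
    (hq : At w q (encodeVote x)) (hp : p.eval w.length s = q) (he : e.eval w.length s = e') :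
    (isTop p e).eval w.length s = ind (e' ∈ Vote.top 2 x) := by
  rw [eval_isTop, hp, he, h.word]
  simp only [ind, mem_top_iff G.k_lt_m hq]

theorem Ctx.eval_uAt (h : Ctx G w c d τ τ' s) : uAt.eval w.length s = 2 + m := by
  simp [uAt, Tm.eval, h.m_eq]

theorem Ctx.eval_vAt (h : Ctx G w c d τ τ' s) : vAt.eval w.length s = 2 + m + m := by
  simp [vAt, uAt, Tm.eval, h.m_eq]

theorem Ctx.eval_sincereAt (h : Ctx G w c d τ τ' s) :
    sincereAt.eval w.length s = 2 + m + m + m := by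
  simp [sincereAt, vAt, uAt, Tm.eval, h.m_eq]

/-- The values of `penaltyU`. -/
def penU (G : GSGame 2 n m) (u : Vote m) (c e : Fin m) : ℕ :=
  ind (e ∈ Vote.top 2 u) + ind (G.tie.symm e < G.tie.symm c)

theorem Ctx.eval_penaltyU (h : Ctx G w c d τ τ' s) (hw : Layout G u v w) {x : ℕ} {e' : Fin m}
    (hx : x ≠ 31) (he : s.vars x = e') :
    (penaltyU (.var x)).eval w.length s = penU G u c e' := by
  have e : (penaltyU (.var x)).eval w.length s = (isTop uAt (.var x)).eval w.length s +
    (above (.num 2) (.var x) (.var 3)).eval w.length s := rfl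
  rw [e, h.eval_isTop_vote hw.fst h.eval_uAt (e' := e') (by simpa [Tm.eval] using he),
    h.eval_above hw.tie (a' := e') (b' := c) (fun _ => rfl)
      (fun r => by simp [Tm.eval, Function.update_of_ne hx, he])
      (fun r => by simp [Tm.eval, h.c_eq])]
  rfl

theorem Ctx.eval_penaltyV (h : Ctx G w c d τ τ' s) (hw : Layout G u v w) {x : ℕ} {e' : Fin m}
    (hx : x ≠ 31) (he : s.vars x = e') :
    (penaltyV (.var x)).eval w.length s = penU G v d e' := by
  have e : (penaltyV (.var x)).eval w.length s = (isTop vAt (.var x)).eval w.length s +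
    (above (.num 2) (.var x) (.var 4)).eval w.length s := rfl
  rw [e, h.eval_isTop_vote hw.snd h.eval_vAt (e' := e') (by simpa [Tm.eval] using he),
    h.eval_above hw.tie (a' := e') (b' := d) (fun _ => rfl)
      (fun r => by simp [Tm.eval, Function.update_of_ne hx, he])
      (fun r => by simp [Tm.eval, h.d_eq])]
  rfl

/-- The values of `totalU` and `totalV`. -/
def totU (u : Vote m) (c : Fin m) (τ : ℕ) : ℕ := τ + ind (c ∈ Vote.top 2 u)

theorem Ctx.eval_totalU (h : Ctx G w c d τ τ' s) (hw : Layout G u v w) :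
    totalU.eval w.length s = totU u c τ := by
  have e : totalU.eval w.length s = s.vars 5 + (isTop uAt (.var 3)).eval w.length s := rfl
  rw [e, h.eval_isTop_vote hw.fst h.eval_uAt (e := .var 3) (e' := c) h.c_eq, h.τ_eq]
  rfl

theorem Ctx.eval_totalV (h : Ctx G w c d τ τ' s) (hw : Layout G u v w) :
    totalV.eval w.length s = totU v d τ' := by
  have e : totalV.eval w.length s = s.vars 6 + (isTop vAt (.var 4)).eval w.length s := rfl
  rw [e, h.eval_isTop_vote hw.snd h.eval_vAt (e := .var 4) (e' := d) h.d_eq, h.τ'_eq]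
  rfl

/-- The values of `capacity`. -/
def capOf (G : GSGame 2 n m) (u v : Vote m) (c d : Fin m) (τ τ' : ℕ) (e : Fin m) : ℕ :=
  if e = c then τ else if e = d then τ' else
    min (totU u c τ - penU G u c e) (totU v d τ' - penU G v d e)

theorem Ctx.eval_capacity (h : Ctx G w c d τ τ' s) (hw : Layout G u v w) {e' : Fin m}
    (he : s.vars 7 = e') : capacity.eval w.length s = capOf G u v c d τ τ' e' := by
  have e : capacity.eval w.length s = if (Tm.eq (.var 7) (.var 3)).eval w.length s ≠ 0 then
    s.vars 5 else if (Tm.eq (.var 7) (.var 4)).eval w.length s ≠ 0 then s.vars 6 else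
    (minOf (.sub totalU (penaltyU (.var 7))) (.sub totalV (penaltyV (.var 7)))).eval w.length s :=
    rfl
  rw [e, eval_minOf]
  have e1 : (Tm.sub totalU (penaltyU (.var 7))).eval w.length s =
    totalU.eval w.length s - (penaltyU (.var 7)).eval w.length s := rfl
  have e2 : (Tm.sub totalV (penaltyV (.var 7))).eval w.length s =
    totalV.eval w.length s - (penaltyV (.var 7)).eval w.length s := rfl
  rw [e1, e2, h.eval_totalU hw, h.eval_totalV hw, h.eval_penaltyU hw (by omega) he,
    h.eval_penaltyV hw (by omega) he]
  simp only [Tm.eval_eq_ne, Tm.eval, he, h.c_eq, h.d_eq, h.τ_eq, h.τ'_eq, Fin.val_inj]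
  rfl

theorem Ctx.eval_loadOf (h : Ctx G w c d τ τ' s) (hw : Layout G u v w) {x : ℕ} (hx : x ≠ 30)
    (hxm : s.vars x < m) : (loadOf (.var x)).eval w.length s =
      (netOf m n c d s).load (cfgOf m s).cur (cfgOf m s).f (s.vars x) := by
  have e : (loadOf (.var x)).eval w.length s = s.arrs 3 (s.vars x) +
      ∑ j ∈ Finset.range w.length,
        if ((Tm.lt (.num 0) (.var 30)).and (.lt (.var 30) (.var 1))).eval w.length (s.set 30 j) ≠ 0
          then (isTop (.get 2 (.var 30)) (.var x)).eval w.length (s.set 30 j) else 0 := rfl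
  rw [e]
  simp only [Network.load, cfgOf, hxm, if_true]
  congr 1
  have hag : (netOf m n c d s).agents = (Finset.range w.length).filter fun j => 0 < j ∧ j < n := by
    have := hw.n_lt
    ext j
    simp only [netOf, net, Finset.mem_erase, Finset.mem_range, Finset.mem_filter]
    omega
  rw [hag, Finset.sum_filter]
  refine Finset.sum_congr rfl fun j _ => ?_
  refine if_congr ?_ ?_ rfl
  · rw [Tm.eval_and, Tm.eval_lt, Tm.eval_lt]
    simp [Tm.eval, h.n_eq]
  · rw [eval_isTop]
    refine if_congr ?_ rfl rfl
    simp [Tm.eval, Function.update_of_ne hx, netOf, net, eq_comm]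

end Voting.Algorithm

/-! ### Correctness of a step -/

namespace Voting.Algorithm

open RAM

variable {n m : ℕ} [NeZero n] [NeZero m]
variable {G : GSGame 2 n m} {u v : Vote m} {w : List ℕ} {c d : Fin m} {τ τ' : ℕ} {s : State}

theorem Ctx.eval_isActive (h : Ctx G w c d τ τ' s) (hw : Layout G u v w) {x : ℕ} (hx : x ≠ 30) :
    (isActive (.var x)).eval w.length s ≠ 0 ↔
      (netOf m n c d s).Active (cfgOf m s) (s.vars x) := by
  rw [isActive, Tm.eval_and, Tm.eval_and, Tm.eval_lt, Tm.eval_lt, Tm.eval_lt]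
  unfold Network.Active
  by_cases hxm : s.vars x < m
  · rw [h.eval_loadOf hw hx hxm]
    simp [Tm.eval, h.m_eq, netOf, net, cfgOf, hxm]
  · simp [Tm.eval, h.m_eq, netOf, net, hxm]

theorem Ctx.proper (h : Ctx G w c d τ τ' s) (hG : G.OthersMinimal) :
    (netOf m n c d s).Proper := by
  have := h.owners.proper hG (s.arrs 5) c d
  rwa [← h.word] at this

theorem Ctx.mem_agents (h : Ctx G w c d τ τ' s) {p : ℕ} :
    s.arrs 1 p ∈ (netOf m n c d s).agents ↔ s.arrs 1 p ≠ 0 := by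
  constructor
  · exact fun hp => Finset.ne_of_mem_erase hp
  · intro hp
    obtain ⟨i, x, -, hi, -⟩ := h.owners.sound p hp
    refine Finset.mem_erase.2 ⟨hp, Finset.mem_range.2 ?_⟩
    rw [hi]; exact i.isLt

/-- Every option starts inside the word, so a search over all indices below B misses none. -/
theorem Ctx.option_lt (h : Ctx G w c d τ τ' s) {p : ℕ} (hp : s.arrs 1 p ≠ 0) : p < w.length := by
  obtain ⟨i, x, -, -, hx⟩ := h.owners.sound p hp
  have hm := Nat.pos_of_neZero m
  have := hx.le_length (by simpa using hm)
  rw [length_encodeVote] at this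
  omega

/-- The pair meets S but differs from it, so exactly one of a and b is new. This makes the target of
a push computable from the two options. -/
theorem new_iff {S : Finset ℕ} {a b x : ℕ} (hS : S.card = 2) (hT : ({a, b} : Finset ℕ).card = 2)
    (hST : (S ∩ {a, b}).Nonempty) (hx : x ∈ S) (hx' : x ∉ ({a, b} : Finset ℕ)) (y : ℕ) :
    (y ∈ ({a, b} : Finset ℕ) ∧ y ∉ S) ↔ y = if a ∈ S then b else a := by
  have hsub : ¬ ({a, b} : Finset ℕ) ⊆ S := fun hc => hx' (by
    rw [Finset.eq_of_subset_of_card_le hc (by rw [hS, hT])]; exact hx)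
  obtain ⟨z, hz⟩ := hST
  simp only [Finset.insert_subset_iff, Finset.singleton_subset_iff, not_and] at hsub
  simp only [Finset.mem_inter, Finset.mem_insert, Finset.mem_singleton] at hz ⊢
  split_ifs with h
  · constructor
    · rintro ⟨rfl | rfl, h2⟩
      exacts [absurd h h2, rfl]
    · rintro rfl
      exact ⟨.inr rfl, hsub h⟩
  · have hb : b ∈ S := by
      rcases hz with ⟨hz, rfl | rfl⟩
      exacts [absurd hz h, hz]
    constructor
    · rintro ⟨rfl | rfl, h2⟩
      exacts [rfl, absurd hb h2]
    · rintro rfl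
      exact ⟨.inl rfl, h⟩

/-- The option in variable `32` determines the target of the push, so testing the height of this one
candidate suffices. The allocation is needed to know that the option held by the owner is one of his
own. -/
theorem Ctx.eval_canPush (h : Ctx G w c d τ τ' s) (hG : G.OthersMinimal) {D : ℕ}
    (hs : (netOf m n c d s).Alloc D (cfgOf m s).cur (cfgOf m s).f) (hx : s.vars 15 < m) :
    canPush.eval w.length s ≠ 0 ↔ ∃ y, (netOf m n c d s).Arc (cfgOf m s) (s.vars 32) (s.vars 15) y ∧
      (cfgOf m s).h (s.vars 15) = (cfgOf m s).h y + 1 := by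
  have hN := h.proper hG
  have eT : ∀ p, (netOf m n c d s).T p = {s.arrs 0 p, s.arrs 0 (p + 1)} := fun p => rfl
  have mT : ∀ p x, x ∈ (netOf m n c d s).T p ↔ s.arrs 0 p = x ∨ s.arrs 0 (p + 1) = x := by
    intro p x; rw [eT]; simp [eq_comm]
  have hnew : (newOf heldOption (.var 32)).eval w.length s =
      if s.arrs 0 (s.vars 32) ∈ (netOf m n c d s).T (s.arrs 2 (s.arrs 1 (s.vars 32)))
        then s.arrs 0 (s.vars 32 + 1) else s.arrs 0 (s.vars 32) := by
    have e : (newOf heldOption (.var 32)).eval w.length s =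
      if (isTop heldOption (inp (.var 32))).eval w.length s ≠ 0 then
        s.arrs 0 (s.vars 32 + 1) else s.arrs 0 (s.vars 32) := rfl
    rw [e]
    refine if_congr ?_ rfl rfl
    rw [eval_isTop_ne, mT]
    rfl
  rw [canPush, Tm.eval_and, Tm.eval_and, Tm.eval_and, Tm.eval_not, eval_isTop_ne, eval_isTop_ne,
    Tm.eval_eq_ne]
  have e1 : (Tm.get 1 (.var 32)).eval w.length s = s.arrs 1 (s.vars 32) := rfl
  have e2 : heldOption.eval w.length s = s.arrs 2 (s.arrs 1 (s.vars 32)) := rfl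
  have e3 : (Tm.var 15).eval w.length s = s.vars 15 := rfl
  have e4 : (Tm.var 32).eval w.length s = s.vars 32 := rfl
  have e5 : (Tm.get 4 (.var 15)).eval w.length s = s.arrs 4 (s.vars 15) := rfl
  have e6 : ∀ t : Tm, (Tm.add (.get 4 t) (.num 1)).eval w.length s =
    s.arrs 4 (t.eval w.length s) + 1 := fun _ => rfl
  rw [e1, e2, e3, e4, e5, e6, hnew, ← mT, ← mT, ← h.mem_agents (c := c) (d := d)]
  unfold Network.Arc
  have e7 : (netOf m n c d s).own = s.arrs 1 := rfl
  have e8 : (cfgOf m s).cur = s.arrs 2 := rfl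
  rw [e7, e8]
  have key : s.arrs 1 (s.vars 32) ∈ (netOf m n c d s).agents →
      s.vars 15 ∈ (netOf m n c d s).T (s.arrs 2 (s.arrs 1 (s.vars 32))) →
      s.vars 15 ∉ (netOf m n c d s).T (s.vars 32) → ∀ y,
      (y ∈ (netOf m n c d s).T (s.vars 32) ∧
        y ∉ (netOf m n c d s).T (s.arrs 2 (s.arrs 1 (s.vars 32)))) ↔
      y = if s.arrs 0 (s.vars 32) ∈ (netOf m n c d s).T (s.arrs 2 (s.arrs 1 (s.vars 32)))
        then s.arrs 0 (s.vars 32 + 1) else s.arrs 0 (s.vars 32) := by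
    intro g1 g2 g3
    have ho := hs.own_cur _ g1
    have ho' : (netOf m n c d s).own (s.arrs 2 (s.arrs 1 (s.vars 32))) ∈
        (netOf m n c d s).agents := by
      have : (netOf m n c d s).own (s.arrs 2 (s.arrs 1 (s.vars 32))) = s.arrs 1 (s.vars 32) := ho
      rwa [this]
    exact new_iff (hN.card _ ho') (hN.card _ g1) (hN.inter _ _ ho' ho) g2 g3
  have hh : ∀ y, y < m → (cfgOf m s).h y = s.arrs 4 y := fun y hy => by simp [cfgOf, hy]
  rw [hh _ hx]
  constructor
  · rintro ⟨g1, g2, g3, g4⟩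
    have hy := (key g1 g2 g3 _).2 rfl
    refine ⟨_, ⟨g1, g2, g3, hy⟩, ?_⟩
    rw [g4, hh _ (Finset.mem_range.1 (hN.sub _ g1 hy.1))]
  · rintro ⟨y, ⟨g1, g2, g3, hy⟩, g4⟩
    have hy' := (key g1 g2 g3 y).1 hy
    rw [hh _ (Finset.mem_range.1 (hN.sub _ g1 hy.1))] at g4
    exact ⟨g1, g2, g3, by rw [g4, ← hy']⟩

theorem Ctx.eval_isFree (h : Ctx G w c d τ τ' s) :
    isFree.eval w.length s ≠ 0 ↔ s.vars 33 ∈ (netOf m n c d s).Z := by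
  rw [isFree, Tm.eval_and, Tm.eval_and, Tm.eval_not, Tm.eval_not, Tm.eval_lt, Tm.eval_eq_ne,
    Tm.eval_eq_ne]
  simp [Tm.eval, h.m_eq, h.c_eq, h.d_eq, netOf, net]

theorem Ctx.eval_canFill (h : Ctx G w c d τ τ' s) (hx : s.vars 15 < m) :
    canFill.eval w.length s ≠ 0 ↔ 0 < (cfgOf m s).f (s.vars 15) ∧
      s.vars 33 ∈ (netOf m n c d s).Z ∧
      (cfgOf m s).h (s.vars 15) = (cfgOf m s).h (s.vars 33) + 1 := by
  rw [canFill, Tm.eval_and, Tm.eval_and, h.eval_isFree, Tm.eval_eq_ne]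
  by_cases hZ : s.vars 33 ∈ (netOf m n c d s).Z
  · have : s.vars 33 < m := by
      simp only [netOf, net, Finset.mem_filter, Finset.mem_range] at hZ
      exact hZ.1
    simp [Tm.eval, cfgOf, hx, this, hZ, Nat.pos_iff_ne_zero]
  · simp [hZ]

/-- A step of the program is a step of the push-relabel algorithm. -/
theorem Ctx.step (h : Ctx G w c d τ τ' s) (hw : Layout G u v w) (hG : G.OthersMinimal) {D : ℕ}
    (hs : (netOf m n c d s).Inv D (cfgOf m s)) :
    ((∃ x, (netOf m n c d s).Active (cfgOf m s) x) →
      (netOf m n c d s).Step (cfgOf m s) (cfgOf m (stepCmd.sem w.length s))) ∧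
    ((¬ ∃ x, (netOf m n c d s).Active (cfgOf m s) x) →
      cfgOf m (stepCmd.sem w.length s) = cfgOf m s) := by
  have hm := hw.m_lt
  rw [stepCmd, Cmd.sem_seq, Cmd.sem_set]
  obtain ⟨X, hX⟩ : ∃ X, X = (Tm.find 34 (isActive (.var 34))).eval w.length s := ⟨_, rfl⟩
  rw [← hX]
  have hXdef : X = lastIndex (fun j => (isActive (.var 34)).eval w.length (s.set 34 j))
    w.length w.length := hX
  have hact : ∀ j, (isActive (.var 34)).eval w.length (s.set 34 j) ≠ 0 ↔
      (netOf m n c d s).Active (cfgOf m s) j := by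
    intro j
    rw [(h.set (by omega)).eval_isActive hw (by omega), netOf_set, cfgOf_set]
    simp
  have hX15 : (s.set 15 X).vars 15 = X := by simp
  have hlt : (Tm.lt (.var 15) .bound).eval w.length (s.set 15 X) ≠ 0 ↔ X < w.length := by
    rw [Tm.eval_lt]; simp [Tm.eval]
  by_cases hXlt : X < w.length
  swap
  -- A failed search returns B. Active candidates are below m < B, so there is none.
  · have hno : ¬ ∃ x, (netOf m n c d s).Active (cfgOf m s) x := by
      rintro ⟨x, hx⟩
      have hxm : x < m := hx.1
      have := lastIndex_not_lt (hXdef ▸ hXlt) x (by omega)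
      exact (hact x).2 hx this
    rw [Cmd.sem_ite_neg (mt hlt.1 hXlt)]
    exact ⟨fun h => absurd h hno, fun _ => rfl⟩
  have hXact : (netOf m n c d s).Active (cfgOf m s) X := by
    rw [← hact, hXdef]
    exact lastIndex_lt (hXdef ▸ hXlt)
  have hXm : X < m := hXact.1
  rw [Cmd.sem_ite_pos (hlt.2 hXlt), Cmd.sem_seq, Cmd.sem_set]
  refine ⟨fun _ => ?_, fun hno => absurd ⟨X, hXact⟩ hno⟩
  have h1 := h.set (x := 15) (j := X) (by omega)
  have hN1 : netOf m n c d (s.set 15 X) = netOf m n c d s := rfl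
  have hc1 : cfgOf m (s.set 15 X) = cfgOf m s := rfl
  have ha1 : (s.set 15 X).arrs = s.arrs := rfl
  generalize s.set 15 X = s₁ at *
  obtain ⟨P, hP⟩ : ∃ P, P = (Tm.find 32 canPush).eval w.length s₁ := ⟨_, rfl⟩
  rw [← hP]
  have hPdef : P = lastIndex (fun j => canPush.eval w.length (s₁.set 32 j)) w.length w.length := hP
  have hpush : ∀ j, canPush.eval w.length (s₁.set 32 j) ≠ 0 ↔
      ∃ y, (netOf m n c d s).Arc (cfgOf m s) j X y ∧ (cfgOf m s).h X = (cfgOf m s).h y + 1 := by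
    intro j
    have e15 : (s₁.set 32 j).vars 15 = X := by simpa using hX15
    have e32 : (s₁.set 32 j).vars 32 = j := by simp
    have := (h1.set (x := 32) (j := j) (by omega)).eval_canPush hG (D := D)
      (by rw [netOf_set, cfgOf_set, hN1, hc1]; exact hs.alloc) (by rw [e15]; exact hXm)
    rw [this, netOf_set, cfgOf_set, hN1, hc1, e15, e32]
  have hlt : (Tm.lt (.var 16) .bound).eval w.length (s₁.set 16 P) ≠ 0 ↔ P < w.length := by
    rw [Tm.eval_lt]; simp [Tm.eval]
  have hP16 : (s₁.set 16 P).vars 16 = P := by simp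
  by_cases hPlt : P < w.length
  · obtain ⟨y, harc, hh⟩ := (hpush P).1 (by
      have := lastIndex_lt (hPdef ▸ hPlt)
      rwa [← hPdef] at this)
    rw [Cmd.sem_ite_pos (hlt.2 hPlt), Cmd.sem_put]
    have := Network.Step.pushAgent (s := cfgOf m s) P X y hXact harc hh
    convert this using 1
    simp only [cfgOf, State.put_arrs, Tm.eval, State.set_arrs, hP16, ha1]
    rfl
  rw [Cmd.sem_ite_neg (mt hlt.1 hPlt), Cmd.sem_seq, Cmd.sem_set]
  -- An arc uses an option, options lie below B, and the search found no suitable one; hence x may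
  -- be relabelled as far as agents are concerned.
  have hnoPush : ∀ p y, (netOf m n c d s).Arc (cfgOf m s) p X y →
      (cfgOf m s).h X ≠ (cfgOf m s).h y + 1 := by
    intro p y harc hh
    have hp : p < w.length := h.option_lt (h.mem_agents.1 harc.1)
    exact (hpush p).2 ⟨y, harc, hh⟩ (lastIndex_not_lt (hPdef ▸ hPlt) p hp)
  have h2 := h1.set (x := 16) (j := P) (by omega)
  have hN2 : netOf m n c d (s₁.set 16 P) = netOf m n c d s := hN1
  have hc2 : cfgOf m (s₁.set 16 P) = cfgOf m s := hc1
  have ha2 : (s₁.set 16 P).arrs = s.arrs := ha1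
  have hX2 : (s₁.set 16 P).vars 15 = X := by simpa using hX15
  generalize s₁.set 16 P = s₂ at *
  obtain ⟨Y, hY⟩ : ∃ Y, Y = (Tm.find 33 canFill).eval w.length s₂ := ⟨_, rfl⟩
  rw [← hY]
  have hYdef : Y = lastIndex (fun j => canFill.eval w.length (s₂.set 33 j)) w.length w.length := hY
  have hfill : ∀ j, canFill.eval w.length (s₂.set 33 j) ≠ 0 ↔
      0 < (cfgOf m s).f X ∧ j ∈ (netOf m n c d s).Z ∧
        (cfgOf m s).h X = (cfgOf m s).h j + 1 := by
    intro j
    have e15 : (s₂.set 33 j).vars 15 = X := by simpa using hX2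
    have e33 : (s₂.set 33 j).vars 33 = j := by simp
    rw [(h2.set (x := 33) (j := j) (by omega)).eval_canFill (by rw [e15]; exact hXm),
      netOf_set, cfgOf_set, hN2, hc2, e15, e33]
  have hlt : (Tm.lt (.var 17) .bound).eval w.length (s₂.set 17 Y) ≠ 0 ↔ Y < w.length := by
    rw [Tm.eval_lt]; simp [Tm.eval]
  have hY17 : (s₂.set 17 Y).vars 17 = Y := by simp
  have hX17 : (s₂.set 17 Y).vars 15 = X := by simpa using hX2
  have ha3 : (s₂.set 17 Y).arrs = s.arrs := ha2
  generalize s₂.set 17 Y = s₃ at *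
  have cf : ∀ x < m, (cfgOf m s).f x = s.arrs 3 x := fun x hx => by simp [cfgOf, hx]
  have ch : ∀ x < m, (cfgOf m s).h x = s.arrs 4 x := fun x hx => by simp [cfgOf, hx]
  by_cases hYlt : Y < w.length
  · obtain ⟨g1, g2, g3⟩ := (hfill Y).1 (by
      have := lastIndex_lt (hYdef ▸ hYlt)
      rwa [← hYdef] at this)
    have hYm : Y < m := by
      simp only [netOf, net, Finset.mem_filter, Finset.mem_range] at g2
      exact g2.1
    rw [Cmd.sem_ite_pos (hlt.2 hYlt), Cmd.sem_seq, Cmd.sem_put, Cmd.sem_put]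
    have := Network.Step.pushFiller (s := cfgOf m s) X Y hXact g1 g2 g3
    convert this using 1
    simp only [cfgOf, State.put_arrs, State.put_vars, Tm.eval, hX17, hY17, ha3]
    simp only [Network.Cfg.mk.injEq]
    refine ⟨by simp, ?_, by simp⟩
    funext x
    have hXY : X ≠ Y := fun e => by rw [e] at g3; omega
    by_cases hxm : x < m
    · simp only [hxm, if_true, Network.move]
      by_cases hxY : x = Y
      · subst hxY; simp [hXY.symm, hYm]
      · by_cases hxX : x = X
        · subst hxX; simp [hxY, hXm]
        · simp [hxY, hxX, hxm]
    · have h4 : x ≠ X := by rintro rfl; exact hxm hXm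
      have h5 : x ≠ Y := by rintro rfl; exact hxm hYm
      simp [Network.move, h4, h5, hxm]
  · rw [Cmd.sem_ite_neg (mt hlt.1 hYlt), Cmd.sem_put]
    have hnoFill : 0 < (cfgOf m s).f X → ∀ y ∈ (netOf m n c d s).Z,
        (cfgOf m s).h X ≠ (cfgOf m s).h y + 1 := by
      intro g1 y g2 g3
      have hy : y < w.length := by
        simp only [netOf, net, Finset.mem_filter, Finset.mem_range] at g2
        omega
      exact (hfill y).2 ⟨g1, g2, g3⟩ (lastIndex_not_lt (hYdef ▸ hYlt) y hy)
    have := Network.Step.relabel (s := cfgOf m s) X hXact hnoPush hnoFill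
    convert this using 1
    simp only [cfgOf, State.put_arrs, Tm.eval, hX17, ha3]
    simp only [Network.Cfg.mk.injEq]
    refine ⟨by simp, by simp, ?_⟩
    funext x
    by_cases hxX : x = X
    · subst hxX; simp [hXm]
    · simp [hxX]

end Voting.Algorithm

/-! ### Correctness of the algorithm -/

namespace Voting.Algorithm

open RAM

variable {n m : ℕ} [NeZero n] [NeZero m]
variable {G : GSGame 2 n m} {u v : Vote m} {w : List ℕ} {c d : Fin m} {τ τ' : ℕ} {s : State}

/-- From every memory that satisfies `K`, the program `C` makes `k` steps of the push-relabel
algorithm, and it preserves `K`. -/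
def Advances (N : Network) (m D B : ℕ) (K : State → Prop) (C : Cmd) (k : ℕ) : Prop :=
  ∀ s, K s → K (C.sem B s) ∧ N.Runs D k (cfgOf m s) (cfgOf m (C.sem B s))

theorem Advances.loop {N : Network} {m D B : ℕ} {K : State → Prop} {C : Cmd} {k : ℕ}
    (h : Advances N m D B K C k) {x : ℕ} (hK : ∀ s j, K s → K (s.set x j)) :
    Advances N m D B K (.loop x C) (B * k) := by
  intro s hs
  refine iterate_induction (fun i s' => K s' ∧ N.Runs D (i * k) (cfgOf m s) (cfgOf m s'))
    ⟨hs, by rw [Nat.zero_mul]; exact .zero _⟩ ?_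
  rintro i - s' ⟨h1, h2⟩
  obtain ⟨h3, h4⟩ := h _ (hK s' i h1)
  refine ⟨h3, ?_⟩
  rw [Nat.succ_mul]
  exact h2.trans h4

/-- The step writes arrays `2` to `4` only, while the network is read off arrays `0`, `1` and `5`
and so stays fixed throughout a run. -/
theorem advances_step (hw : Layout G u v w) (hG : G.OthersMinimal) (N : Network) (D : ℕ) :
    Advances N m D w.length (fun s => Ctx G w c d τ τ' s ∧ netOf m n c d s = N) stepCmd 1 := by
  rintro s ⟨h, rfl⟩
  refine ⟨⟨h.sem _ _ (by decide) (by decide), ?_⟩, ?_⟩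
  · unfold netOf
    rw [Cmd.sem_arrs _ _ (by decide), Cmd.sem_arrs _ _ (by decide), Cmd.sem_arrs _ _ (by decide)]
  · exact .succ (.zero _) (fun hs => (h.step hw hG hs).1) fun hs => (h.step hw hG hs).2

/-- The loops around `stepCmd`. -/
theorem Ctx.steps (h : Ctx G w c d τ τ' s) (hw : Layout G u v w) (hG : G.OthersMinimal) (D : ℕ) :
    Ctx G w c d τ τ' ((Cmd.loop 20 (.loop 21 (.loop 22 (.loop 23 stepCmd)))).sem w.length s) ∧
      netOf m n c d ((Cmd.loop 20 (.loop 21 (.loop 22 (.loop 23 stepCmd)))).sem w.length s) =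
        netOf m n c d s ∧
      (netOf m n c d s).Runs D (w.length * (w.length * (w.length * (w.length * 1)))) (cfgOf m s)
        (cfgOf m ((Cmd.loop 20 (.loop 21 (.loop 22 (.loop 23 stepCmd)))).sem w.length s)) := by
  have hK : ∀ x, 7 ≤ x → ∀ (s' : State) (j : ℕ),
      (Ctx G w c d τ τ' s' ∧ netOf m n c d s' = netOf m n c d s) →
      (Ctx G w c d τ τ' (s'.set x j) ∧ netOf m n c d (s'.set x j) = netOf m n c d s) :=
    fun x hx s' j h' => ⟨h'.1.set hx, h'.2⟩
  have := (((advances_step hw hG (netOf m n c d s) D).loop (x := 23) (hK 23 (by omega))).loop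
    (x := 22) (hK 22 (by omega))).loop (x := 21) (hK 21 (by omega)) |>.loop (x := 20)
    (hK 20 (by omega)) s ⟨h, rfl⟩
  exact ⟨this.1.1, this.1.2, this.2⟩

theorem Ctx.eval_agentTokens (h : Ctx G w c d τ τ' s) :
    agentTokens.eval w.length s = 2 * (n - 1) := by
  simp only [agentTokens, Tm.eval, h.n_eq]; omega

/-- The memory before the push-relabel algorithm starts. -/
theorem Ctx.setup (h : Ctx G w c d τ τ' s) (hw : Layout G u v w) {s' : State}
    (hs' : s' = setupCmd.sem w.length s) :
    Ctx G w c d τ τ' s' ∧ (∀ e : Fin m, s'.arrs 5 e = capOf G u v c d τ τ' e) ∧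
      s'.vars 8 = ∑ x ∈ Finset.range m, s'.arrs 5 x ∧ (cfgOf m s').h = (fun _ => 0) ∧
      (netOf m n c d s').Alloc (s'.vars 8 - 2 * (n - 1)) (cfgOf m s').cur (cfgOf m s').f := by
  have hm := G.k_lt_m
  have hmB := hw.m_lt
  rw [setupCmd, Cmd.sem_seq, Cmd.sem_seq, Cmd.sem_seq, Cmd.sem_seq, Cmd.sem_seq] at hs'
  obtain ⟨s₁, hs₁⟩ : ∃ s₁, s₁ = (Cmd.loop 7 (.put 5 (.var 7) capacity)).sem w.length s := ⟨_, rfl⟩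
  have h1 : Ctx G w c d τ τ' s₁ := hs₁ ▸ h.sem w.length _ (by decide) (by decide)
  have hcap : ∀ e : Fin m, s₁.arrs 5 e = capOf G u v c d τ τ' e := by
    intro e
    rw [hs₁]
    refine Cmd.sem_loop_put (by omega) fun s' hx hv ha => ?_
    exact (h.congr (fun y _ hy => hv y (by omega)) (ha 0 (by omega))
      (ha 1 (by omega))).eval_capacity hw hx
  rw [← hs₁] at hs'
  obtain ⟨S, hS⟩ : ∃ S, S = ∑ x ∈ Finset.range m, s₁.arrs 5 x := ⟨_, rfl⟩
  have hSe : (Tm.sum 30 (.ite (.lt (.var 30) (.var 2)) (.get 5 (.var 30)) (.num 0))).eval w.length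
      s₁ = S := by
    have e : (Finset.range m) = (Finset.range w.length).filter (· < m) := by
      ext j; simp only [Finset.mem_range, Finset.mem_filter]; omega
    rw [hS, e, Finset.sum_filter]
    refine Finset.sum_congr rfl fun j _ => ?_
    refine if_congr ?_ rfl rfl
    rw [Tm.eval_lt]
    simp [Tm.eval, h1.m_eq]
  rw [Cmd.sem_set (x := 8), hSe, Cmd.sem_set] at hs'
  have h2 := h1.set (x := 8) (j := S) (by omega)
  have h8 : (s₁.set 8 S).vars 8 = S := by simp
  have ha2 : (s₁.set 8 S).arrs = s₁.arrs := rfl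
  generalize s₁.set 8 S = s₂ at *
  obtain ⟨z, hz⟩ : ∃ z, z = (Tm.find 33 isFree).eval w.length s₂ := ⟨_, rfl⟩
  have hzZ : z ∈ (netOf m n c d s₂).Z := by
    have key : ∀ j, isFree.eval w.length (s₂.set 33 j) ≠ 0 ↔ j ∈ (netOf m n c d s₂).Z := by
      intro j
      rw [(h2.set (x := 33) (j := j) (by omega)).eval_isFree, netOf_set]
      simp
    -- With at least three candidates, one other than c and d can take the filler.
    obtain ⟨e, he⟩ : ∃ e : Fin m, e ∉ ({c, d} : Finset (Fin m)) := by
      refine Finset.exists_mem_notMem_of_card_lt_card (s := {c, d}) (t := Finset.univ) ?_ |>.imp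
        fun _ h => h.2
      have := Finset.card_le_two (a := c) (b := d)
      rw [Finset.card_univ, Fintype.card_fin]
      omega
    simp only [Finset.mem_insert, Finset.mem_singleton, not_or] at he
    have := lastIndex_of_exists (f := fun j => isFree.eval w.length (s₂.set 33 j)) (B := w.length)
      (j := e) (by omega) ((key _).2 (by
        simp only [netOf, net, Finset.mem_filter, Finset.mem_range, ne_eq, Fin.val_inj]
        exact ⟨e.isLt, he⟩))
    rw [hz]
    exact (key _).1 this.2
  rw [← hz] at hs'
  have h3 := h2.set (x := 17) (j := z) (by omega)
  have h83 : (s₂.set 17 z).vars 8 = S := by simpa using h8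
  have h17 : (s₂.set 17 z).vars 17 = z := by simp
  have ha3 : (s₂.set 17 z).arrs = s₁.arrs := ha2
  have hZ3 : (netOf m n c d (s₂.set 17 z)).Z = (netOf m n c d s₂).Z := rfl
  generalize s₂.set 17 z = s₃ at *
  obtain ⟨s₄, hs₄⟩ : ∃ s₄, s₄ = (Cmd.loop 7 (.put 4 (.var 7) (.num 0))).sem w.length s₃ := ⟨_, rfl⟩
  have h4 : Ctx G w c d τ τ' s₄ := hs₄ ▸ h3.sem w.length _ (by decide) (by decide)
  rw [← hs₄] at hs'
  obtain ⟨s₅, hs₅⟩ : ∃ s₅, s₅ = (Cmd.loop 7 (.put 3 (.var 7)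
    (.ite (.eq (.var 7) (.var 17)) (.sub (.var 8) agentTokens) (.num 0)))).sem w.length s₄ :=
    ⟨_, rfl⟩
  have h5 : Ctx G w c d τ τ' s₅ := hs₅ ▸ h4.sem w.length _ (by decide) (by decide)
  rw [← hs₅] at hs'
  have h6 : Ctx G w c d τ τ' s' := hs' ▸ h5.sem w.length _ (by decide) (by decide)
  have a5 : s'.arrs 5 = s₁.arrs 5 := by
    rw [hs', Cmd.sem_arrs _ _ (by decide), hs₅, Cmd.sem_arrs _ _ (by decide), hs₄,
      Cmd.sem_arrs _ _ (by decide), ha3]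
  have a4 : ∀ x < m, s'.arrs 4 x = 0 := by
    intro x hx
    rw [hs', Cmd.sem_arrs _ _ (by decide), hs₅, Cmd.sem_arrs _ _ (by decide), hs₄]
    exact Cmd.sem_loop_put (by omega) fun _ _ _ _ => rfl
  have v8 : s'.vars 8 = S := by
    rw [hs', Cmd.sem_vars _ _ (by decide), hs₅, Cmd.sem_vars _ _ (by decide), hs₄,
      Cmd.sem_vars _ _ (by decide), h83]
  have v84 : s₄.vars 8 = S := by rw [hs₄, Cmd.sem_vars _ _ (by decide), h83]
  have v17 : s₄.vars 17 = z := by rw [hs₄, Cmd.sem_vars _ _ (by decide), h17]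
  have a3 : ∀ x < m, s'.arrs 3 x = if x = z then S - 2 * (n - 1) else 0 := by
    intro x hx
    rw [hs', Cmd.sem_arrs _ _ (by decide), hs₅]
    refine Cmd.sem_loop_put (by omega) fun s' hx hv ha => ?_
    have h7 := h4.congr (s' := s') (fun y _ hy => hv y (by omega)) (ha 0 (by omega))
      (ha 1 (by omega))
    refine if_congr ?_ ?_ rfl
    · rw [Tm.eval_eq_ne]
      simp only [Tm.eval, hx, hv 17 (by omega), v17]
    · have e : (Tm.sub (.var 8) agentTokens).eval w.length s' =
        s'.vars 8 - agentTokens.eval w.length s' := rfl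
      rw [e, h7.eval_agentTokens, hv 8 (by omega), v84]
  have a2 : ∀ i, i ≠ 0 → i < n → s'.arrs 1 (s'.arrs 2 i) = i := by
    intro i hi0 hi
    -- The sincere vote is an option of every voter, so the search for some option of agent i
    -- succeeds.
    obtain ⟨p, hp, -⟩ := h5.owners.complete ⟨i, hi⟩ _ (List.mem_cons_self ..) hi0
    have hp' : p < w.length := h5.option_lt (by rw [hp]; exact hi0)
    have a1 : s'.arrs 1 = s₅.arrs 1 := by rw [hs', Cmd.sem_arrs _ _ (by decide)]
    have e2 : s'.arrs 2 i = lastIndex (fun q => if s₅.arrs 1 q = i then 1 else 0) w.length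
        w.length := by
      rw [hs']
      refine Cmd.sem_loop_put (hi.trans hw.n_lt) fun s' hx hv ha => ?_
      simp only [Tm.eval]
      congr 1
      funext q
      rw [Tm.eval_eq]
      simp [Tm.eval, hx, ha 1]
    have := (lastIndex_of_exists (f := fun q => if s₅.arrs 1 q = i then 1 else 0) hp'
      (by simp [hp])).2
    rw [← e2] at this
    rw [a1]
    by_contra hne
    exact this (if_neg hne)
  have hZ : ∀ x, x ∈ (netOf m n c d s').Z → x < m := fun x hx =>
    Finset.mem_range.1 (Finset.mem_filter.1 hx).1
  have hzZ' : z ∈ (netOf m n c d s').Z := hzZ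
  have hf : ∀ x, (cfgOf m s').f x = if x = z then S - 2 * (n - 1) else 0 := by
    intro x
    by_cases hx : x < m
    · simp [cfgOf, hx, a3]
    · have : x ≠ z := by rintro rfl; exact hx (hZ _ hzZ')
      simp [cfgOf, hx, this]
  refine ⟨h6, fun e => by rw [a5, hcap], by rw [v8, a5, hS], ?_, ?_, ?_, ?_⟩
  · funext x
    by_cases hx : x < m
    · simp [cfgOf, hx, a4]
    · simp [cfgOf, hx]
  · intro i hi
    obtain ⟨h8, h9⟩ := Finset.mem_erase.1 hi
    exact a2 i h8 (Finset.mem_range.1 h9)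
  · intro x hx
    rw [hf, if_neg]
    rintro rfl
    exact hx hzZ'
  · simp only [hf, v8]
    rw [Finset.sum_ite_eq', if_pos hzZ']

end Voting.Algorithm

/-! ### The test of one quadruple, and the search over all of them -/

namespace Voting.Algorithm

open RAM

variable {n m : ℕ} [NeZero n] [NeZero m]
variable {G : GSGame 2 n m} {u v : Vote m} {w : List ℕ} {c d : Fin m} {τ τ' : ℕ} {s : State}

theorem ind_le (P : Prop) [Decidable P] : ind P ≤ 1 := by unfold ind; split_ifs <;> omega

theorem capOf_le {B : ℕ} (hτ : τ < B) (hτ' : τ' < B) (e : Fin m) :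
    capOf G u v c d τ τ' e ≤ B := by
  have := ind_le (c ∈ Vote.top 2 u)
  unfold capOf totU
  split_ifs <;> omega

theorem Ctx.eval_isConsistent (h : Ctx G w c d τ τ' s) (hw : Layout G u v w) :
    isConsistent.eval w.length s ≠ 0 ↔ 2 * (n - 1) ≤ s.vars 8 ∧
      τ' + penU G u c d ≤ totU u c τ ∧ τ + penU G v d c ≤ totU v d τ' ∧
      ∀ e, e ≠ c → e ≠ d → penU G u c e ≤ totU u c τ ∧ penU G v d e ≤ totU v d τ' := by
  have hm := hw.m_lt
  rw [isConsistent, Tm.eval_and, Tm.eval_and, Tm.eval_and, Tm.eval_not, Tm.eval_not, Tm.eval_not,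
    Tm.eval_not, Tm.eval_lt, Tm.eval_lt, Tm.eval_lt, Tm.eval_sum_ne, h.eval_agentTokens,
    h.eval_totalU hw, h.eval_totalV hw]
  have e1 : (Tm.add (.var 6) (penaltyU (.var 4))).eval w.length s =
    s.vars 6 + (penaltyU (.var 4)).eval w.length s := rfl
  have e2 : (Tm.add (.var 5) (penaltyV (.var 3))).eval w.length s =
    s.vars 5 + (penaltyV (.var 3)).eval w.length s := rfl
  rw [e1, e2, h.eval_penaltyU hw (by omega) h.d_eq, h.eval_penaltyV hw (by omega) h.c_eq, h.τ_eq,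
    h.τ'_eq, not_lt, not_lt, not_lt]
  refine and_congr Iff.rfl (and_congr Iff.rfl (and_congr Iff.rfl ?_))
  have key : ∀ e : Fin m, ((Tm.and isFree (.or (.lt totalU (penaltyU (.var 33)))
      (.lt totalV (penaltyV (.var 33))))).eval w.length (s.set 33 e) ≠ 0 ↔
      (e ≠ c ∧ e ≠ d) ∧ (totU u c τ < penU G u c e ∨ totU v d τ' < penU G v d e)) := by
    intro e
    have h' := h.set (x := 33) (j := e) (by omega)
    have he : (s.set 33 e).vars 33 = e := by simp
    rw [Tm.eval_and, Tm.eval_or, Tm.eval_lt, Tm.eval_lt, h'.eval_isFree, h'.eval_totalU hw,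
      h'.eval_totalV hw, h'.eval_penaltyU hw (by omega) he, h'.eval_penaltyV hw (by omega) he, he]
    simp [netOf, net, Fin.val_inj]
  constructor
  · intro hno e hc hd
    by_contra hlt
    exact hno ⟨e, by omega, (key e).2 ⟨⟨hc, hd⟩, by omega⟩⟩
  · rintro hall ⟨j, -, hj⟩
    have hjm : j < m := by
      rw [Tm.eval_and, (h.set (by omega)).eval_isFree] at hj
      simpa using (Finset.mem_filter.1 hj.1).1
    obtain ⟨⟨hc, hd⟩, hlt⟩ := (key ⟨j, hjm⟩).1 hj
    have := hall _ hc hd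
    omega

theorem Ctx.eval_isFeasible (h : Ctx G w c d τ τ' s) (hw : Layout G u v w) :
    isFeasible.eval w.length s ≠ 0 ↔ ∀ x < m,
      (netOf m n c d s).load (cfgOf m s).cur (cfgOf m s).f x ≤ (netOf m n c d s).cap x := by
  have hm := hw.m_lt
  have key : ∀ x, (Tm.and (.lt (.var 34) (.var 2)) (.lt (.get 5 (.var 34))
      (loadOf (.var 34)))).eval w.length (s.set 34 x) ≠ 0 ↔ x < m ∧
        (netOf m n c d s).cap x < (netOf m n c d s).load (cfgOf m s).cur (cfgOf m s).f x := by
    intro x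
    have h' := h.set (x := 34) (j := x) (by omega)
    have hx : (s.set 34 x).vars 34 = x := by simp
    rw [Tm.eval_and, Tm.eval_lt, Tm.eval_lt]
    have e1 : (Tm.var 34).eval w.length (s.set 34 x) = x := hx
    have e2 : (Tm.var 2).eval w.length (s.set 34 x) = m := h'.m_eq
    have e3 : (Tm.get 5 (.var 34)).eval w.length (s.set 34 x) = (netOf m n c d s).cap x := by
      simp [Tm.eval, netOf, net]
    rw [e1, e2, e3]
    refine and_congr_right fun hxm => ?_
    rw [h'.eval_loadOf hw (by omega) (by rwa [hx]), netOf_set, cfgOf_set, hx]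
  rw [isFeasible, Tm.eval_not, Tm.eval_sum_ne]
  simp only [key, not_exists, not_and, not_lt]
  exact ⟨fun h x hx => h x (hx.trans hm) hx, fun h x _ hx => h x hx⟩

/-- The test whether an outcome is possible is correct. -/
theorem Ctx.search (h : Ctx G w c d τ τ' s) (hw : Layout G u v w) (hG : G.OthersMinimal)
    (hcd : c ≠ d) (hτ : τ < w.length) (hτ' : τ' < w.length) {s' : State}
    (hs' : s' = (Cmd.loop 20 (.loop 21 (.loop 22 (.loop 23 stepCmd)))).sem w.length
      (setupCmd.sem w.length s)) :
    (isConsistent.and isFeasible).eval w.length s' ≠ 0 ↔ G.Outcome u v c d τ τ' := by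
  have hm := hw.m_lt
  obtain ⟨s₁, hs₁⟩ : ∃ s₁, s₁ = setupCmd.sem w.length s := ⟨_, rfl⟩
  rw [← hs₁] at hs'
  obtain ⟨h₁, hcap, hS, hh, halloc⟩ := h.setup hw hs₁
  obtain ⟨h₂, hN, hrun⟩ := h₁.steps hw hG (s₁.vars 8 - 2 * (n - 1))
  rw [← hs'] at h₂ hN hrun
  have h8 : s'.vars 8 = s₁.vars 8 := by rw [hs', Cmd.sem_vars _ _ (by decide)]
  have hout := h₁.owners.outcome_iff hG u v hcd (pU := penU G u c) (pV := penU G v d)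
    (fun _ => rfl) (fun _ => rfl) rfl rfl hcap hS
  rw [← h₁.word] at hout
  rw [Tm.eval_and, h₂.eval_isConsistent hw, h₂.eval_isFeasible hw, hout, h8]
  refine and_congr_right fun hcons => ?_
  have hcard : (netOf m n c d s₁).agents.card = n - 1 := card_agents n m (Nat.pos_of_neZero n) ..
  have hbound : s₁.vars 8 ≤ m * w.length := by
    rw [hS]
    calc _ ≤ ∑ x ∈ Finset.range m, w.length := Finset.sum_le_sum fun x hx => by
          rw [hcap ⟨x, Finset.mem_range.1 hx⟩]; exact capOf_le hτ hτ' _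
      _ = m * w.length := by simp
  -- The capacities sum to S ≤ mB with m < B, so (S + 1)m² ≤ B²m² < B⁴. Consistency makes the
  -- subtraction of 2(n - 1) genuine.
  have hlong : (s₁.vars 8 - 2 * (n - 1) + 2 * (netOf m n c d s₁).agents.card + 1) *
      ((netOf m n c d s₁).m * (netOf m n c d s₁).m) <
        w.length * (w.length * (w.length * (w.length * 1))) := by
    rw [hcard, show s₁.vars 8 - 2 * (n - 1) + 2 * (n - 1) + 1 = s₁.vars 8 + 1 by omega]
    have e : (netOf m n c d s₁).m = m := rfl
    rw [e]
    have h1 : s₁.vars 8 + 1 ≤ w.length * w.length := by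
      have : (m + 1) * w.length ≤ w.length * w.length := Nat.mul_le_mul_right _ hm
      rw [Nat.succ_mul] at this
      omega
    have h2 : m * m < w.length * w.length := Nat.mul_lt_mul'' hm hm
    calc _ ≤ (w.length * w.length) * (m * m) := Nat.mul_le_mul_right _ h1
      _ < (w.length * w.length) * (w.length * w.length) :=
        Nat.mul_lt_mul_of_pos_left h2 (by positivity [show 0 < w.length by omega])
      _ = _ := by ring
  have := hrun.feasible_iff (h₁.proper hG) halloc hh hlong
  rw [hN]
  exact this.symm

theorem Base.set {x j : ℕ} (h : Base G w s) (hx : 3 ≤ x) : Base G w (s.set x j) where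
  word := h.word
  n_eq := by simp [Function.update_of_ne (show 1 ≠ x by omega), h.n_eq]
  m_eq := by simp [Function.update_of_ne (show 2 ≠ x by omega), h.m_eq]
  sound := h.sound
  complete := h.complete

/-- If `Hit φ vals` holds, where `vals` are the values of the variables `3, …, x - 1`, then `C` makes
the variable `φ` nonzero, and otherwise it does not change whether `φ` is zero. -/
def Records (G : GSGame 2 n m) (w : List ℕ) (x : ℕ) (C : Cmd) (Hit : ℕ → (ℕ → ℕ) → Prop) : Prop :=
  ∀ (vals : ℕ → ℕ) (s : State), Base G w s →
    (∀ y, 3 ≤ y → y < x → s.vars y = vals y ∧ vals y < w.length) →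
    Base G w (C.sem w.length s) ∧
      (∀ y, 3 ≤ y → y < x → (C.sem w.length s).vars y = vals y) ∧
      ∀ φ, φ = 9 ∨ φ = 10 → ((C.sem w.length s).vars φ ≠ 0 ↔ s.vars φ ≠ 0 ∨ Hit φ vals)

/-- The flags are never reset, so looping over a variable turns a hit into the existence of a hit.
As x ≤ 6, the loop variable is neither of the flags. -/
theorem Records.loop {x : ℕ} {C : Cmd} {Hit : ℕ → (ℕ → ℕ) → Prop}
    (h : Records G w (x + 1) C Hit) (hx : 3 ≤ x) (hx' : x ≤ 6) :
    Records G w x (.loop x C)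
      (fun φ vals => ∃ j < w.length, Hit φ (Function.update vals x j)) := by
  intro vals s hs hv
  refine iterate_induction (fun i s' => Base G w s' ∧ (∀ y, 3 ≤ y → y < x → s'.vars y = vals y) ∧
    ∀ φ, φ = 9 ∨ φ = 10 → (s'.vars φ ≠ 0 ↔
      s.vars φ ≠ 0 ∨ ∃ j < i, Hit φ (Function.update vals x j)))
    ⟨hs, fun y h1 h2 => (hv y h1 h2).1, fun φ _ => by simp⟩ ?_
  rintro i hi s' ⟨h1, h2, h3⟩
  obtain ⟨h4, h5, h6⟩ := h (Function.update vals x i) (s'.set x i) (h1.set hx) (by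
    intro y hy hy'
    by_cases e : y = x
    · subst e; simpa using hi
    · simpa [e] using ⟨h2 y hy (by omega), (hv y hy (by omega)).2⟩)
  refine ⟨h4, fun y hy hy' => ?_, fun φ hφ => ?_⟩
  · rw [h5 y hy (by omega), Function.update_of_ne (by omega)]
  · rw [h6 φ hφ, State.set_vars, Function.update_of_ne (by omega), h3 φ hφ, or_assoc]
    refine or_congr_right ?_
    constructor
    · rintro (⟨j, hj, hj'⟩ | hj)
      exacts [⟨j, by omega, hj'⟩, ⟨i, by omega, hj⟩]
    · rintro ⟨j, hj, hj'⟩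
      rcases Nat.lt_succ_iff_lt_or_eq.1 hj with hj | rfl
      exacts [.inl ⟨j, hj, hj'⟩, .inr hj']

/-- An outcome that player `0` likes better with the first strategy (`φ = 9`), respectively with
the second one. -/
def IsHit (G : GSGame 2 n m) (u v : Vote m) (φ : ℕ) (vals : ℕ → ℕ) : Prop :=
  ∃ c d : Fin m, vals 3 = c ∧ vals 4 = d ∧ G.Outcome u v c d (vals 5) (vals 6) ∧
    if φ = 9 then Vote.Prefers (G.V 0) c d else Vote.Prefers (G.V 0) d c

theorem records_bodyCmd (hw : Layout G u v w) (hG : G.OthersMinimal) :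
    Records G w 7 bodyCmd (IsHit G u v) := by
  intro vals s hs hv
  refine ⟨⟨?_, ?_, ?_, ?_, ?_⟩, ?_, ?_⟩
  · rw [Cmd.sem_arrs _ _ (by decide), hs.word]
  · rw [Cmd.sem_vars _ _ (by decide), hs.n_eq]
  · rw [Cmd.sem_vars _ _ (by decide), hs.m_eq]
  · rw [Cmd.sem_arrs _ _ (by decide)]; exact hs.sound
  · rw [Cmd.sem_arrs _ _ (by decide)]; exact hs.complete
  · intro y hy hy'
    rw [← (hv y hy hy').1]
    refine Cmd.sem_vars _ _ ?_ _
    interval_cases y <;> decide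
  intro φ hφ
  have h3 := (hv 3 (by omega) (by omega)).1
  have h4 := (hv 4 (by omega) (by omega)).1
  obtain ⟨h5, h5'⟩ := hv 5 (by omega) (by omega)
  obtain ⟨h6, h6'⟩ := hv 6 (by omega) (by omega)
  have hguard : (Tm.and (.lt (.var 3) (.var 2)) (.and (.lt (.var 4) (.var 2))
      (.not (.eq (.var 3) (.var 4))))).eval w.length s ≠ 0 ↔
      vals 3 < m ∧ vals 4 < m ∧ vals 3 ≠ vals 4 := by
    rw [Tm.eval_and, Tm.eval_and, Tm.eval_not, Tm.eval_lt, Tm.eval_lt, Tm.eval_eq_ne]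
    simp [Tm.eval, hs.m_eq, h3, h4]
  rw [bodyCmd]
  by_cases hg : vals 3 < m ∧ vals 4 < m ∧ vals 3 ≠ vals 4
  swap
  -- Nothing is missed by skipping equal winners: a hit needs a strict preference between c and d.
  · rw [Cmd.sem_ite_neg (mt hguard.1 hg), Cmd.sem_skip, or_iff_left]
    rintro ⟨c, d, hc, hd, -, hp⟩
    refine hg ⟨hc ▸ c.isLt, hd ▸ d.isLt, fun e => ?_⟩
    have : c = d := Fin.ext (by omega)
    subst this
    rw [ite_self] at hp
    exact lt_irrefl _ hp
  rw [Cmd.sem_ite_pos (hguard.2 hg), Cmd.sem_seq, Cmd.sem_seq]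
  obtain ⟨hc, hd, hcd⟩ := hg
  have hctx : Ctx G w ⟨vals 3, hc⟩ ⟨vals 4, hd⟩ (vals 5) (vals 6) s :=
    ⟨hs.word, hs.n_eq, hs.m_eq, ⟨hs.sound, hs.complete⟩, h3, h4, h5, h6⟩
  have hne : (⟨vals 3, hc⟩ : Fin m) ≠ ⟨vals 4, hd⟩ := fun e => hcd (congrArg Fin.val e)
  obtain ⟨s', hs'⟩ : ∃ s', s' = (Cmd.loop 20 (.loop 21 (.loop 22 (.loop 23 stepCmd)))).sem w.length
      (setupCmd.sem w.length s) := ⟨_, rfl⟩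
  have hsearch := hctx.search hw hG hne h5' h6' hs'
  have hctx' : Ctx G w ⟨vals 3, hc⟩ ⟨vals 4, hd⟩ (vals 5) (vals 6) s' :=
    hs' ▸ (hctx.sem _ _ (by decide) (by decide)).sem _ _ (by decide) (by decide)
  have hφs : s'.vars φ = s.vars φ := by
    rw [hs']
    rcases hφ with rfl | rfl <;>
      rw [Cmd.sem_vars _ _ (by decide), Cmd.sem_vars _ _ (by decide)]
  have hhit : IsHit G u v φ vals ↔ G.Outcome u v ⟨vals 3, hc⟩ ⟨vals 4, hd⟩ (vals 5) (vals 6) ∧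
      if φ = 9 then Vote.Prefers (G.V 0) ⟨vals 3, hc⟩ ⟨vals 4, hd⟩
        else Vote.Prefers (G.V 0) ⟨vals 4, hd⟩ ⟨vals 3, hc⟩ := by
    constructor
    · rintro ⟨c, d, hc', hd', h⟩
      have e1 : c = ⟨vals 3, hc⟩ := Fin.ext hc'.symm
      have e2 : d = ⟨vals 4, hd⟩ := Fin.ext hd'.symm
      rwa [← e1, ← e2]
    · exact fun h => ⟨_, _, rfl, rfl, h⟩
  rw [← hs', ← hφs, hhit, recordCmd]
  by_cases hout : G.Outcome u v ⟨vals 3, hc⟩ ⟨vals 4, hd⟩ (vals 5) (vals 6)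
  swap
  · rw [Cmd.sem_ite_neg (mt hsearch.1 hout), Cmd.sem_skip]
    simp [hout]
  rw [Cmd.sem_ite_pos (hsearch.2 hout)]
  have hpref : (Tm.lt (rankOf sincereAt (.var 4)) (rankOf sincereAt (.var 3))).eval w.length s' ≠ 0 ↔
      Vote.Prefers (G.V 0) ⟨vals 4, hd⟩ ⟨vals 3, hc⟩ := by
    rw [Tm.eval_lt,
      hctx'.eval_rankOf (e := .var 4) (e' := ⟨vals 4, hd⟩) hw.sincere
        (fun r => (hctx'.set (by omega)).eval_sincereAt)
        (fun r => (hctx'.set (x := 31) (j := r) (by omega)).d_eq),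
      hctx'.eval_rankOf (e := .var 3) (e' := ⟨vals 3, hc⟩) hw.sincere
        (fun r => (hctx'.set (by omega)).eval_sincereAt)
        (fun r => (hctx'.set (x := 31) (j := r) (by omega)).c_eq)]
    rfl
  by_cases hp : Vote.Prefers (G.V 0) ⟨vals 4, hd⟩ ⟨vals 3, hc⟩
  · have hp' : ¬ Vote.Prefers (G.V 0) ⟨vals 3, hc⟩ ⟨vals 4, hd⟩ := lt_asymm hp
    rw [Cmd.sem_ite_pos (hpref.2 hp), Cmd.sem_set]
    rcases hφ with rfl | rfl <;> simp [hp, hp', hout, Tm.eval]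
  · have hp' : Vote.Prefers (G.V 0) ⟨vals 3, hc⟩ ⟨vals 4, hd⟩ :=
      (lt_trichotomy ((G.V 0).symm ⟨vals 3, hc⟩) ((G.V 0).symm ⟨vals 4, hd⟩)).resolve_right (by
        rintro (e | e)
        · exact hne ((G.V 0).symm.injective e)
        · exact hp e)
    rw [Cmd.sem_ite_neg (mt hpref.1 hp), Cmd.sem_set]
    rcases hφ with rfl | rfl <;> simp [hp, hp', hout, Tm.eval]

theorem layout_encode (hw : w = G.encode u v) : Layout G u v w := by
  obtain ⟨-, -, h1, h2, h3, h4, -⟩ := at_encode G u v hw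
  obtain ⟨h5, h6⟩ := length_bounds G.k_lt_m hw
  refine ⟨h1, h2, h3, ?_, h5, h6⟩
  have := h4.finRange (j := 0) (Nat.pos_of_neZero n)
  simpa using this

/-- The algorithm decides weak dominance. -/
theorem mainCmd_correct (hG : G.OthersMinimal) (hw : w = G.encode u v) :
    (G.WeaklyDominates u v ∧ (mainCmd.sem w.length (initial w)).vars 0 = 1) ∨
      (¬ G.WeaklyDominates u v ∧ (mainCmd.sem w.length (initial w)).vars 0 = 0) := by
  have hl := layout_encode hw
  obtain ⟨hb, h9, h10⟩ := parseCmd_spec G.k_lt_m hw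
  rw [mainCmd, Cmd.sem_seq, Cmd.sem_seq]
  generalize parseCmd.sem w.length (initial w) = s at *
  have hrec := ((((records_bodyCmd hl hG).loop (x := 6) (by omega) (by omega)).loop (x := 5)
    (by omega) (by omega)).loop (x := 4) (by omega) (by omega)).loop (x := 3) (by omega) (by omega)
    (fun _ => 0) s hb (by omega)
  obtain ⟨-, -, hflag⟩ := hrec
  generalize (Cmd.loop 3 (.loop 4 (.loop 5 (.loop 6 bodyCmd)))).sem w.length s = s' at *
  have hmB := hl.m_lt
  have hnB := hl.n_lt
  have key : ∀ φ, φ = 9 ∨ φ = 10 → s.vars φ = 0 → (s'.vars φ ≠ 0 ↔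
      ∃ c d τ τ', τ < n ∧ τ' < n ∧ G.Outcome u v c d τ τ' ∧
        if φ = 9 then Vote.Prefers (G.V 0) c d else Vote.Prefers (G.V 0) d c) := by
    intro φ hφ h0
    rw [hflag φ hφ, h0]
    simp only [ne_eq, not_true_eq_false, false_or]
    constructor
    -- The search runs over all targets below B, but in an outcome they are scores given by the
    -- other voters and hence below n.
    · rintro ⟨c', -, d', -, τ, -, τ', -, c, d, -, -, hout, hp⟩
      obtain ⟨W, -, -, -, h3, h4⟩ := id hout
      exact ⟨c, d, _, _, h3 ▸ GSGame.othersScore_lt 2 W c, h4 ▸ GSGame.othersScore_lt 2 W d, hout, hp⟩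
    · rintro ⟨c, d, τ, τ', hτ, hτ', hout, hp⟩
      refine ⟨c, by omega, d, by omega, τ, by omega, τ', by omega, c, d, by simp, by simp, ?_, hp⟩
      simpa using hout
  have k9 := key 9 (.inl rfl) h9
  have k10 := key 10 (.inr rfl) h10
  simp only [if_true] at k9
  simp only [show ¬ (10 = 9) by omega, if_false] at k10
  rw [GSGame.weaklyDominates_iff, ← k9, ← k10, Cmd.sem_set]
  have e : (Tm.ite (.and (.var 9) (.not (.var 10))) (.num 1) (.num 0)).eval w.length s' =
    if (Tm.and (.var 9) (.not (.var 10))).eval w.length s' ≠ 0 then 1 else 0 := rfl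
  have e' : (Tm.and (.var 9) (.not (.var 10))).eval w.length s' ≠ 0 ↔
      s'.vars 9 ≠ 0 ∧ ¬ s'.vars 10 ≠ 0 := by
    rw [Tm.eval_and, Tm.eval_not]; rfl
  rw [e]
  by_cases hc : ¬ s'.vars 10 ≠ 0 ∧ s'.vars 9 ≠ 0
  · exact .inl ⟨hc, by rw [if_pos (e'.2 hc.symm)]; simp⟩
  · exact .inr ⟨hc, by rw [if_neg (fun h => hc (e'.1 h).symm)]; simp⟩

end Voting.Algorithm

theorem theorem3 :
    ∃ (P : RAM.Prog) (p : Polynomial ℕ),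
      ∀ (n m : ℕ) [NeZero n] [NeZero m] (G : Voting.GSGame 2 n m), G.OthersMinimal →
        ∀ u v : Voting.Vote m,
          P.DecidesWithin (G.encode u v) (G.WeaklyDominates u v)
            (p.eval (RAM.inputSize (G.encode u v))) := by
  obtain ⟨P, p, h⟩ := RAM.Cmd.exists_decidesWithin Voting.Algorithm.mainCmd
  exact ⟨P, p, fun n m _ _ G hG u v => h _ _ (Voting.Algorithm.mainCmd_correct hG rfl)⟩
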